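/- **Setting.** Let $I\subset\mathbb R$ be an open interval and $\alpha<\beta$ with $[\alpha,\beta]\subset I$. Let $D\in C^1(I)$ with $D\ge d>0$ on $I$, and let $f\in C^2(I)$ satisfy $f(\alpha)=f(\beta)=0$, $f'(\alpha)>0$, $f'(\beta)>0$. Put $G(u):=\int_\alpha^u f(s)D(s)\,ds$ and assume $G(\beta)=0$ and $G(u)>0$ for all $u\in I\setminus\{\alpha,\beta\}$. Set $$S_G:=\int_\alpha^\beta\sqrt{2G(u)}\,du,\qquad A_\gamma:=\frac{\sqrt{G''(\gamma)}}{D(\gamma)}\ (\gamma=\alpha,\beta),\qquad A:=\min\{A_\alpha,A_\beta\}.$$ For $\varepsilon,\ell>0$ let $\varphi(\cdot,\ell,+1)$ (resp. $\varphi(\cdot,\ell,-1)$) be the solution on $\mathbb R$, with values in $I$, of $\varepsilon^2(D(\varphi)\varphi')'-f(\varphi)=0$, $\varphi(\pm\ell/2)=\frac{\alpha+\beta}2$, with $\varphi>\frac{\alpha+\beta}2$ (resp. $\varphi<\frac{\alpha+\beta}2$) in $(-\ell/2,\ell/2)$; if there are several, the one whose value at $0$ is closest to $\beta$ (resp. $\alpha$).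 Fix $a<b$, $N\ge1$, and a $C^\infty$ function $\chi:\mathbb R\to[0,1]$ with $\chi=0$ on $(-\infty,-1]$ and $\chi=1$ on $[1,\infty)$. For $\boldsymbol h=(h_1,\dots,h_N)$ put $h_0:=2a-h_1$, $h_{N+1}:=2b-h_N$, $\ell_j:=h_j-h_{j-1}$, $h_{j-1/2}:=\frac12(h_{j-1}+h_j)$, and for $\varepsilon,\rho>0$ let $$\Omega_\rho:=\{\boldsymbol h\in\mathbb R^N:\ a<h_1<\dots<h_N<b,\ \ell_j>\varepsilon/\rho\ \text{ for } j=1,\dots,N+1\}.$$ With $\chi^j(x):=\chi\big(\frac{x-h_j}\varepsilon\big)$ and $\varphi^j(x):=\varphi(x-h_{j-1/2},\ell_j,(-1)^j)$ define, for $j=1,\dots,N$, $$u^{\boldsymbol h}:=(1-\chi^j)\varphi^j+\chi^j\varphi^{j+1}\ \text{ in } [h_{j-1/2},h_{j+1/2}],\qquad u^{\boldsymbol h}_j:=\partial_{h_j}u^{\boldsymbol h},\qquad \tau^{\boldsymbol h}_j:=-\gamma^jD(u^{\boldsymbol h})\,u^{\boldsymbol h}_x,$$ where $\gamma^j(x):=\chi\big(\frac{x-h_{j-1/2}-\varepsilon}\varepsilon\big)\big[1-\chi\big(\frac{x-h_{j+1/2}+\varepsilon}\varepsilon\big)\big]$.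 Let $\langle v,w\rangle:=\int_a^b vw\,dx$, and for $j=1,\dots,N+1$ let $\delta^j:=\varphi(0,\ell_j,-1)-\alpha$ if $j$ is odd and $\delta^j:=\beta-\varphi(0,\ell_j,+1)$ if $j$ is even. **Theorem.** There exist $\bar\rho,C_1,C_2>0$, independent of $\varepsilon,\rho,\boldsymbol h$, such that for all $\varepsilon>0$, $\rho\in(0,\bar\rho)$ and $\boldsymbol h\in\Omega_\rho$ the following holds. The objects above are well defined: the profiles $\varphi(\cdot,\ell_j,(-1)^j)$, $j=1,\dots,N+1$, exist and are unique, $u^{\boldsymbol h}$ is differentiable in $x\in[a,b]$ and in each $h_k$, and the products $u^{\boldsymbol h}_k\tau^{\boldsymbol h}_j$ are integrable on $(a,b)$. Moreover, $$\big|\langle u^{\boldsymbol h}_j,\tau^{\boldsymbol h}_j\rangle-\varepsilon^{-1}S_G\big|\le C_1\varepsilon^{-1}\max\{\delta^j,\delta^{j+1}\}\le C_2\,\varepsilon^{-1}\exp\Big(-\frac{A\min\{\ell_j,\ell_{j+1}\}}{2\varepsilon}\Big),\qquad j=1,\dots,N,$$ $$|\langle u^{\boldsymbol h}_j,\tau^{\boldsymbol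 h}_{j+1}\rangle|+|\langle u^{\boldsymbol h}_{j+1},\tau^{\boldsymbol h}_j\rangle|\le C_1\varepsilon^{-1}\delta^{j+1}\le C_2\,\varepsilon^{-1}\exp\Big(-\frac{A\ell_{j+1}}{2\varepsilon}\Big),\qquad j=1,\dots,N-1,$$ $$\langle u^{\boldsymbol h}_k,\tau^{\boldsymbol h}_j\rangle=0\quad\text{if } |k-j|>1,\qquad k,j=1,\dots,N.$$ -/

import Mathlib

open Set MeasureTheory
open scoped ContDiff

namespace LayerDynamics

/-- The data of the equation `u_t = ε² (D(u) u_x)_x - f(u)` with its standing assumptions: `I` is an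
open interval containing `[α, β]`, the diffusion coefficient `D` is `C¹` and uniformly positive on
`I`, the reaction term `f` is `C²` on `I` and bistable, and the potential
`u ↦ ∫_α^u f D` vanishes at `β` and is positive at every other point of `I` except `α`. -/
structure Bistable where
  I : Set ℝ
  D : ℝ → ℝ
  f : ℝ → ℝ
  α : ℝ
  β : ℝ
  isOpen_I : IsOpen I
  ordConnected_I : I.OrdConnected
  α_lt_β : α < β
  Icc_subset : Icc α β ⊆ I
  contDiffOn_D : ContDiffOn ℝ 1 D I
  D_lower : ∃ d : ℝ, 0 < d ∧ ∀ u ∈ I, d ≤ D u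
  contDiffOn_f : ContDiffOn ℝ 2 f I
  f_α : f α = 0
  f_β : f β = 0
  deriv_f_α : 0 < deriv f α
  deriv_f_β : 0 < deriv f β
  integral_eq_zero : ∫ s in α..β, f s * D s = 0
  integral_pos : ∀ u ∈ I, u ≠ α → u ≠ β → 0 < ∫ s in α..u, f s * D s

/-- A smooth transition function `χ : ℝ → [0, 1]`, equal to `0` on `(-∞, -1]` and to `1` on
`[1, ∞)`. -/
structure Cutoff where
  χ : ℝ → ℝ
  contDiff : ContDiff ℝ ∞ χ
  mem_Icc : ∀ x, χ x ∈ Icc (0 : ℝ) 1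
  eq_zero : ∀ x, x ≤ -1 → χ x = 0
  eq_one : ∀ x, 1 ≤ x → χ x = 1

noncomputable section

/-- The double-well potential `G(u) = ∫_α^u f(s) D(s) ds`. -/
def G (P : Bistable) (u : ℝ) : ℝ := ∫ s in P.α..u, P.f s * P.D s

/-- `S_G = ∫_α^β √(2 G(u)) du`. -/
def SG (P : Bistable) : ℝ := ∫ u in P.α..P.β, Real.sqrt (2 * G P u)

/-- `A_γ = √(G''(γ)) / D(γ)`. -/
def rateAt (P : Bistable) (γ : ℝ) : ℝ := Real.sqrt (deriv (deriv (G P)) γ) / P.D γ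

/-- `A = min {A_α, A_β}`. -/
def rate (P : Bistable) : ℝ := min (rateAt P P.α) (rateAt P P.β)

/-- The threshold value `(α + β) / 2`. -/
def midValue (P : Bistable) : ℝ := (P.α + P.β) / 2

/-- The well on the side `σ = ±1` of the threshold: `β` for `σ = +1` and `α` for `σ = -1`. -/
def well (P : Bistable) (σ : ℝ) : ℝ := if 0 < σ then P.β else P.α

/-- `φ` solves `ε² (D(φ) φ')' - f(φ) = 0` on the real line with values in `I`, takes the value
`(α + β) / 2` at `± ℓ / 2`, and in between lies strictly above (`σ = +1`) or strictly below
(`σ = -1`) this value. -/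
structure IsProfile (P : Bistable) (ε ℓ σ : ℝ) (φ : ℝ → ℝ) : Prop where
  mem_I : ∀ x, φ x ∈ P.I
  differentiable : Differentiable ℝ φ
  differentiable_flux : Differentiable ℝ (fun x => P.D (φ x) * deriv φ x)
  ode : ∀ x, ε ^ 2 * deriv (fun y => P.D (φ y) * deriv φ y) x - P.f (φ x) = 0
  left : φ (-(ℓ / 2)) = midValue P
  right : φ (ℓ / 2) = midValue P
  side : ∀ x ∈ Ioo (-(ℓ / 2)) (ℓ / 2), 0 < σ * (φ x - midValue P)

/-- The profile attached to the well. If `f` has further zeros between the wells then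
`IsProfile` may have further solutions, which stay away from the wells however large `ℓ / ε` is; the
solution meant by `φ(·, ℓ, ±1)` is the one whose value at `0` is close to the well, that is, the one
closest to it. -/
def IsWellProfile (P : Bistable) (ε ℓ σ : ℝ) (φ : ℝ → ℝ) : Prop :=
  IsProfile P ε ℓ σ φ ∧
    ∀ ψ : ℝ → ℝ, IsProfile P ε ℓ σ ψ → |φ 0 - well P σ| ≤ |ψ 0 - well P σ|

/-- The function `φ(·, ℓ, σ)`, for `σ = ±1`. -/
def phi (P : Bistable) (ε ℓ σ : ℝ) : ℝ → ℝ := Classical.epsilon (IsWellProfile P ε ℓ σ)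

section Layers

variable (P : Bistable) (X : Cutoff) (a b : ℝ) (N : ℕ) (ε : ℝ)

/-! A vector of layer positions `(h_1, …, h_N)` is represented by a function `h : ℕ → ℝ`, of which
only the values at `1, …, N` are used. -/

/-- The positions `h_0 = 2a - h_1, h_1, …, h_N, h_{N+1} = 2b - h_N`. -/
def node (h : ℕ → ℝ) (j : ℕ) : ℝ :=
  if j = 0 then 2 * a - h 1 else if j = N + 1 then 2 * b - h N else h j

/-- `ℓ_j = h_j - h_{j-1}`, for `1 ≤ j ≤ N + 1`. -/
def len (h : ℕ → ℝ) (j : ℕ) : ℝ := node a b N h j - node a b N h (j - 1)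

/-- `h_{j-1/2} = (h_{j-1} + h_j) / 2`, for `1 ≤ j ≤ N + 1`. -/
def mid (h : ℕ → ℝ) (j : ℕ) : ℝ := (node a b N h (j - 1) + node a b N h j) / 2

/-- The set `Ω_ρ` of well-separated layer positions. -/
def Omega (ρ : ℝ) : Set (ℕ → ℝ) :=
  {h | a < h 1 ∧ (∀ j, 1 ≤ j → j < N → h j < h (j + 1)) ∧ h N < b ∧
    ∀ j ∈ Finset.Icc 1 (N + 1), ε / ρ < len a b N h j}

/-- `χ^j(x) = χ((x - h_j) / ε)`. -/
def chiJ (h : ℕ → ℝ) (j : ℕ) (x : ℝ) : ℝ := X.χ ((x - h j) / ε)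

/-- `φ^j(x) = φ(x - h_{j-1/2}, h_j - h_{j-1}, (-1)^j)`. -/
def phiJ (h : ℕ → ℝ) (j : ℕ) (x : ℝ) : ℝ :=
  phi P ε (len a b N h j) ((-1) ^ j) (x - mid a b N h j)

/-- `δ^j`: the distance of `φ(0, ℓ_j, (-1)^j)` from the well, that is `φ(0, ℓ_j, -1) - α` for odd
`j` and `β - φ(0, ℓ_j, +1)` for even `j`. -/
def deltaJ (h : ℕ → ℝ) (j : ℕ) : ℝ :=
  if Odd j then phi P ε (len a b N h j) (-1) 0 - P.α else P.β - phi P ε (len a b N h j) 1 0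

/-- The index `j ∈ {1, …, N}` of the cell `I_j = [h_{j-1/2}, h_{j+1/2}]` that contains
`x ∈ [a, b]` (the left one at a common end point). -/
def cellIndex (h : ℕ → ℝ) (x : ℝ) : ℕ :=
  ((Finset.Icc 2 N).filter (fun i => mid a b N h i < x)).card + 1

/-- The function `u^h`, equal to `(1 - χ^j) φ^j + χ^j φ^{j+1}` on the cell `I_j`. -/
def uh (h : ℕ → ℝ) (x : ℝ) : ℝ :=
  (1 - chiJ X ε h (cellIndex a b N h x) x) * phiJ P a b N ε h (cellIndex a b N h x) x
    + chiJ X ε h (cellIndex a b N h x) x * phiJ P a b N ε h (cellIndex a b N h x + 1) x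

/-- `u^h_k = ∂u^h / ∂h_k`. -/
def uhPartial (h : ℕ → ℝ) (k : ℕ) (x : ℝ) : ℝ :=
  deriv (fun t => uh P X a b N ε (Function.update h k t) x) (h k)

/-- The cut-off function `γ^j`. -/
def gammaJ (h : ℕ → ℝ) (j : ℕ) (x : ℝ) : ℝ :=
  X.χ ((x - mid a b N h j - ε) / ε) * (1 - X.χ ((x - mid a b N h (j + 1) + ε) / ε))

/-- The approximate tangent vector `τ^h_j = -γ^j D(u^h) u^h_x`. -/
def tau (h : ℕ → ℝ) (j : ℕ) (x : ℝ) : ℝ :=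
  -gammaJ X a b N ε h j x * P.D (uh P X a b N ε h x) * deriv (uh P X a b N ε h) x

/-- The entry `⟨u^h_k, τ^h_j⟩`, an inner product in `L²(a, b)`. -/
def entry (h : ℕ → ℝ) (k j : ℕ) : ℝ :=
  ∫ x in a..b, uhPartial P X a b N ε h k x * tau P X a b N ε h j x

/-- The objects attached to `h` are well defined: the profiles `φ(·, ℓ_j, (-1)^j)` exist and are
unique, `u^h` is differentiable in `x` and in each `h_k`, and the integrands of the entries
`⟨u^h_k, τ^h_j⟩` are integrable. -/
def WellDefined (h : ℕ → ℝ) : Prop :=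
  (∀ j ∈ Finset.Icc 1 (N + 1), ∃! φ : ℝ → ℝ, IsWellProfile P ε (len a b N h j) ((-1) ^ j) φ) ∧
  (∀ x ∈ Icc a b, DifferentiableAt ℝ (uh P X a b N ε h) x) ∧
  (∀ k ∈ Finset.Icc 1 N, ∀ x ∈ Icc a b,
    DifferentiableAt ℝ (fun t => uh P X a b N ε (Function.update h k t) x) (h k)) ∧
  (∀ k ∈ Finset.Icc 1 N, ∀ j ∈ Finset.Icc 1 N, IntervalIntegrable
    (fun x => uhPartial P X a b N ε h k x * tau P X a b N ε h j x) volume a b)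

end Layers

end

end LayerDynamics

/-!
The function `u^h` is made of stationary profiles `φ(·, ℓ_j, ±1)`, and everything rests on how close
such a profile is to a heteroclinic orbit when `ℓ_j / ε` is large.

The Kirchhoff transform `v = ∫_α^φ D` and the scaling `t = x / ε` turn the profile equation into
`v'' = F(v)` with `F = f ∘ (Kirchhoff)⁻¹`. Outside `[α, β]`, `f` is extended affinely and `D` by
constants, so that the flow is complete and differentiable; profiles never leave `(α, β)`, by
conservation of energy and uniqueness. On the side `σ = ±1` of the threshold, `U = σ v` leaves the
threshold `m` with a velocity `s`, approaches a hyperbolic equilibrium `B`, turns back at the time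
`turn s` and is symmetric about it (`Well`, `Bistable.toWell`). A profile of half-period
`τ = ℓ / (2ε)` is an orbit with `turn s = τ`.

Two facts about orbits with `s` slightly below the velocity `hetVel` of the heteroclinic orbit carry
the proof. The distance `gap s` of the turning point from `B` is at most a multiple of
`exp(-A turn s)` (`Well.Near.gap_le`). And `turn` is strictly increasing, with the derivative
`w'(turn s) / (-F)`, where `w` is the linearized solution and `F` is taken at the turning point: the
Wronskian of `w` and the velocity equals `s`, which makes `w(turn s) = s / (-F)` large, of order
`1 / gap s`, and `w` grows exponentially near `B` (`Well.Near.le_linVel_turn`). Hence the orbits can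
be parametrized by their turning time, there is exactly one profile close to the well
(`Bistable.isWellProfile_iff`), and its derivative in `τ` is bounded by a multiple of the gap
(`Well.abs_lin_mul_startDeriv_le`). Moreover, the energy identity shows that `∫ D(φ) φ'^2` over half
a period differs from that of the heteroclinic orbit by a multiple of the gap
(`Well.Near.abs_integral_vel_sq_sub_le`), and the latter is one of two parts of `S_G`. The gap is
comparable to `δ`.

In the coordinate `z = (x - h_j) / ε` the function `u^h` is a convex combination of two profiles
which, for `|z| ≤ 1`, come from the same flow with initial velocities that differ by a multiple of
`δ^j + δ^{j+1}` (`Bistable.exists_interface_bound`). So its action on the cell is `S_G` up to such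
an error (`Bistable.exists_full_layer_bound`). Differentiating `u^h` in `h_k` moves the node `j` by
`nodeDeriv N k j`, which contributes `-nodeDeriv N k j · u^h_x`, and changes the two adjacent
lengths, which contributes terms with the `τ`-derivatives of the profiles. Since `τ^h_j` vanishes
outside the cell of `h_j`, each entry is `ε⁻¹ nodeDeriv N k j S_G` up to an error in which `δ^j` and
`δ^{j+1}` are weighted by the derivatives of the lengths `ℓ_j` and `ℓ_{j+1}` in `h_k`
(`Bistable.exists_entry_bound`); the theorem reads this off for `k = j`, `|k - j| = 1` and
`|k - j| > 1`.
-/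

namespace LayerDynamics

/-! ### Second-order scalar equations with globally Lipschitz right-hand side -/

theorem hasDerivAt_comp_neg {e : ℝ → ℝ} {e' t : ℝ} (h : HasDerivAt e e' (-t)) :
    HasDerivAt (fun t => e (-t)) (-e') t := by
  simpa [Function.comp_def] using HasDerivAt.comp t h (hasDerivAt_neg t)

/-- Grönwall's inequality for a second-order scalar equation, on an interval starting at `0`. -/
theorem gronwall_right {e g g' : ℝ → ℝ} {K R δ τ : ℝ} (hK : 1 ≤ K) (hR : 0 ≤ R)
    (he : ∀ t ∈ Icc 0 τ, HasDerivAt e (g t) t) (hg : ∀ t ∈ Icc 0 τ, HasDerivAt g (g' t) t)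
    (hb : ∀ t ∈ Icc 0 τ, |g' t| ≤ K * |e t| + R) (h0 : |e 0| ≤ δ) (h0' : |g 0| ≤ δ) :
    ∀ t ∈ Icc 0 τ, |e t| ≤ (δ + R) * Real.exp (K * t) ∧ |g t| ≤ (δ + R) * Real.exp (K * t) := by
  have hd : ∀ t ∈ Icc 0 τ, HasDerivAt (fun t => (e t, g t)) (g t, g' t) t :=
    fun t ht => (he t ht).prodMk (hg t ht)
  have key := norm_le_gronwallBound_of_norm_deriv_right_le (f := fun t => (e t, g t))
    (f' := fun t => (g t, g' t)) (δ := δ) (K := K) (ε := R) (a := 0) (b := τ)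
    (fun t ht => (hd t ht).continuousAt.continuousWithinAt)
    (fun t ht => (hd t (Ico_subset_Icc_self ht)).hasDerivWithinAt)
    (by simpa [Prod.norm_def] using ⟨h0, h0'⟩)
    (fun t ht => by
      simp only [Prod.norm_def, Real.norm_eq_abs]
      have h1 := le_max_left |e t| |g t|
      have h2 := le_max_right |e t| |g t|
      have h3 := hb t (Ico_subset_Icc_self ht)
      apply max_le <;> nlinarith [abs_nonneg (e t), abs_nonneg (g t)])
  intro t ht
  have h := key t ht
  have hle : gronwallBound δ K R (t - 0) ≤ (δ + R) * Real.exp (K * t) := by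
    rw [gronwallBound_of_K_ne_0 (by positivity), sub_zero]
    have h1 : R / K ≤ R := div_le_self hR hK
    have h2 : 1 ≤ Real.exp (K * t) := Real.one_le_exp (mul_nonneg (by positivity) ht.1)
    have : R / K * (Real.exp (K * t) - 1) ≤ R * (Real.exp (K * t) - 1) :=
      mul_le_mul_of_nonneg_right h1 (by linarith)
    nlinarith
  simp only [Prod.norm_def, Real.norm_eq_abs] at h
  exact ⟨(le_max_left _ _).trans (h.trans hle), (le_max_right _ _).trans (h.trans hle)⟩

/-- Two-sided version of `gronwall_right`. -/
theorem gronwall_abs {e g g' : ℝ → ℝ} {K R δ τ : ℝ} (hK : 1 ≤ K) (hR : 0 ≤ R)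
    (he : ∀ t, |t| ≤ τ → HasDerivAt e (g t) t) (hg : ∀ t, |t| ≤ τ → HasDerivAt g (g' t) t)
    (hb : ∀ t, |t| ≤ τ → |g' t| ≤ K * |e t| + R) (h0 : |e 0| ≤ δ) (h0' : |g 0| ≤ δ) :
    ∀ t, |t| ≤ τ →
      |e t| ≤ (δ + R) * Real.exp (K * |t|) ∧ |g t| ≤ (δ + R) * Real.exp (K * |t|) := by
  have hmem : ∀ t ∈ Icc 0 τ, |t| ≤ τ := fun t ht => by rw [abs_of_nonneg ht.1]; exact ht.2
  have hmem' : ∀ t ∈ Icc 0 τ, |-t| ≤ τ := fun t ht => by rw [abs_neg]; exact hmem t ht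
  intro t ht
  rcases le_total 0 t with h | h
  · rw [abs_of_nonneg h] at ht ⊢
    exact gronwall_right hK hR (fun t ht => he t (hmem t ht)) (fun t ht => hg t (hmem t ht))
      (fun t ht => hb t (hmem t ht)) h0 h0' t ⟨h, ht⟩
  · have := gronwall_right (e := fun t => e (-t)) (g := fun t => -g (-t)) (g' := fun t => g' (-t))
      (τ := τ) hK hR
      (fun t ht => hasDerivAt_comp_neg (he (-t) (hmem' t ht)))
      (fun t ht => by simpa using (hasDerivAt_comp_neg (hg (-t) (hmem' t ht))).fun_neg)
      (fun t ht => hb _ (hmem' t ht)) (by simpa using h0) (by simpa using h0') (-t)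
      ⟨by linarith, by rwa [abs_of_nonpos h] at ht⟩
    rw [abs_of_nonpos h]
    simpa using this

/-- Truncation of a real number to `[-R, R]`. -/
def clip (R x : ℝ) : ℝ := max (-R) (min R x)

theorem lipschitzWith_clip (R : ℝ) : LipschitzWith 1 (clip R) :=
  (LipschitzWith.id.const_min R).const_max (-R)

theorem clip_of_abs_le {R x : ℝ} (h : |x| ≤ R) : clip R x = x := by
  rw [clip, min_eq_right (abs_le.1 h).2, max_eq_right (abs_le.1 h).1]

theorem abs_clip_le {R : ℝ} (hR : 0 ≤ R) (x : ℝ) : |clip R x| ≤ R := by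
  rw [clip, abs_le]
  exact ⟨le_max_left _ _, max_le (by linarith) (min_le_left _ _)⟩

theorem abs_clip_le_abs {R : ℝ} (hR : 0 ≤ R) (x : ℝ) : |clip R x| ≤ |x| := by
  rw [clip]
  rcases le_total R x with h | h
  · rw [min_eq_left h, max_eq_right (by linarith)]
    exact abs_le_abs_of_nonneg hR h
  · rw [min_eq_right h]
    rcases le_total (-R) x with h' | h'
    · rw [max_eq_right h']
    · rw [max_eq_left h', abs_neg, abs_of_nonneg hR]
      exact le_trans (by linarith) (neg_le_abs x)

/-- Solutions of `x'' = f(t, x)` exist on every bounded interval if `f` is Lipschitz in `x`. The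
right-hand side is truncated to apply the Picard-Lindelöf theorem with a bounded vector field; the
a priori bound of Grönwall's inequality shows that the truncation is never active. -/
theorem exists_solution_Icc {f : ℝ → ℝ → ℝ} {K L : ℝ} (hK : 1 ≤ K) (hL : 0 ≤ L)
    (hf : ∀ x, Continuous fun t => f t x) (hlip : ∀ t x y, |f t x - f t y| ≤ K * |x - y|)
    (hbd : ∀ t, |f t 0| ≤ L) (x₀ v₀ : ℝ) {T : ℝ} (hT : 0 < T) :
    ∃ x v : ℝ → ℝ, x 0 = x₀ ∧ v 0 = v₀ ∧ ∀ t, |t| ≤ T →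
      HasDerivAt x (v t) t ∧ HasDerivAt v (f t (x t)) t := by
  set δ := max |x₀| |v₀| with hδ
  set R := (δ + L) * Real.exp (K * T) with hR
  have hδ0 : 0 ≤ δ := (abs_nonneg _).trans (le_max_left _ _)
  have hR0 : 0 ≤ R := by positivity
  have hfb : ∀ t x, |f t x| ≤ K * |x| + L := fun t x => by
    have h1 := hlip t x 0
    have h2 := hbd t
    rw [sub_zero] at h1
    calc |f t x| = |(f t x - f t 0) + f t 0| := by ring_nf
      _ ≤ _ := (abs_add_le _ _).trans (by linarith)
  -- both components of the vector field are truncated, which makes it bounded and Lipschitz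
  let F : ℝ → ℝ × ℝ → ℝ × ℝ := fun t q => (clip R q.2, f t (clip R q.1))
  have hT' : (0 : ℝ) ∈ Icc (-(T + 1)) (T + 1) := ⟨by linarith, by linarith⟩
  have hPL : IsPicardLindelof F (tmin := -(T + 1)) (tmax := T + 1) ⟨0, hT'⟩ (x₀, v₀)
      ((R + K * R + L) * (T + 1)).toNNReal 0 (R + K * R + L).toNNReal K.toNNReal := by
    refine ⟨fun t _ => LipschitzWith.lipschitzOnWith ?_, fun q _ => ?_, fun t _ q _ => ?_, ?_⟩
    · refine LipschitzWith.of_dist_le_mul fun p q => ?_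
      rw [Real.coe_toNNReal _ (by linarith), Prod.dist_eq, Prod.dist_eq]
      simp only [F, Real.dist_eq]
      have c1 := (lipschitzWith_clip R).dist_le_mul p.1 q.1
      have c2 := (lipschitzWith_clip R).dist_le_mul p.2 q.2
      simp only [Real.dist_eq, NNReal.coe_one, one_mul] at c1 c2
      have h1 := le_max_left |p.1 - q.1| |p.2 - q.2|
      have h2 := le_max_right |p.1 - q.1| |p.2 - q.2|
      have h3 := hlip t (clip R p.1) (clip R q.1)
      apply max_le <;> nlinarith [abs_nonneg (p.1 - q.1), abs_nonneg (p.2 - q.2)]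
    · exact (continuous_const.prodMk (hf _)).continuousOn
    · rw [Real.coe_toNNReal _ (by positivity), Prod.norm_def]
      simp only [F, Real.norm_eq_abs]
      have h1 := abs_clip_le hR0 q.1
      have h2 := abs_clip_le hR0 q.2
      have h3 := hfb t (clip R q.1)
      apply max_le <;> nlinarith [mul_le_mul_of_nonneg_left h1 (by linarith : 0 ≤ K)]
    · rw [Real.coe_toNNReal _ (by positivity), Real.coe_toNNReal _ (by positivity)]
      simp
  obtain ⟨q, hq0, hq⟩ := hPL.exists_eq_forall_mem_Icc_hasDerivWithinAt₀
  have hq' : ∀ t, |t| ≤ T → HasDerivAt q (F t (q t)) t := fun t ht =>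
    (hq t ⟨by linarith [(abs_le.1 ht).1], by linarith [(abs_le.1 ht).2]⟩).hasDerivAt
      (Icc_mem_nhds (by linarith [(abs_le.1 ht).1]) (by linarith [(abs_le.1 ht).2]))
  have hx : ∀ t, |t| ≤ T → HasDerivAt (fun t => (q t).1) (clip R (q t).2) t := fun t ht =>
    (hasFDerivAt_fst (𝕜 := ℝ) (E := ℝ) (F := ℝ) (p := q t)).comp_hasDerivAt t (hq' t ht)
  have hv : ∀ t, |t| ≤ T → HasDerivAt (fun t => (q t).2) (f t (clip R (q t).1)) t := fun t ht =>
    (hasFDerivAt_snd (𝕜 := ℝ) (E := ℝ) (F := ℝ) (p := q t)).comp_hasDerivAt t (hq' t ht)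
  have hq0' : q 0 = (x₀, v₀) := hq0
  -- the a priori bound, from Grönwall's inequality for the pair `(x, v)`
  have hbound : ∀ t, |t| ≤ T → |(q t).1| ≤ R ∧ |(q t).2| ≤ R := by
    have main : ∀ (r : ℝ → ℝ × ℝ) (r' : ℝ → ℝ × ℝ), (∀ t ∈ Icc 0 T, HasDerivAt r (r' t) t) →
        (∀ t ∈ Icc 0 T, ‖r' t‖ ≤ K * ‖r t‖ + L) → r 0 = (x₀, v₀) → ∀ t ∈ Icc 0 T, ‖r t‖ ≤ R := by
      intro r r' hr hr' h0 t ht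
      have := norm_le_gronwallBound_of_norm_deriv_right_le (f := r) (f' := r') (δ := δ) (K := K)
        (ε := L) (a := 0) (b := T) (fun t ht => (hr t ht).continuousAt.continuousWithinAt)
        (fun t ht => (hr t (Ico_subset_Icc_self ht)).hasDerivWithinAt)
        (by rw [h0]; simp [Prod.norm_def, hδ])
        (fun t ht => hr' t (Ico_subset_Icc_self ht)) t ht
      refine this.trans ?_
      rw [gronwallBound_of_K_ne_0 (by positivity), sub_zero]
      have h1 : L / K ≤ L := div_le_self hL hK
      have h2 : 1 ≤ Real.exp (K * t) := Real.one_le_exp (mul_nonneg (by positivity) ht.1)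
      have h3 : L / K * (Real.exp (K * t) - 1) ≤ L * (Real.exp (K * t) - 1) :=
        mul_le_mul_of_nonneg_right h1 (by linarith)
      have h4 : Real.exp (K * t) ≤ Real.exp (K * T) :=
        Real.exp_le_exp.2 (mul_le_mul_of_nonneg_left ht.2 (by linarith))
      rw [hR]
      nlinarith [mul_le_mul_of_nonneg_left h4 (by linarith : 0 ≤ δ + L)]
    have hFb : ∀ t (p : ℝ × ℝ), ‖F t p‖ ≤ K * ‖p‖ + L := by
      intro t p
      simp only [F, Prod.norm_def, Real.norm_eq_abs]
      have h1 := le_max_left |p.1| |p.2|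
      have h2 := le_max_right |p.1| |p.2|
      have h3 := hfb t (clip R p.1)
      have h4 := abs_clip_le_abs hR0 p.1
      have h5 := abs_clip_le_abs hR0 p.2
      apply max_le <;> nlinarith [abs_nonneg p.1, abs_nonneg p.2]
    intro t ht
    have hn : ‖q t‖ ≤ R := by
      rcases le_total 0 t with h | h
      · rw [abs_of_nonneg h] at ht
        exact main q _ (fun t ht => hq' t (by rw [abs_of_nonneg ht.1]; exact ht.2))
          (fun t _ => hFb t _) hq0' t ⟨h, ht⟩
      · rw [abs_of_nonpos h] at ht
        have := main (fun t => q (-t)) (fun t => -F (-t) (q (-t)))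
          (fun t ht => (hq' (-t) (by rw [abs_neg, abs_of_nonneg ht.1]; exact ht.2)).scomp t
            (hasDerivAt_neg t) |>.congr_deriv (by simp))
          (fun t _ => by rw [norm_neg]; exact hFb _ _) (by simpa using hq0') (-t)
          ⟨by linarith, ht⟩
        simpa using this
    rw [Prod.norm_def] at hn
    exact ⟨(le_max_left _ _).trans hn, (le_max_right _ _).trans hn⟩
  refine ⟨fun t => (q t).1, fun t => (q t).2, by simp [hq0'], by simp [hq0'], fun t ht => ⟨?_, ?_⟩⟩
  · have := hx t ht
    rwa [clip_of_abs_le (hbound t ht).2] at this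
  · have := hv t ht
    rwa [clip_of_abs_le (hbound t ht).1] at this

/-- Uniqueness for `x'' = f(t, x)` on a symmetric interval. -/
theorem eq_of_solution_abs {f : ℝ → ℝ → ℝ} {K τ : ℝ} (hK : 1 ≤ K)
    (hlip : ∀ t x y, |f t x - f t y| ≤ K * |x - y|) {x v y w : ℝ → ℝ}
    (hx : ∀ t, |t| ≤ τ → HasDerivAt x (v t) t ∧ HasDerivAt v (f t (x t)) t)
    (hy : ∀ t, |t| ≤ τ → HasDerivAt y (w t) t ∧ HasDerivAt w (f t (y t)) t)
    (h0 : x 0 = y 0) (h0' : v 0 = w 0) : ∀ t, |t| ≤ τ → x t = y t ∧ v t = w t := by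
  intro t ht
  have := gronwall_abs (e := fun t => x t - y t) (g := fun t => v t - w t)
    (g' := fun t => f t (x t) - f t (y t)) (δ := 0) (R := 0) hK le_rfl
    (fun t ht => (hx t ht).1.sub (hy t ht).1) (fun t ht => (hx t ht).2.sub (hy t ht).2)
    (fun t _ => by simpa using hlip t _ _) (by simp [h0]) (by simp [h0']) t ht
  simp only [add_zero, zero_mul, abs_nonpos_iff, sub_eq_zero] at this
  exact this

/-- Uniqueness for `x'' = f(t, x)` on the real line. -/
theorem eq_of_solution {f : ℝ → ℝ → ℝ} {K : ℝ} (hK : 1 ≤ K)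
    (hlip : ∀ t x y, |f t x - f t y| ≤ K * |x - y|) {x v y w : ℝ → ℝ}
    (hx : ∀ t, HasDerivAt x (v t) t ∧ HasDerivAt v (f t (x t)) t)
    (hy : ∀ t, HasDerivAt y (w t) t ∧ HasDerivAt w (f t (y t)) t)
    (h0 : x 0 = y 0) (h0' : v 0 = w 0) (t : ℝ) : x t = y t ∧ v t = w t :=
  eq_of_solution_abs (τ := |t|) hK hlip (fun t _ => hx t) (fun t _ => hy t) h0 h0' t le_rfl

/-- Global existence for `x'' = f(t, x)` with `f` Lipschitz in `x`. -/
theorem exists_solution {f : ℝ → ℝ → ℝ} {K L : ℝ} (hK : 1 ≤ K) (hL : 0 ≤ L)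
    (hf : ∀ x, Continuous fun t => f t x) (hlip : ∀ t x y, |f t x - f t y| ≤ K * |x - y|)
    (hbd : ∀ t, |f t 0| ≤ L) (x₀ v₀ : ℝ) :
    ∃ x v : ℝ → ℝ, x 0 = x₀ ∧ v 0 = v₀ ∧ ∀ t,
      HasDerivAt x (v t) t ∧ HasDerivAt v (f t (x t)) t := by
  have hex : ∀ n : ℕ, ∃ x v : ℝ → ℝ, x 0 = x₀ ∧ v 0 = v₀ ∧ ∀ t, |t| ≤ (n : ℝ) + 1 →
      HasDerivAt x (v t) t ∧ HasDerivAt v (f t (x t)) t := fun n =>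
    exists_solution_Icc hK hL hf hlip hbd x₀ v₀ (by positivity)
  choose X V hX0 hV0 hXV using hex
  -- the solutions on the intervals `[-(n + 1), n + 1]` extend each other, by uniqueness
  have hagree : ∀ m n : ℕ, m ≤ n → ∀ t, |t| ≤ (m : ℝ) + 1 → X m t = X n t ∧ V m t = V n t := by
    intro m n hmn
    have hmn' : (m : ℝ) ≤ n := by exact_mod_cast hmn
    exact eq_of_solution_abs hK hlip (hXV m) (fun t ht => hXV n t (by linarith))
      (by rw [hX0, hX0]) (by rw [hV0, hV0])
  have hloc : ∀ (n : ℕ) (t : ℝ), |t| ≤ (n : ℝ) + 1 →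
      X ⌊|t|⌋₊ t = X n t ∧ V ⌊|t|⌋₊ t = V n t := by
    intro n t ht
    rcases le_total ⌊|t|⌋₊ n with h | h
    · exact hagree _ _ h t (Nat.lt_floor_add_one _).le
    · exact ⟨(hagree _ _ h t ht).1.symm, (hagree _ _ h t ht).2.symm⟩
  refine ⟨fun t => X ⌊|t|⌋₊ t, fun t => V ⌊|t|⌋₊ t, by simp [hX0], by simp [hV0], fun t => ?_⟩
  set n := ⌊|t|⌋₊ with hn
  have hlt : |t| < (n : ℝ) + 1 := Nat.lt_floor_add_one _
  have hev : ∀ᶠ r in nhds t, |r| ≤ (n : ℝ) + 1 :=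
    (continuous_abs.continuousAt.eventually_lt continuousAt_const hlt).mono fun r hr => hr.le
  have := hXV n t hlt.le
  exact ⟨this.1.congr_of_eventuallyEq (hev.mono fun r hr => (hloc n r hr).1),
    this.2.congr_of_eventuallyEq (hev.mono fun r hr => (hloc n r hr).2)⟩

/-! ### The flow of `x'' = F(x)` and its linearization -/

/-- A force `F` with potential `-H` on the real line, as seen from a point `m` with the hyperbolic
equilibrium `B` on its right: `F B = 0`, `F' B = A²`, and `H` is positive between its zeros `lo` and
`B`. The force is globally Lipschitz with a Lipschitz derivative, so that its flow is complete and
differentiable. -/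
structure Well where
  F : ℝ → ℝ
  F' : ℝ → ℝ
  H : ℝ → ℝ
  lo : ℝ
  m : ℝ
  B : ℝ
  A : ℝ
  K : ℝ
  K₂ : ℝ
  lo_lt : lo < m
  m_lt : m < B
  A_pos : 0 < A
  one_le_K : 1 ≤ K
  K₂_nonneg : 0 ≤ K₂
  hasDerivAt_F : ∀ u, HasDerivAt F (F' u) u
  abs_F'_le : ∀ u, |F' u| ≤ K
  F'_lip : ∀ u v, |F' u - F' v| ≤ K₂ * |u - v|
  hasDerivAt_H : ∀ u, HasDerivAt H (F u) u
  F_B : F B = 0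
  F'_B : F' B = A ^ 2
  H_lo : H lo = 0
  H_B : H B = 0
  H_pos : ∀ u ∈ Ioo lo B, 0 < H u

/-- A function of two variables is differentiable if it has a first-order expansion in the first one
with a quadratic remainder, locally uniformly in the second one, and is differentiable in the second
one. -/
theorem hasFDerivAt_of_expansion {g : ℝ → ℝ → ℝ} {a : ℝ → ℝ} {s t b C : ℝ}
    (h : ∀ t', |t'| ≤ |t| + 1 → ∀ s', |g s' t' - g s t' - a t' * (s' - s)| ≤ C * (s' - s) ^ 2)
    (ha : ContinuousAt a t) (hb : HasDerivAt (g s) b t) :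
    HasFDerivAt (fun q : ℝ × ℝ => g q.1 q.2)
      (a t • ContinuousLinearMap.fst ℝ ℝ ℝ + b • ContinuousLinearMap.snd ℝ ℝ ℝ) (s, t) := by
  have h1 : HasFDerivAt (fun q : ℝ × ℝ => g s q.2) (b • ContinuousLinearMap.snd ℝ ℝ ℝ) (s, t) := by
    have := HasDerivAt.comp_hasFDerivAt (s, t) (h₂ := g s) (f := Prod.snd) hb
      (hasFDerivAt_snd (𝕜 := ℝ) (E := ℝ) (F := ℝ))
    exact this
  have h2 : HasFDerivAt (fun q : ℝ × ℝ => a t * (q.1 - s))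
      (a t • ContinuousLinearMap.fst ℝ ℝ ℝ) (s, t) :=
    ((hasFDerivAt_fst (𝕜 := ℝ) (E := ℝ) (F := ℝ)).sub_const s).const_mul (a t)
  have hfst : (fun q : ℝ × ℝ => q.1 - s) =O[nhds (s, t)] fun q => q - (s, t) :=
    Asymptotics.IsBigO.of_bound 1 (Filter.Eventually.of_forall fun q => by
      rw [one_mul]; exact norm_fst_le (q - (s, t)))
  have ht0 : Filter.Tendsto (fun q : ℝ × ℝ => q.1 - s) (nhds (s, t)) (nhds 0) := by
    have : Continuous fun q : ℝ × ℝ => q.1 - s := by fun_prop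
    simpa using this.tendsto (s, t)
  -- the variation of the slope `a` in time only gives a term of higher order
  have h3 : HasFDerivAt (fun q : ℝ × ℝ => (a q.2 - a t) * (q.1 - s)) (0 : ℝ × ℝ →L[ℝ] ℝ) (s, t) := by
    rw [hasFDerivAt_iff_isLittleO]
    have hlim : Filter.Tendsto (fun q : ℝ × ℝ => a q.2 - a t) (nhds (s, t)) (nhds 0) := by
      have hc : ContinuousAt (fun q : ℝ × ℝ => a q.2) (s, t) :=
        ContinuousAt.comp (g := a) (f := Prod.snd) (x := (s, t)) ha continuousAt_snd
      simpa using hc.tendsto.sub_const (a t)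
    have := ((Asymptotics.isLittleO_one_iff ℝ).2 hlim).mul_isBigO hfst.norm_right
    simpa using this
  have h4 : HasFDerivAt (fun q : ℝ × ℝ => g q.1 q.2 - g s q.2 - a q.2 * (q.1 - s))
      (0 : ℝ × ℝ →L[ℝ] ℝ) (s, t) := by
    rw [hasFDerivAt_iff_isLittleO]
    have hO : (fun q : ℝ × ℝ => g q.1 q.2 - g s q.2 - a q.2 * (q.1 - s)) =O[nhds (s, t)]
        fun q => (q.1 - s) * (q.1 - s) := by
      refine Asymptotics.IsBigO.of_bound C ?_
      have hc : Continuous fun q : ℝ × ℝ => |q.2| := by fun_prop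
      have hev : ∀ᶠ q : ℝ × ℝ in nhds (s, t), |q.2| < |t| + 1 :=
        hc.continuousAt.eventually_lt continuousAt_const (by simp)
      filter_upwards [hev] with q hq
      have := h q.2 hq.le q.1
      rw [Real.norm_eq_abs, Real.norm_eq_abs, abs_mul_self, ← sq]
      exact this
    have := hO.trans_isLittleO
      (((Asymptotics.isLittleO_one_iff ℝ).2 ht0).mul_isBigO hfst.norm_right)
    simpa using this
  have := ((h1.add h2).add h3).add h4
  refine (this.congr_fderiv (by simp [add_comm])).congr_of_eventuallyEq
    (Filter.Eventually.of_forall fun q => ?_)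
  simp only [Pi.add_apply]
  ring

namespace Well

variable (W : Well)

theorem abs_F_sub_le (x y : ℝ) : |W.F x - W.F y| ≤ W.K * |x - y| := by
  simpa using convex_univ.norm_image_sub_le_of_norm_hasDerivWithin_le (f := W.F) (f' := W.F')
    (C := W.K) (fun x _ => (W.hasDerivAt_F x).hasDerivWithinAt) (fun x _ => W.abs_F'_le x)
    (mem_univ y) (mem_univ x)

theorem abs_F_sub_sub_le (x y : ℝ) :
    |W.F y - W.F x - W.F' x * (y - x)| ≤ W.K₂ * (y - x) ^ 2 := by
  have := (convex_uIcc x y).norm_image_sub_le_of_norm_hasDerivWithin_le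
    (f := fun u => W.F u - W.F' x * u) (f' := fun u => W.F' u - W.F' x) (C := W.K₂ * |y - x|)
    (fun u _ => ((W.hasDerivAt_F u).sub
      (by simpa using (hasDerivAt_id u).const_mul (W.F' x))).hasDerivWithinAt)
    (fun u hu => (W.F'_lip u x).trans
      (mul_le_mul_of_nonneg_left (abs_sub_left_of_mem_uIcc hu) W.K₂_nonneg))
    left_mem_uIcc right_mem_uIcc
  rw [Real.norm_eq_abs, Real.norm_eq_abs, mul_assoc, abs_mul_abs_self, ← sq] at this
  convert this using 2
  ring

theorem continuous_H : Continuous W.H :=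
  continuous_iff_continuousAt.2 fun u => (W.hasDerivAt_H u).continuousAt

theorem continuous_F' : Continuous W.F' :=
  (LipschitzWith.of_dist_le_mul (K := W.K₂.toNNReal) fun u v => by
    rw [Real.coe_toNNReal _ W.K₂_nonneg]; exact W.F'_lip u v).continuous

theorem K_pos : 0 < W.K := one_pos.trans_le W.one_le_K

theorem exists_flow (s : ℝ) : ∃ x v : ℝ → ℝ, x 0 = W.m ∧ v 0 = s ∧ ∀ t,
    HasDerivAt x (v t) t ∧ HasDerivAt v (W.F (x t)) t :=
  exists_solution (f := fun _ x => W.F x) (L := |W.F 0|) W.one_le_K (abs_nonneg _)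
    (fun _ => continuous_const) (fun _ => W.abs_F_sub_le) (fun _ => le_rfl) W.m s

/-- The position at time `t` of the solution of `x'' = F(x)` which leaves `m` with velocity `s`. -/
noncomputable def pos (s : ℝ) : ℝ → ℝ := (W.exists_flow s).choose

/-- The velocity at time `t` of the solution of `x'' = F(x)` which leaves `m` with velocity `s`. -/
noncomputable def vel (s : ℝ) : ℝ → ℝ := (W.exists_flow s).choose_spec.choose

theorem pos_zero (s : ℝ) : W.pos s 0 = W.m := (W.exists_flow s).choose_spec.choose_spec.1

theorem vel_zero (s : ℝ) : W.vel s 0 = s := (W.exists_flow s).choose_spec.choose_spec.2.1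

theorem hasDerivAt_pos (s t : ℝ) : HasDerivAt (W.pos s) (W.vel s t) t :=
  ((W.exists_flow s).choose_spec.choose_spec.2.2 t).1

theorem hasDerivAt_vel (s t : ℝ) : HasDerivAt (W.vel s) (W.F (W.pos s t)) t :=
  ((W.exists_flow s).choose_spec.choose_spec.2.2 t).2

theorem continuous_pos (s : ℝ) : Continuous (W.pos s) :=
  continuous_iff_continuousAt.2 fun t => (W.hasDerivAt_pos s t).continuousAt

theorem continuous_vel (s : ℝ) : Continuous (W.vel s) :=
  continuous_iff_continuousAt.2 fun t => (W.hasDerivAt_vel s t).continuousAt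

/-- Solutions of `x'' = F(x)` on an interval starting at `0` are determined by their data at `0`. -/
theorem eqOn_of_solution {x v y w : ℝ → ℝ} {τ : ℝ}
    (hx : ∀ t ∈ Icc 0 τ, HasDerivAt x (v t) t ∧ HasDerivAt v (W.F (x t)) t)
    (hy : ∀ t ∈ Icc 0 τ, HasDerivAt y (w t) t ∧ HasDerivAt w (W.F (y t)) t)
    (h0 : x 0 = y 0) (h0' : v 0 = w 0) {t : ℝ} (ht : t ∈ Icc 0 τ) : x t = y t := by
  have := gronwall_right (e := fun t => x t - y t) (g := fun t => v t - w t)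
    (g' := fun t => W.F (x t) - W.F (y t)) (δ := 0) (R := 0) W.one_le_K le_rfl
    (fun t ht => (hx t ht).1.sub (hy t ht).1) (fun t ht => (hx t ht).2.sub (hy t ht).2)
    (fun t _ => by simpa using W.abs_F_sub_le _ _) (by simp [h0]) (by simp [h0']) t ht
  simp only [add_zero, zero_mul, abs_nonpos_iff, sub_eq_zero] at this
  exact this.1

theorem eq_of_solution {x v y w : ℝ → ℝ}
    (hx : ∀ t, HasDerivAt x (v t) t ∧ HasDerivAt v (W.F (x t)) t)
    (hy : ∀ t, HasDerivAt y (w t) t ∧ HasDerivAt w (W.F (y t)) t)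
    (h0 : x 0 = y 0) (h0' : v 0 = w 0) (t : ℝ) : x t = y t ∧ v t = w t :=
  LayerDynamics.eq_of_solution (f := fun _ x => W.F x) W.one_le_K (fun _ => W.abs_F_sub_le) hx hy
    h0 h0' t

theorem exists_lin (s : ℝ) : ∃ x v : ℝ → ℝ, x 0 = 0 ∧ v 0 = 1 ∧ ∀ t,
    HasDerivAt x (v t) t ∧ HasDerivAt v (W.F' (W.pos s t) * x t) t :=
  exists_solution (f := fun t x => W.F' (W.pos s t) * x) (L := 0) W.one_le_K le_rfl
    (fun x => (W.continuous_F'.comp (W.continuous_pos s)).mul continuous_const)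
    (fun t x y => by
      rw [← mul_sub, abs_mul]
      exact mul_le_mul_of_nonneg_right (W.abs_F'_le _) (abs_nonneg _))
    (fun t => by simp) 0 1

/-- The derivative of `pos` with respect to the initial velocity. -/
noncomputable def lin (s : ℝ) : ℝ → ℝ := (W.exists_lin s).choose

/-- The derivative of `vel` with respect to the initial velocity. -/
noncomputable def linVel (s : ℝ) : ℝ → ℝ := (W.exists_lin s).choose_spec.choose

theorem lin_zero (s : ℝ) : W.lin s 0 = 0 := (W.exists_lin s).choose_spec.choose_spec.1

theorem linVel_zero (s : ℝ) : W.linVel s 0 = 1 := (W.exists_lin s).choose_spec.choose_spec.2.1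

theorem hasDerivAt_lin (s t : ℝ) : HasDerivAt (W.lin s) (W.linVel s t) t :=
  ((W.exists_lin s).choose_spec.choose_spec.2.2 t).1

theorem hasDerivAt_linVel (s t : ℝ) :
    HasDerivAt (W.linVel s) (W.F' (W.pos s t) * W.lin s t) t :=
  ((W.exists_lin s).choose_spec.choose_spec.2.2 t).2

theorem continuous_lin (s : ℝ) : Continuous (W.lin s) :=
  continuous_iff_continuousAt.2 fun t => (W.hasDerivAt_lin s t).continuousAt

theorem continuous_linVel (s : ℝ) : Continuous (W.linVel s) :=
  continuous_iff_continuousAt.2 fun t => (W.hasDerivAt_linVel s t).continuousAt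

theorem abs_pos_sub_le (s s' t : ℝ) :
    |W.pos s' t - W.pos s t| ≤ |s' - s| * Real.exp (W.K * |t|) ∧
      |W.vel s' t - W.vel s t| ≤ |s' - s| * Real.exp (W.K * |t|) := by
  have := gronwall_abs (e := fun t => W.pos s' t - W.pos s t)
    (g := fun t => W.vel s' t - W.vel s t) (τ := |t|)
    (g' := fun t => W.F (W.pos s' t) - W.F (W.pos s t)) (δ := |s' - s|) (R := 0) W.one_le_K le_rfl
    (fun t _ => (W.hasDerivAt_pos s' t).sub (W.hasDerivAt_pos s t))
    (fun t _ => (W.hasDerivAt_vel s' t).sub (W.hasDerivAt_vel s t))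
    (fun t _ => by simpa using W.abs_F_sub_le _ _) (by simp [pos_zero]) (by simp [vel_zero]) t le_rfl
  simpa using this

theorem abs_lin_le (s t : ℝ) :
    |W.lin s t| ≤ Real.exp (W.K * |t|) ∧ |W.linVel s t| ≤ Real.exp (W.K * |t|) := by
  have := gronwall_abs (e := W.lin s) (g := W.linVel s) (τ := |t|)
    (g' := fun t => W.F' (W.pos s t) * W.lin s t) (δ := 1) (R := 0) W.one_le_K le_rfl
    (fun t _ => W.hasDerivAt_lin s t) (fun t _ => W.hasDerivAt_linVel s t)
    (fun t _ => by
      rw [abs_mul, add_zero]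
      exact mul_le_mul_of_nonneg_right (W.abs_F'_le _) (abs_nonneg _))
    (by simp [lin_zero]) (by simp [linVel_zero]) t le_rfl
  simpa using this

/-- First-order expansion in the initial velocity, by Grönwall's inequality for the remainder. -/
theorem abs_pos_expansion_le (s s' : ℝ) {t τ : ℝ} (ht : |t| ≤ τ) :
    |W.pos s' t - W.pos s t - W.lin s t * (s' - s)| ≤
        W.K₂ * Real.exp (W.K * τ) ^ 3 * (s' - s) ^ 2 ∧
      |W.vel s' t - W.vel s t - W.linVel s t * (s' - s)| ≤
        W.K₂ * Real.exp (W.K * τ) ^ 3 * (s' - s) ^ 2 := by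
  set E := Real.exp (W.K * τ) with hE
  have hmono : ∀ t, |t| ≤ τ → Real.exp (W.K * |t|) ≤ E := fun t ht =>
    Real.exp_le_exp.2 (mul_le_mul_of_nonneg_left ht W.K_pos.le)
  have hR : 0 ≤ W.K₂ * (|s' - s| * E) ^ 2 := mul_nonneg W.K₂_nonneg (sq_nonneg _)
  have := gronwall_abs (e := fun t => W.pos s' t - W.pos s t - W.lin s t * (s' - s))
    (g := fun t => W.vel s' t - W.vel s t - W.linVel s t * (s' - s)) (τ := τ)
    (g' := fun t => W.F (W.pos s' t) - W.F (W.pos s t) - W.F' (W.pos s t) * W.lin s t * (s' - s))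
    (δ := 0) (R := W.K₂ * (|s' - s| * E) ^ 2) W.one_le_K hR
    (fun t _ => ((W.hasDerivAt_pos s' t).sub (W.hasDerivAt_pos s t)).sub
      ((W.hasDerivAt_lin s t).mul_const _))
    (fun t _ => ((W.hasDerivAt_vel s' t).sub (W.hasDerivAt_vel s t)).sub
      ((W.hasDerivAt_linVel s t).mul_const _))
    (fun t ht => by
      have h1 := W.abs_F_sub_sub_le (W.pos s t) (W.pos s' t)
      have h2 : (W.pos s' t - W.pos s t) ^ 2 ≤ (|s' - s| * E) ^ 2 := by
        rw [← sq_abs (W.pos s' t - W.pos s t)]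
        exact pow_le_pow_left₀ (abs_nonneg _) ((W.abs_pos_sub_le s s' t).1.trans
          (mul_le_mul_of_nonneg_left (hmono t ht) (abs_nonneg _))) 2
      have h3 : W.F (W.pos s' t) - W.F (W.pos s t) - W.F' (W.pos s t) * W.lin s t * (s' - s) =
          (W.F (W.pos s' t) - W.F (W.pos s t) - W.F' (W.pos s t) * (W.pos s' t - W.pos s t)) +
          W.F' (W.pos s t) * (W.pos s' t - W.pos s t - W.lin s t * (s' - s)) := by ring
      rw [h3]
      refine (abs_add_le _ _).trans ?_
      rw [abs_mul, add_comm]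
      exact add_le_add (mul_le_mul_of_nonneg_right (W.abs_F'_le _) (abs_nonneg _))
        (h1.trans (mul_le_mul_of_nonneg_left h2 W.K₂_nonneg)))
    (by simp [pos_zero, lin_zero]) (by simp [vel_zero, linVel_zero]) t ht
  have hle : (0 + W.K₂ * (|s' - s| * E) ^ 2) * Real.exp (W.K * |t|) ≤
      W.K₂ * E ^ 3 * (s' - s) ^ 2 := by
    rw [zero_add, mul_pow, sq_abs]
    calc _ ≤ W.K₂ * ((s' - s) ^ 2 * E ^ 2) * E :=
          mul_le_mul_of_nonneg_left (hmono t ht) (by have := W.K₂_nonneg; positivity)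
      _ = _ := by ring
  exact ⟨this.1.trans hle, this.2.trans hle⟩

theorem hasFDerivAt_pos (s t : ℝ) : HasFDerivAt (fun q : ℝ × ℝ => W.pos q.1 q.2)
    (W.lin s t • ContinuousLinearMap.fst ℝ ℝ ℝ + W.vel s t • ContinuousLinearMap.snd ℝ ℝ ℝ)
    (s, t) :=
  hasFDerivAt_of_expansion (fun _ ht s' => (W.abs_pos_expansion_le s s' ht).1)
    (W.continuous_lin s).continuousAt (W.hasDerivAt_pos s t)

theorem hasFDerivAt_vel (s t : ℝ) : HasFDerivAt (fun q : ℝ × ℝ => W.vel q.1 q.2)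
    (W.linVel s t • ContinuousLinearMap.fst ℝ ℝ ℝ +
      W.F (W.pos s t) • ContinuousLinearMap.snd ℝ ℝ ℝ) (s, t) :=
  hasFDerivAt_of_expansion (fun _ ht s' => (W.abs_pos_expansion_le s s' ht).2)
    (W.continuous_linVel s).continuousAt (W.hasDerivAt_vel s t)

/-- Conservation of energy. -/
theorem energy (s t : ℝ) :
    W.vel s t ^ 2 - 2 * W.H (W.pos s t) = s ^ 2 - 2 * W.H W.m := by
  have hd : ∀ t, HasDerivAt (fun t => W.vel s t ^ 2 - 2 * W.H (W.pos s t)) 0 t := fun t => by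
    have h1 := (W.hasDerivAt_vel s t).pow 2
    have h2 := ((W.hasDerivAt_H (W.pos s t)).comp t (W.hasDerivAt_pos s t)).const_mul 2
    exact (h1.sub h2).congr_deriv (by simp; ring)
  have := is_const_of_deriv_eq_zero (fun t => (hd t).differentiableAt) (fun t => (hd t).deriv) t 0
  simpa [pos_zero, vel_zero] using this

/-- The Wronskian of the velocity and of the linearized solution. -/
theorem wronskian (s t : ℝ) :
    W.vel s t * W.linVel s t - W.F (W.pos s t) * W.lin s t = s := by
  have hd : ∀ t, HasDerivAt (fun t => W.vel s t * W.linVel s t - W.F (W.pos s t) * W.lin s t) 0 t :=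
    fun t => by
      have h1 := (W.hasDerivAt_vel s t).mul (W.hasDerivAt_linVel s t)
      have h2 := ((W.hasDerivAt_F (W.pos s t)).comp t (W.hasDerivAt_pos s t)).mul
        (W.hasDerivAt_lin s t)
      exact (h1.sub h2).congr_deriv (by simp; ring)
  have := is_const_of_deriv_eq_zero (fun t => (hd t).differentiableAt) (fun t => (hd t).deriv) t 0
  simpa [pos_zero, vel_zero, lin_zero, linVel_zero] using this

end Well

/-! ### Orbits near the heteroclinic orbit: turning time and turning point -/

/-- The mean value inequality in the form `g b - g a ≤ C (b - a)`. -/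
theorem image_sub_le_of_deriv_le {g g' : ℝ → ℝ} {a b C : ℝ} (hab : a ≤ b)
    (h : ∀ t ∈ Icc a b, HasDerivAt g (g' t) t) (hC : ∀ t ∈ Icc a b, g' t ≤ C) :
    g b - g a ≤ C * (b - a) := by
  rcases hab.eq_or_lt with rfl | hlt
  · simp
  obtain ⟨c, hc, hc'⟩ := exists_hasDerivAt_eq_slope g g' hlt
    (fun t ht => (h t ht).continuousAt.continuousWithinAt)
    (fun t ht => h t (Ioo_subset_Icc_self ht))
  have := hC c (Ioo_subset_Icc_self hc)
  rw [hc', div_le_iff₀ (by linarith)] at this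
  exact this

theorem le_image_sub_of_le_deriv {g g' : ℝ → ℝ} {a b C : ℝ} (hab : a ≤ b)
    (h : ∀ t ∈ Icc a b, HasDerivAt g (g' t) t) (hC : ∀ t ∈ Icc a b, C ≤ g' t) :
    C * (b - a) ≤ g b - g a := by
  have := image_sub_le_of_deriv_le (g := fun t => -g t) (g' := fun t => -g' t) (C := -C) hab
    (fun t ht => (h t ht).fun_neg) (fun t ht => neg_le_neg (hC t ht))
  linarith

namespace Well

variable (W : Well)

/-- The velocity at `m` of the heteroclinic orbit, which tends to `B`. -/
noncomputable def hetVel : ℝ := Real.sqrt (2 * W.H W.m)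

/-- The radius of a neighbourhood of `B` in which `F' ≥ (A / 2) ^ 2`. -/
noncomputable def eta : ℝ := min ((W.B - W.m) / 2) (W.A ^ 2 / (2 * (W.K₂ + 1)))

theorem H_m_pos : 0 < W.H W.m := W.H_pos _ ⟨W.lo_lt, W.m_lt⟩

theorem hetVel_pos : 0 < W.hetVel := Real.sqrt_pos.2 (by linarith [W.H_m_pos])

theorem hetVel_sq : W.hetVel ^ 2 = 2 * W.H W.m := Real.sq_sqrt (by linarith [W.H_m_pos])

theorem vel_sq (s t : ℝ) : W.vel s t ^ 2 = 2 * W.H (W.pos s t) - (W.hetVel ^ 2 - s ^ 2) := by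
  have := W.energy s t
  rw [W.hetVel_sq]
  linarith

theorem eta_pos : 0 < W.eta := by
  have h1 := W.m_lt
  have h2 := W.A_pos
  have h3 := W.K₂_nonneg
  exact lt_min (by linarith) (by positivity)

theorem m_lt_sub_eta : W.m < W.B - W.eta := by
  have h1 : W.eta ≤ (W.B - W.m) / 2 := min_le_left _ _
  linarith [W.m_lt]

theorem half_A_sq_le_F' {u : ℝ} (hu : |u - W.B| ≤ W.eta) : (W.A / 2) ^ 2 ≤ W.F' u := by
  have h1 := (abs_le.1 (W.F'_lip u W.B)).1
  have h3 := W.K₂_nonneg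
  have h4 : W.eta * (2 * (W.K₂ + 1)) ≤ W.A ^ 2 := by
    rw [← le_div_iff₀ (by positivity)]
    exact min_le_right _ _
  have h5 := W.eta_pos
  have h6 : W.K₂ * |u - W.B| ≤ W.K₂ * W.eta := mul_le_mul_of_nonneg_left hu h3
  rw [W.F'_B] at h1
  nlinarith

theorem F_le {u : ℝ} (hu : u ∈ Icc (W.B - W.eta) W.B) : W.F u ≤ -((W.A / 2) ^ 2 * (W.B - u)) := by
  have := le_image_sub_of_le_deriv (g := W.F) (g' := W.F') (C := (W.A / 2) ^ 2) hu.2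
    (fun t _ => W.hasDerivAt_F t) (fun t ht => W.half_A_sq_le_F' (by
      rw [abs_le]; constructor <;> linarith [ht.1, ht.2, hu.1, W.eta_pos]))
  rw [W.F_B] at this
  linarith

theorem abs_F_le (u : ℝ) : |W.F u| ≤ W.K * |W.B - u| := by
  have := W.abs_F_sub_le u W.B
  rwa [W.F_B, sub_zero, abs_sub_comm] at this

theorem le_H {u : ℝ} (hu : u ∈ Icc (W.B - W.eta) W.B) :
    (W.A / 2) ^ 2 * (W.B - u) ^ 2 ≤ 2 * W.H u := by
  have := image_sub_le_of_deriv_le (g := fun u => 2 * W.H u - (W.A / 2) ^ 2 * (W.B - u) ^ 2)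
    (g' := fun u => 2 * W.F u + 2 * (W.A / 2) ^ 2 * (W.B - u)) (C := 0) hu.2
    (fun t _ => (((W.hasDerivAt_H t).const_mul 2).sub
      ((((hasDerivAt_id t).const_sub W.B).pow 2).const_mul ((W.A / 2) ^ 2))).congr_deriv
        (by simp; ring))
    (fun t ht => by
      have := W.F_le ⟨hu.1.trans ht.1, ht.2⟩
      linarith)
  simp only [W.H_B] at this
  linarith

theorem H_le {u : ℝ} (hu : u ≤ W.B) : 2 * W.H u ≤ W.K * (W.B - u) ^ 2 := by
  have := le_image_sub_of_le_deriv (g := fun u => 2 * W.H u - W.K * (W.B - u) ^ 2)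
    (g' := fun u => 2 * W.F u + 2 * W.K * (W.B - u)) (C := 0) hu
    (fun t _ => (((W.hasDerivAt_H t).const_mul 2).sub
      ((((hasDerivAt_id t).const_sub W.B).pow 2).const_mul W.K)).congr_deriv
        (by simp; ring))
    (fun t ht => by
      have := (abs_le.1 (W.abs_F_le t)).1
      rw [abs_of_nonneg (by linarith [ht.2])] at this
      linarith)
  simp only [W.H_B] at this
  linarith

theorem exists_hmin : ∃ h₀ > 0, ∀ u ∈ Icc W.m (W.B - W.eta), h₀ ≤ W.H u := by
  obtain ⟨u, hu, hmin⟩ := isCompact_Icc.exists_isMinOn (nonempty_Icc.2 W.m_lt_sub_eta.le)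
    W.continuous_H.continuousOn
  exact ⟨W.H u, W.H_pos u ⟨W.lo_lt.trans_le hu.1, by linarith [hu.2, W.eta_pos]⟩,
    fun v hv => hmin hv⟩

/-- A positive lower bound of the potential on `[m, B - eta]`. -/
noncomputable def hmin : ℝ := W.exists_hmin.choose

theorem hmin_pos : 0 < W.hmin := W.exists_hmin.choose_spec.1

theorem hmin_le {u : ℝ} (hu : u ∈ Icc W.m (W.B - W.eta)) : W.hmin ≤ W.H u :=
  W.exists_hmin.choose_spec.2 u hu

/-- A bound of the time needed to travel from `m` to `B - eta`. -/
noncomputable def entryTime : ℝ := (W.B - W.m) / Real.sqrt W.hmin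

theorem entryTime_nonneg : 0 ≤ W.entryTime :=
  div_nonneg (by linarith [W.m_lt]) (Real.sqrt_nonneg _)

/-- A size of the linearized solution beyond which its growth near `B` dominates its initial
data. -/
noncomputable def linThreshold : ℝ :=
  Real.exp (W.K * (W.entryTime + 1)) * (2 + 2 / (W.A / 2))

/-- The initial velocities under consideration: those below but close to the velocity of the
heteroclinic orbit. The bounds of the energy defect `hetVel ^ 2 - s ^ 2` ensure that the orbit
reaches the neighbourhood of `B` with a speed bounded from below (`lt_hmin`), and that the
linearized solution is at least `linThreshold` at the turning time (`small`). -/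
structure Near (s : ℝ) : Prop where
  half_lt : W.hetVel / 2 < s
  lt : s < W.hetVel
  lt_hmin : W.hetVel ^ 2 - s ^ 2 < W.hmin
  small : W.hetVel ^ 2 - s ^ 2 < (W.hetVel / 2 * (W.A / 2) / (W.K * W.linThreshold)) ^ 2

variable {W} {s : ℝ}

namespace Near

variable (hs : W.Near s)
include hs

theorem pos' : 0 < s := by linarith [hs.half_lt, W.hetVel_pos]

theorem defect_pos : 0 < W.hetVel ^ 2 - s ^ 2 := by nlinarith [hs.lt, hs.pos']

theorem H_pos_pos (t : ℝ) : 0 < W.H (W.pos s t) := by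
  have h1 := W.vel_sq s t
  have h2 := hs.defect_pos
  nlinarith [sq_nonneg (W.vel s t)]

theorem pos_mem (t : ℝ) : W.pos s t ∈ Ioo W.lo W.B := by
  constructor
  · by_contra! h
    obtain ⟨t', ht'⟩ := mem_range_of_exists_le_of_exists_ge (W.continuous_pos s) ⟨t, h⟩
      ⟨0, by rw [W.pos_zero]; exact W.lo_lt.le⟩
    have := hs.H_pos_pos t'
    rw [ht', W.H_lo] at this
    exact lt_irrefl _ this
  · by_contra! h
    obtain ⟨t', ht'⟩ := mem_range_of_exists_le_of_exists_ge (W.continuous_pos s)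
      ⟨0, by rw [W.pos_zero]; exact W.m_lt.le⟩ ⟨t, h⟩
    have := hs.H_pos_pos t'
    rw [ht', W.H_B] at this
    exact lt_irrefl _ this

theorem abs_vel_le (t : ℝ) : |W.vel s t| ≤ W.K * (W.B - W.pos s t) := by
  have h1 := W.vel_sq s t
  have h2 := hs.defect_pos
  have h3 := W.H_le (hs.pos_mem t).2.le
  have h4 := (hs.pos_mem t).2
  have h5 : 0 ≤ W.K * (W.B - W.pos s t) := mul_nonneg W.K_pos.le (by linarith)
  have h6 : W.K * (W.B - W.pos s t) ^ 2 ≤ (W.K * (W.B - W.pos s t)) ^ 2 := by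
    rw [mul_pow]
    exact mul_le_mul_of_nonneg_right (by nlinarith [W.one_le_K]) (sq_nonneg _)
  exact abs_le_of_sq_le_sq (by linarith) h5

theorem vel_le (t : ℝ) : W.vel s t ≤ W.K * (W.B - W.pos s t) :=
  (le_abs_self _).trans (hs.abs_vel_le t)

theorem sqrt_hmin_le_vel {t : ℝ} (ht : W.pos s t ∈ Icc W.m (W.B - W.eta)) (hv : 0 ≤ W.vel s t) :
    Real.sqrt W.hmin ≤ W.vel s t := by
  rw [Real.sqrt_le_left hv, W.vel_sq s t]
  linarith [W.hmin_le ht, hs.lt_hmin]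

/-- An orbit below the heteroclinic one turns back. -/
theorem exists_vel_eq_zero : ∃ t, 0 ≤ t ∧ W.vel s t = 0 := by
  by_contra! hne
  have hpos : ∀ t, 0 ≤ t → 0 < W.vel s t := by
    intro t ht
    by_contra! hle
    obtain ⟨t', ht', h0⟩ := intermediate_value_Icc' ht (W.continuous_vel s).continuousOn
      (show (0 : ℝ) ∈ Icc _ _ from ⟨hle, by rw [W.vel_zero]; exact hs.pos'.le⟩)
    exact hne t' ht'.1 h0
  have hmono : MonotoneOn (W.pos s) (Ici 0) :=
    monotoneOn_of_deriv_nonneg (convex_Ici 0) (W.continuous_pos s).continuousOn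
      (fun t _ => (W.hasDerivAt_pos s t).differentiableAt.differentiableWithinAt)
      (fun t ht => by
        rw [interior_Ici] at ht
        rw [(W.hasDerivAt_pos s t).deriv]
        exact (hpos t (le_of_lt ht)).le)
  have hm : ∀ t, 0 ≤ t → W.m ≤ W.pos s t := fun t ht => by
    rw [← W.pos_zero s]
    exact hmono self_mem_Ici ht ht
  by_cases hreach : ∃ t₂, 0 ≤ t₂ ∧ W.B - W.eta ≤ W.pos s t₂
  · -- once the orbit has entered the neighbourhood of `B`, it decelerates at a uniform rate
    obtain ⟨t₂, ht₂, hreach⟩ := hreach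
    set c := W.hetVel ^ 2 - s ^ 2 with hc
    have hcpos : 0 < c := hs.defect_pos
    set d₀ := Real.sqrt (c / W.K) with hd₀
    have hd₀pos : 0 < d₀ := Real.sqrt_pos.2 (div_pos hcpos W.K_pos)
    have hA : 0 < W.A / 2 := by linarith [W.A_pos]
    set τ := W.vel s t₂ / ((W.A / 2) ^ 2 * d₀) with hτ
    have hτ0 : 0 < τ := div_pos (hpos _ ht₂) (by positivity)
    have hd : ∀ t, d₀ ≤ W.B - W.pos s t := fun t => by
      rw [hd₀, Real.sqrt_le_left (by linarith [(hs.pos_mem t).2]), div_le_iff₀ W.K_pos]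
      have h1 := W.vel_sq s t
      have h2 := W.H_le (hs.pos_mem t).2.le
      nlinarith [sq_nonneg (W.vel s t)]
    have := image_sub_le_of_deriv_le (g := W.vel s) (g' := fun t => W.F (W.pos s t))
      (a := t₂) (b := t₂ + τ) (C := -((W.A / 2) ^ 2 * d₀)) (by linarith)
      (fun t _ => W.hasDerivAt_vel s t) (fun t ht => by
        have h1 : W.B - W.eta ≤ W.pos s t :=
          hreach.trans (hmono ht₂ (ht₂.trans ht.1 : (0 : ℝ) ≤ t) ht.1)
        have h2 := W.F_le ⟨h1, (hs.pos_mem t).2.le⟩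
        have h3 := mul_le_mul_of_nonneg_left (hd t) (sq_nonneg (W.A / 2))
        linarith)
    have h2 := hpos (t₂ + τ) (by linarith)
    have h3 : (W.A / 2) ^ 2 * d₀ * τ = W.vel s t₂ := by
      rw [hτ]; exact mul_div_cancel₀ _ (by positivity)
    rw [add_sub_cancel_left] at this
    linarith
  · push Not at hreach
    -- outside this neighbourhood the speed is at least `√hmin`, so the orbit cannot stay there
    have h0 : 0 < Real.sqrt W.hmin := Real.sqrt_pos.2 W.hmin_pos
    have := le_image_sub_of_le_deriv (g := W.pos s) (g' := W.vel s) (a := 0)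
      (b := W.entryTime) (C := Real.sqrt W.hmin) W.entryTime_nonneg
      (fun t _ => W.hasDerivAt_pos s t)
      (fun t ht => hs.sqrt_hmin_le_vel ⟨hm t ht.1, (hreach t ht.1).le⟩ (hpos t ht.1).le)
    have h3 : Real.sqrt W.hmin * W.entryTime = W.B - W.m := by
      rw [entryTime]; field_simp
    rw [sub_zero, h3, W.pos_zero] at this
    linarith [(hs.pos_mem W.entryTime).2]

end Near

variable (W) in
/-- The turning time: the first time at which the velocity vanishes. -/
noncomputable def turn (s : ℝ) : ℝ := sInf {t | 0 ≤ t ∧ W.vel s t = 0}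

variable (W) in
/-- The distance of the turning point from `B`. -/
noncomputable def gap (s : ℝ) : ℝ := W.B - W.pos s (W.turn s)

namespace Near

variable (hs : W.Near s)
include hs

theorem turn_spec : 0 ≤ W.turn s ∧ W.vel s (W.turn s) = 0 := by
  have hcl : IsClosed {t | 0 ≤ t ∧ W.vel s t = 0} :=
    isClosed_Ici.inter (isClosed_eq (W.continuous_vel s) continuous_const)
  exact hcl.csInf_mem hs.exists_vel_eq_zero ⟨0, fun t ht => ht.1⟩

theorem vel_turn : W.vel s (W.turn s) = 0 := hs.turn_spec.2

theorem turn_pos : 0 < W.turn s := by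
  refine hs.turn_spec.1.lt_of_ne fun h => ?_
  have := hs.vel_turn
  rw [← h, W.vel_zero] at this
  exact hs.pos'.ne' this

theorem vel_pos {t : ℝ} (ht : t ∈ Ico 0 (W.turn s)) : 0 < W.vel s t := by
  by_contra! hle
  obtain ⟨t', ht', h0⟩ := intermediate_value_Icc' ht.1 (W.continuous_vel s).continuousOn
    (show (0 : ℝ) ∈ Icc _ _ from ⟨hle, by rw [W.vel_zero]; exact hs.pos'.le⟩)
  have : W.turn s ≤ t' := csInf_le ⟨0, fun t ht => ht.1⟩ ⟨ht'.1, h0⟩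
  linarith [ht.2, ht'.2]

theorem strictMonoOn_pos : StrictMonoOn (W.pos s) (Icc 0 (W.turn s)) :=
  strictMonoOn_of_deriv_pos (convex_Icc _ _) (W.continuous_pos s).continuousOn fun t ht => by
    rw [interior_Icc] at ht
    rw [(W.hasDerivAt_pos s t).deriv]
    exact hs.vel_pos (Ioo_subset_Ico_self ht)

theorem m_le_pos {t : ℝ} (ht : t ∈ Icc 0 (W.turn s)) : W.m ≤ W.pos s t := by
  rw [← W.pos_zero s]
  exact hs.strictMonoOn_pos.monotoneOn (left_mem_Icc.2 hs.turn_pos.le) ht ht.1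

theorem gap_pos : 0 < W.gap s := by
  have := (hs.pos_mem (W.turn s)).2
  rw [gap]; linarith

theorem two_mul_H_turn : 2 * W.H (W.pos s (W.turn s)) = W.hetVel ^ 2 - s ^ 2 := by
  have := W.vel_sq s (W.turn s)
  rw [hs.vel_turn] at this
  linarith

theorem gap_lt_eta : W.gap s < W.eta := by
  by_contra! h
  have h1 := W.hmin_le (u := W.pos s (W.turn s))
    ⟨hs.m_le_pos (right_mem_Icc.2 hs.turn_pos.le), by rw [gap] at h; linarith⟩
  linarith [hs.two_mul_H_turn, hs.lt_hmin, W.hmin_pos]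

theorem pos_turn_mem : W.pos s (W.turn s) ∈ Icc (W.B - W.eta) W.B := by
  have h1 := hs.gap_lt_eta
  have h2 := hs.gap_pos
  rw [gap] at h1 h2
  constructor <;> linarith

theorem le_defect : (W.A / 2) ^ 2 * W.gap s ^ 2 ≤ W.hetVel ^ 2 - s ^ 2 := by
  rw [← hs.two_mul_H_turn]
  exact W.le_H hs.pos_turn_mem

theorem defect_le : W.hetVel ^ 2 - s ^ 2 ≤ W.K * W.gap s ^ 2 := by
  rw [← hs.two_mul_H_turn]
  exact W.H_le hs.pos_turn_mem.2

theorem F_turn_neg : W.F (W.pos s (W.turn s)) < 0 := by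
  have h1 := W.F_le hs.pos_turn_mem
  have h2 := hs.gap_pos
  have h3 := W.A_pos
  have : 0 < (W.A / 2) ^ 2 * W.gap s := by positivity
  rw [gap] at this
  linarith

theorem neg_F_turn_le : -W.F (W.pos s (W.turn s)) ≤ W.K * W.gap s := by
  have h1 := (abs_le.1 (W.abs_F_le (W.pos s (W.turn s)))).1
  have h2 := hs.gap_pos
  rw [gap] at h2 ⊢
  rw [abs_of_pos h2] at h1
  linarith

/-- The orbit enters the neighbourhood of `B` after a time which is bounded uniformly in `s`. -/
theorem exists_entry : ∃ t₁ ∈ Ioo 0 (W.turn s), t₁ ≤ W.entryTime ∧ W.pos s t₁ = W.B - W.eta ∧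
    ∀ t ∈ Icc t₁ (W.turn s), W.pos s t ∈ Icc (W.B - W.eta) W.B := by
  have hT := hs.turn_pos
  obtain ⟨t₁, ht₁, h1⟩ := intermediate_value_Ioo hT.le (W.continuous_pos s).continuousOn
    (show W.B - W.eta ∈ Ioo _ _ from ⟨by rw [W.pos_zero]; exact W.m_lt_sub_eta, by
      have := hs.gap_lt_eta
      rw [gap] at this; linarith⟩)
  have hmono := hs.strictMonoOn_pos.monotoneOn
  refine ⟨t₁, ht₁, ?_, h1, fun t ht => ⟨?_, (hs.pos_mem t).2.le⟩⟩
  · have h0 : 0 < Real.sqrt W.hmin := Real.sqrt_pos.2 W.hmin_pos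
    have := le_image_sub_of_le_deriv (g := W.pos s) (g' := W.vel s) (a := 0)
      (b := t₁) (C := Real.sqrt W.hmin) ht₁.1.le (fun t _ => W.hasDerivAt_pos s t)
      (fun t ht => hs.sqrt_hmin_le_vel
        ⟨hs.m_le_pos ⟨ht.1, ht.2.trans ht₁.2.le⟩, h1 ▸
          hmono ⟨ht.1, ht.2.trans ht₁.2.le⟩ (Ioo_subset_Icc_self ht₁) ht.2⟩
        (hs.vel_pos ⟨ht.1, ht.2.trans_lt ht₁.2⟩).le)
    rw [entryTime, le_div_iff₀ h0]
    rw [h1, W.pos_zero] at this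
    linarith [W.eta_pos]
  · rw [← h1]
    exact hmono (Ioo_subset_Icc_self ht₁) ⟨ht₁.1.le.trans ht.1, ht.2⟩ ht.1

/-- The orbit is symmetric about its turning time. -/
theorem pos_turn_add (y : ℝ) : W.pos s (W.turn s + y) = W.pos s (W.turn s - y) ∧
    W.vel s (W.turn s + y) = -W.vel s (W.turn s - y) := by
  refine W.eq_of_solution (x := fun y => W.pos s (W.turn s + y))
    (v := fun y => W.vel s (W.turn s + y)) (y := fun y => W.pos s (W.turn s - y))
    (w := fun y => -W.vel s (W.turn s - y)) (fun y => ⟨?_, ?_⟩) (fun y => ⟨?_, ?_⟩) (by simp)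
    (by simp [hs.vel_turn]) y
  · exact (W.hasDerivAt_pos s _).comp_const_add _ _
  · exact (W.hasDerivAt_vel s _).comp_const_add _ _
  · exact (W.hasDerivAt_pos s _).comp_const_sub _ _
  · exact ((W.hasDerivAt_vel s _).comp_const_sub _ _).fun_neg.congr_deriv (by simp)

theorem vel_nonneg {t : ℝ} (ht : t ∈ Icc 0 (W.turn s)) : 0 ≤ W.vel s t := by
  rcases ht.2.eq_or_lt with h | h
  · rw [h, hs.vel_turn]
  · exact (hs.vel_pos ⟨ht.1, h⟩).le

theorem m_lt_pos {t : ℝ} (ht : t ∈ Ioo 0 (2 * W.turn s)) : W.m < W.pos s t := by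
  have key : ∀ t ∈ Ioc 0 (W.turn s), W.m < W.pos s t := fun t ht => by
    rw [← W.pos_zero s]
    exact hs.strictMonoOn_pos (left_mem_Icc.2 hs.turn_pos.le) (Ioc_subset_Icc_self ht) ht.1
  rcases le_total t (W.turn s) with h | h
  · exact key t ⟨ht.1, h⟩
  · have := (hs.pos_turn_add (t - W.turn s)).1
    rw [show W.turn s + (t - W.turn s) = t by ring] at this
    rw [this]
    exact key _ ⟨by linarith [ht.2], by linarith⟩

/-- The turning point approaches `B` at most exponentially fast in the turning time. -/
theorem sub_m_le : W.B - W.m ≤ W.gap s * Real.exp (W.K * W.turn s) := by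
  -- `(B - x) exp(K t)` is nondecreasing, because `x' ≤ K (B - x)`
  have := le_image_sub_of_le_deriv (g := fun t => (W.B - W.pos s t) * Real.exp (W.K * t))
    (g' := fun t => (W.K * (W.B - W.pos s t) - W.vel s t) * Real.exp (W.K * t)) (C := 0)
    hs.turn_pos.le
    (fun t _ => (((W.hasDerivAt_pos s t).const_sub W.B).mul
      (((hasDerivAt_id t).const_mul W.K).exp)).congr_deriv (by simp; ring))
    (fun t _ => mul_nonneg (by linarith [hs.vel_le t]) (Real.exp_pos _).le)
  simp only [W.pos_zero, zero_mul, mul_zero, Real.exp_zero, mul_one] at this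
  rw [gap]
  linarith

/-- The turning point approaches `B` at least at the exponential rate `A` in the turning time. The
function `(x' + A (B - x)) exp(A t + κ x')` is decreasing near `B`: the second exponent absorbs the
deviation of `F` from its linear part, since `-x''` is comparable to `B - x`. -/
theorem gap_le : W.gap s ≤ (W.K * W.eta + W.A * W.eta) / W.A *
    Real.exp (W.A * W.entryTime + W.K₂ / (W.A * (W.A / 2) ^ 2) * (W.K * W.eta)) *
      Real.exp (-(W.A * W.turn s)) := by
  obtain ⟨t₁, ht₁, ht₁', hpos₁, hmem⟩ := hs.exists_entry
  have hA := W.A_pos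
  set κ := W.K₂ / (W.A * (W.A / 2) ^ 2) with hκ
  have hκ0 : 0 ≤ κ := div_nonneg W.K₂_nonneg (by positivity)
  have hκ1 : κ * (W.A * (W.A / 2) ^ 2) = W.K₂ := by rw [hκ]; field_simp
  have hN := image_sub_le_of_deriv_le
    (g := fun t => (W.vel s t + W.A * (W.B - W.pos s t)) * Real.exp (W.A * t + κ * W.vel s t))
    (g' := fun t => (W.F (W.pos s t) + W.A * (-W.vel s t) +
      (W.vel s t + W.A * (W.B - W.pos s t)) * (W.A + κ * W.F (W.pos s t))) *
        Real.exp (W.A * t + κ * W.vel s t)) (C := 0) ht₁.2.le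
    (fun t _ => (((W.hasDerivAt_vel s t).add
        (((W.hasDerivAt_pos s t).const_sub W.B).const_mul W.A)).mul
      ((((hasDerivAt_id t).const_mul W.A).add ((W.hasDerivAt_vel s t).const_mul κ)).exp)).congr_deriv
        (by simp; ring))
    (fun t ht => by
      refine mul_nonpos_of_nonpos_of_nonneg ?_ (Real.exp_pos _).le
      have hv : 0 ≤ W.vel s t := hs.vel_nonneg ⟨ht₁.1.le.trans ht.1, ht.2⟩
      have h1 := (abs_le.1 (W.abs_F_sub_sub_le W.B (W.pos s t))).2
      rw [W.F_B, W.F'_B] at h1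
      have h2 := W.F_le (hmem t ht)
      set b := W.B - W.pos s t with hb
      have hb0 : 0 ≤ b := by linarith [(hmem t ht).2]
      have h3 : W.F (W.pos s t) + W.A ^ 2 * b ≤ W.K₂ * b ^ 2 := by
        have : W.pos s t - W.B = -b := by rw [hb]; ring
        rw [this] at h1
        linarith
      have h4 : (W.vel s t + W.A * b) * (κ * W.F (W.pos s t)) ≤
          (W.vel s t + W.A * b) * (κ * -((W.A / 2) ^ 2 * b)) :=
        mul_le_mul_of_nonneg_left (mul_le_mul_of_nonneg_left h2 hκ0) (by positivity)
      have h5 : (W.A * b) * (κ * ((W.A / 2) ^ 2 * b)) ≤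
          (W.vel s t + W.A * b) * (κ * ((W.A / 2) ^ 2 * b)) :=
        mul_le_mul_of_nonneg_right (by linarith) (by positivity)
      have h6 : (W.A * b) * (κ * ((W.A / 2) ^ 2 * b)) = W.K₂ * b ^ 2 := by
        rw [← hκ1]; ring
      nlinarith)
  simp only [hs.vel_turn, zero_add, mul_zero, add_zero, zero_mul, hpos₁, sub_sub_cancel] at hN
  have hv₁ : W.vel s t₁ ≤ W.K * W.eta := by
    have := hs.vel_le t₁
    rwa [hpos₁, sub_sub_cancel] at this
  have he : Real.exp (W.A * t₁ + κ * W.vel s t₁) ≤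
      Real.exp (W.A * W.entryTime + κ * (W.K * W.eta)) :=
    Real.exp_le_exp.2 (add_le_add (mul_le_mul_of_nonneg_left ht₁' hA.le)
      (mul_le_mul_of_nonneg_left hv₁ hκ0))
  have hη := W.eta_pos
  have hK := W.K_pos
  have h7 : (W.vel s t₁ + W.A * W.eta) * Real.exp (W.A * t₁ + κ * W.vel s t₁) ≤
      (W.K * W.eta + W.A * W.eta) * Real.exp (W.A * W.entryTime + κ * (W.K * W.eta)) :=
    mul_le_mul (by linarith) he (Real.exp_pos _).le (by positivity)
  have h8 : W.A * W.gap s * Real.exp (W.A * W.turn s) ≤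
      (W.K * W.eta + W.A * W.eta) * Real.exp (W.A * W.entryTime + κ * (W.K * W.eta)) := by
    rw [gap]; linarith
  rw [Real.exp_neg, ← div_eq_mul_inv, le_div_iff₀ (Real.exp_pos _), div_mul_eq_mul_div,
    le_div_iff₀ hA]
  linarith

/-- Near its turning time the orbit is close to the constant solution `B`. -/
theorem abs_vel_near_turn {t : ℝ} (ht : |t - W.turn s| ≤ 2) :
    |W.vel s t| ≤ Real.exp (2 * W.K) * W.gap s := by
  have := gronwall_abs (e := fun t => W.pos s (W.turn s + t) - W.B)
    (g := fun t => W.vel s (W.turn s + t)) (τ := 2)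
    (g' := fun t => W.F (W.pos s (W.turn s + t))) (δ := W.gap s) (R := 0) W.one_le_K le_rfl
    (fun t _ => ((W.hasDerivAt_pos s _).comp_const_add _ _).sub_const _)
    (fun t _ => (W.hasDerivAt_vel s _).comp_const_add _ _)
    (fun t _ => by rw [add_zero, abs_sub_comm]; exact W.abs_F_le _)
    (by rw [add_zero, abs_sub_comm, ← gap, abs_of_pos hs.gap_pos])
    (by rw [add_zero, hs.vel_turn, abs_zero]; exact hs.gap_pos.le) (t - W.turn s) ht
  rw [show W.turn s + (t - W.turn s) = t by ring, add_zero] at this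
  refine this.2.trans ?_
  rw [mul_comm]
  exact mul_le_mul_of_nonneg_right (Real.exp_le_exp.2 (by nlinarith [W.K_pos])) hs.gap_pos.le

end Near

end Well

/-! ### Dependence of the orbits on the turning time -/

/-- One-dimensional implicit differentiation: a continuous solution `τ` of `g(s, τ(s)) = 0` is
differentiable where `∂₂ g ≠ 0`. -/
theorem hasDerivAt_of_implicit {g : ℝ × ℝ → ℝ} {τ : ℝ → ℝ} {s p q : ℝ} (hq : q ≠ 0)
    (hg : HasFDerivAt g (p • ContinuousLinearMap.fst ℝ ℝ ℝ + q • ContinuousLinearMap.snd ℝ ℝ ℝ)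
      (s, τ s)) (hτ : ContinuousAt τ s) (h0 : ∀ᶠ s' in nhds s, g (s', τ s') = 0) :
    HasDerivAt τ (-p / q) s := by
  have ht : Filter.Tendsto (fun s' => (s', τ s')) (nhds s) (nhds (s, τ s)) :=
    (continuousAt_id.prodMk hτ).tendsto
  have h1 := hg.isLittleO.comp_tendsto ht
  have h2 : (fun s' => τ s' - τ s - (s' - s) * (-p / q)) =o[nhds s]
      fun s' => ((s' - s, τ s' - τ s) : ℝ × ℝ) := by
    refine (h1.const_mul_left (-1 / q)).congr' ?_ (Filter.Eventually.of_forall fun s' => by simp)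
    filter_upwards [h0] with s' hs'
    have := h0.self_of_nhds
    simp only [Function.comp_apply, hs', this, add_apply,
      smul_apply, ContinuousLinearMap.coe_fst', ContinuousLinearMap.coe_snd',
      Prod.fst_sub, Prod.snd_sub, smul_eq_mul]
    field_simp
    ring
  have h3 : (fun s' => ((0, τ s' - τ s - (s' - s) * (-p / q)) : ℝ × ℝ)) =o[nhds s]
      fun s' => ((s' - s, τ s' - τ s) : ℝ × ℝ) := by
    refine Asymptotics.IsLittleO.of_norm_left ?_
    refine h2.norm_left.congr_left fun s' => ?_
    simp [Prod.norm_def]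
  have h4 : (fun s' => ((s' - s, τ s' - τ s) : ℝ × ℝ)) =O[nhds s] fun s' => s' - s := by
    refine h3.right_isBigO_sub.trans ?_
    refine Asymptotics.IsBigO.of_bound (max 1 |p / q|) (Filter.Eventually.of_forall fun s' => ?_)
    have : ((s' - s, τ s' - τ s) : ℝ × ℝ) - (0, τ s' - τ s - (s' - s) * (-p / q)) =
        (s' - s, (s' - s) * (-p / q)) := by
      simp
    rw [this, Prod.norm_def]
    simp only [Real.norm_eq_abs]
    refine max_le ?_ ?_
    · exact le_mul_of_one_le_left (abs_nonneg _) (le_max_left _ _)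
    · rw [abs_mul, mul_comm, neg_div, abs_neg]
      exact mul_le_mul_of_nonneg_right (le_max_right _ _) (abs_nonneg _)
  rw [hasDerivAt_iff_isLittleO]
  simpa using h2.trans_isBigO h4

namespace Well

variable {W : Well} {s : ℝ}

namespace Near

theorem of_le (hs : W.Near s) {s' : ℝ} (h : s ≤ s') (h' : s' < W.hetVel) : W.Near s' := by
  have h1 : s ^ 2 ≤ s' ^ 2 := pow_le_pow_left₀ hs.pos'.le h 2
  exact ⟨hs.half_lt.trans_le h, h', by linarith [hs.lt_hmin], by linarith [hs.small]⟩

theorem eventually_near (hs : W.Near s) : ∀ᶠ s' in nhds s, W.Near s' := by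
  have hc : ContinuousAt (fun s' => W.hetVel ^ 2 - s' ^ 2) s := by fun_prop
  filter_upwards [eventually_gt_nhds hs.half_lt, eventually_lt_nhds hs.lt,
    hc.eventually_lt continuousAt_const hs.lt_hmin, hc.eventually_lt continuousAt_const hs.small]
    with s' h1 h2 h3 h4 using ⟨h1, h2, h3, h4⟩

variable (hs : W.Near s)
include hs

theorem lin_turn_mul : W.lin s (W.turn s) * -W.F (W.pos s (W.turn s)) = s := by
  have := W.wronskian s (W.turn s)
  rw [hs.vel_turn] at this
  linarith

/-- At the turning time the Wronskian identity reads `w (-F) = s`, so that `w` is large because the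
force at the turning point is small. -/
theorem linThreshold_le : W.linThreshold ≤ W.lin s (W.turn s) := by
  have hA := W.A_pos
  have hK := W.K_pos
  have hv := W.hetVel_pos
  have hg := hs.gap_pos
  have hΛ : 0 < W.linThreshold := by rw [linThreshold]; positivity
  have h1 : (W.A / 2 * W.gap s) ^ 2 ≤
      (W.hetVel / 2 * (W.A / 2) / (W.K * W.linThreshold)) ^ 2 := by
    rw [mul_pow]
    exact hs.le_defect.trans hs.small.le
  have h2 := (le_abs_self _).trans (abs_le_of_sq_le_sq h1 (by positivity))
  rw [le_div_iff₀ (by positivity)] at h2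
  have h3 : W.linThreshold * (W.K * W.gap s) ≤ s := by
    have : (W.A / 2) * (W.linThreshold * (W.K * W.gap s)) ≤ (W.A / 2) * (W.hetVel / 2) := by
      linarith
    exact (le_of_mul_le_mul_left this (by positivity)).trans hs.half_lt.le
  have h4 := hs.lin_turn_mul
  have h5 : 0 < W.lin s (W.turn s) := by
    have h6 := hs.F_turn_neg
    have h7 := hs.pos'
    rw [← h4] at h7
    exact pos_of_mul_pos_left h7 (by linarith)
  have h6 := mul_le_mul_of_nonneg_left hs.neg_F_turn_le h5.le
  rw [h4] at h6
  exact le_of_mul_le_mul_right (h3.trans h6) (by positivity)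

theorem lin_turn_pos : 0 < W.lin s (W.turn s) := by
  have hA := W.A_pos
  exact lt_of_lt_of_le (by rw [linThreshold]; positivity) hs.linThreshold_le

omit hs in
theorem abs_lin_le_of_le {t : ℝ} (h : |t| ≤ W.entryTime + 1) :
    |W.lin s t| ≤ Real.exp (W.K * (W.entryTime + 1)) ∧
      |W.linVel s t| ≤ Real.exp (W.K * (W.entryTime + 1)) := by
  have he : Real.exp (W.K * |t|) ≤ Real.exp (W.K * (W.entryTime + 1)) :=
    Real.exp_le_exp.2 (mul_le_mul_of_nonneg_left h W.K_pos.le)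
  exact ⟨(W.abs_lin_le s t).1.trans he, (W.abs_lin_le s t).2.trans he⟩

/-- Up to the turning time, the linearized solution is largest at the turning time: its square is
convex near `B`, and the value at the turning time exceeds every value away from `B`. -/
theorem abs_lin_le_lin_turn {t : ℝ} (ht : t ∈ Icc (-1) (W.turn s)) :
    |W.lin s t| ≤ W.lin s (W.turn s) := by
  have hA := W.A_pos
  obtain ⟨t₁, ht₁, ht₁', hpos₁, hmem⟩ := hs.exists_entry
  set C₀ := Real.exp (W.K * (W.entryTime + 1)) with hC₀
  have hC₀T : C₀ ≤ W.lin s (W.turn s) := by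
    refine le_trans ?_ hs.linThreshold_le
    rw [linThreshold]
    exact le_mul_of_one_le_right (Real.exp_pos _).le (by
      have : 0 < 2 / (W.A / 2) := by positivity
      linarith)
  rcases le_total t t₁ with h | h
  · refine (abs_lin_le_of_le ?_).1.trans hC₀T
    rw [abs_le]
    constructor <;> linarith [ht.1, W.entryTime_nonneg]
  · have hder : ∀ t, HasDerivAt (fun t => W.lin s t * W.linVel s t)
        (W.linVel s t ^ 2 + W.F' (W.pos s t) * W.lin s t ^ 2) t := fun t =>
      ((W.hasDerivAt_lin s t).mul (W.hasDerivAt_linVel s t)).congr_deriv (by ring)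
    have hder2 : ∀ t, HasDerivAt (fun t => W.lin s t ^ 2) (2 * (W.lin s t * W.linVel s t)) t :=
      fun t => ((W.hasDerivAt_lin s t).pow 2).congr_deriv (by simp; ring)
    have hmono : ∀ x y, t₁ ≤ x → x ≤ y → y ≤ W.turn s →
        W.lin s x * W.linVel s x ≤ W.lin s y * W.linVel s y := fun x y h1 h2 h3 => by
      have := le_image_sub_of_le_deriv (C := 0) h2 (fun t _ => hder t) (fun t ht => by
        have h4 := W.half_A_sq_le_F' (u := W.pos s t) (by
          have := hmem t ⟨h1.trans ht.1, ht.2.trans h3⟩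
          rw [abs_le]; constructor <;> linarith [this.1, this.2, W.eta_pos])
        have h5 : 0 ≤ W.F' (W.pos s t) := (sq_nonneg _).trans h4
        positivity)
      linarith
    have hfin : ∀ x : ℝ, W.lin s t ^ 2 ≤ x ^ 2 → 0 ≤ x → |W.lin s t| ≤ x :=
      fun x => abs_le_of_sq_le_sq
    -- where `w²` is increasing it is bounded by its value at the turning time, and where it is
    -- decreasing by its value at the entry time
    rcases le_total 0 (W.lin s t * W.linVel s t) with hQ | hQ
    · refine hfin _ ?_ hs.lin_turn_pos.le
      have := le_image_sub_of_le_deriv (C := 0) ht.2 (fun t _ => hder2 t) (fun x hx => by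
        have := hmono t x h hx.1 hx.2
        linarith)
      linarith
    · refine (hfin C₀ ?_ (Real.exp_pos _).le).trans hC₀T
      have h6 := image_sub_le_of_deriv_le (C := 0) h (fun t _ => hder2 t) (fun x hx => by
        have := hmono x t hx.1 hx.2 ht.2
        linarith)
      have h7 : |W.lin s t₁| ≤ C₀ := (abs_lin_le_of_le (by
        rw [abs_of_pos ht₁.1]; linarith)).1
      have h8 : W.lin s t₁ ^ 2 ≤ C₀ ^ 2 := sq_le_sq' (abs_le.1 h7).1 (abs_le.1 h7).2
      linarith

/-- The linearized solution grows exponentially at the turning time: `w w' - (A / 2) w ^ 2` is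
increasing near `B`. -/
theorem le_linVel_turn : W.A / 4 * W.lin s (W.turn s) ≤ W.linVel s (W.turn s) := by
  have hA := W.A_pos
  obtain ⟨t₁, ht₁, ht₁', hpos₁, hmem⟩ := hs.exists_entry
  set C₀ := Real.exp (W.K * (W.entryTime + 1)) with hC₀
  set k := W.A / 2 with hk
  have hk0 : 0 < k := by positivity
  have hinc := le_image_sub_of_le_deriv
    (g := fun t => W.lin s t * W.linVel s t - k * W.lin s t ^ 2)
    (g' := fun t => W.linVel s t ^ 2 + W.F' (W.pos s t) * W.lin s t ^ 2 -
      2 * k * (W.lin s t * W.linVel s t)) (C := 0) ht₁.2.le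
    (fun t _ => (((W.hasDerivAt_lin s t).mul (W.hasDerivAt_linVel s t)).sub
      (((W.hasDerivAt_lin s t).pow 2).const_mul k)).congr_deriv (by simp; ring))
    (fun t ht => by
      have h4 := W.half_A_sq_le_F' (u := W.pos s t) (by
        have := hmem t ht
        rw [abs_le]; constructor <;> linarith [this.1, this.2, W.eta_pos])
      rw [← hk] at h4
      have h5 := mul_le_mul_of_nonneg_right h4 (sq_nonneg (W.lin s t))
      nlinarith [sq_nonneg (W.linVel s t - k * W.lin s t)])
  have hb := abs_lin_le_of_le (W := W) (s := s) (t := t₁) (by rw [abs_of_pos ht₁.1]; linarith)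
  have h8 : W.lin s t₁ ^ 2 ≤ C₀ ^ 2 := sq_le_sq' (abs_le.1 hb.1).1 (abs_le.1 hb.1).2
  have h9 : -(C₀ * C₀) ≤ W.lin s t₁ * W.linVel s t₁ := by
    refine (abs_le.1 ?_).1
    rw [abs_mul]
    exact mul_le_mul hb.1 hb.2 (abs_nonneg _) (Real.exp_pos _).le
  have hw := hs.lin_turn_pos
  have hΛ : C₀ * (2 + 2 / k) ≤ W.lin s (W.turn s) := hs.linThreshold_le
  set w := W.lin s (W.turn s) with hwdef
  set w' := W.linVel s (W.turn s) with hwdef'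
  have hC0 : 0 < C₀ := Real.exp_pos _
  have h10 : (1 + k) * C₀ ^ 2 ≤ k / 2 * w ^ 2 := by
    have h11 : (C₀ * (2 + 2 / k)) ^ 2 ≤ w ^ 2 := pow_le_pow_left₀ (by positivity) hΛ 2
    have h12 : k / 2 * (C₀ * (2 + 2 / k)) ^ 2 = (2 * (1 + k) + 2 * (1 + k) / k) * C₀ ^ 2 := by
      field_simp; ring
    have h13 : (1 + k) * C₀ ^ 2 ≤ (2 * (1 + k) + 2 * (1 + k) / k) * C₀ ^ 2 := by
      refine mul_le_mul_of_nonneg_right ?_ (by positivity)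
      have : 0 < 2 * (1 + k) / k := by positivity
      linarith
    nlinarith
  have h14 : 0 ≤ w * (w' - k / 2 * w) := by nlinarith
  have h15 := nonneg_of_mul_nonneg_right h14 hw
  rw [show W.A / 4 = k / 2 by rw [hk]; ring]
  linarith

theorem continuousAt_turn : ContinuousAt W.turn s := by
  have hnear := hs.eventually_near
  refine tendsto_order.2 ⟨fun a ha => ?_, fun b hb => ?_⟩
  -- before the turning time the velocity is bounded away from zero, also for nearby orbits
  · rcases lt_or_ge a 0 with ha0 | ha0
    · filter_upwards [hnear] with s' hs' using ha0.trans hs'.turn_pos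
    obtain ⟨t₀, ht₀, hmin⟩ := isCompact_Icc.exists_isMinOn (nonempty_Icc.2 ha0)
      (W.continuous_vel s).continuousOn
    have hμ : 0 < W.vel s t₀ := hs.vel_pos ⟨ht₀.1, ht₀.2.trans_lt ha⟩
    have hc : ContinuousAt (fun s' => |s' - s| * Real.exp (W.K * a)) s := by fun_prop
    filter_upwards [hnear, hc.eventually_lt continuousAt_const (by simpa using hμ)] with s' hs' h
    by_contra! hle
    have h1 := (W.abs_pos_sub_le s s' (W.turn s')).2
    rw [hs'.vel_turn, zero_sub, abs_neg, abs_of_pos hs'.turn_pos] at h1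
    have h2 : |s' - s| * Real.exp (W.K * W.turn s') ≤ |s' - s| * Real.exp (W.K * a) :=
      mul_le_mul_of_nonneg_left (Real.exp_le_exp.2 (mul_le_mul_of_nonneg_left hle W.K_pos.le))
        (abs_nonneg _)
    have h3 : W.vel s t₀ ≤ W.vel s (W.turn s') := hmin ⟨hs'.turn_pos.le, hle⟩
    linarith [le_abs_self (W.vel s (W.turn s'))]
  -- shortly after the turning time the velocity is negative, also for nearby orbits
  · set y := min (b - W.turn s) (W.turn s) with hy
    have hy0 : 0 < y := lt_min (by linarith) hs.turn_pos
    have hneg : W.vel s (W.turn s + y) < 0 := by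
      rw [(hs.pos_turn_add y).2]
      have := hs.vel_pos (t := W.turn s - y) ⟨by linarith [min_le_right (b - W.turn s) (W.turn s)],
        by linarith⟩
      linarith
    have hc : ContinuousAt (fun s' => W.vel s (W.turn s + y) +
        |s' - s| * Real.exp (W.K * |W.turn s + y|)) s := by fun_prop
    filter_upwards [hnear, hc.eventually_lt (continuousAt_const (y := (0 : ℝ)))
      (by simpa using hneg)] with s' hs' h
    have h1 := (abs_le.1 (W.abs_pos_sub_le s s' (W.turn s + y)).2).2
    have h2 : W.vel s' (W.turn s + y) < 0 := by linarith
    have h3 : W.turn s' < W.turn s + y := by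
      by_contra! hle
      rcases hle.eq_or_lt with h4 | h4
      · rw [h4, hs'.vel_turn] at h2
        exact lt_irrefl _ h2
      · have := hs'.vel_pos ⟨by linarith [hs.turn_pos], h4⟩
        linarith
    linarith [min_le_left (b - W.turn s) (W.turn s)]

theorem hasDerivAt_turn : HasDerivAt W.turn
    (W.linVel s (W.turn s) / -W.F (W.pos s (W.turn s))) s := by
  have := hasDerivAt_of_implicit (g := fun q : ℝ × ℝ => W.vel q.1 q.2) hs.F_turn_neg.ne
    (W.hasFDerivAt_vel s (W.turn s)) hs.continuousAt_turn
    (hs.eventually_near.mono fun s' hs' => hs'.vel_turn)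
  exact this.congr_deriv (by rw [neg_div, div_neg])

theorem linVel_turn_pos : 0 < W.linVel s (W.turn s) :=
  lt_of_lt_of_le (mul_pos (by linarith [W.A_pos]) hs.lin_turn_pos) hs.le_linVel_turn

end Near

variable (W)

theorem strictMonoOn_turn : StrictMonoOn W.turn {s | W.Near s} := by
  have hconv : Convex ℝ {s | W.Near s} := by
    rw [convex_iff_ordConnected]
    exact ⟨fun x hx y hy z hz => Near.of_le hx hz.1 (hz.2.trans_lt (show W.Near y from hy).lt)⟩
  refine strictMonoOn_of_deriv_pos hconv
    (fun s hs => (show W.Near s from hs).continuousAt_turn.continuousWithinAt) fun s hs => ?_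
  have hs' : W.Near s := interior_subset hs
  rw [hs'.hasDerivAt_turn.deriv]
  exact div_pos hs'.linVel_turn_pos (by linarith [hs'.F_turn_neg])

/-- Orbits close to the heteroclinic one have a small gap. -/
theorem exists_near_gap_le {r : ℝ} (hr : 0 < r) : ∃ s, W.Near s ∧ W.gap s < r := by
  have hv := W.hetVel_pos
  have hA := W.A_pos
  have hK := W.K_pos
  have hc : ContinuousAt (fun s' => W.hetVel ^ 2 - s' ^ 2) W.hetVel := by fun_prop
  have hev : ∀ x : ℝ, 0 < x → ∀ᶠ s' in nhdsWithin W.hetVel (Iio W.hetVel),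
      W.hetVel ^ 2 - s' ^ 2 < x := fun x hx =>
    nhdsWithin_le_nhds (hc.eventually_lt continuousAt_const (by simpa using hx))
  have hΛ : 0 < W.linThreshold := by rw [linThreshold]; positivity
  obtain ⟨s, ⟨⟨h1, h2, h3⟩, h4⟩, h5⟩ := (((hev _ W.hmin_pos).and ((hev
    ((W.hetVel / 2 * (W.A / 2) / (W.K * W.linThreshold)) ^ 2) (by positivity)).and
    (hev ((W.A / 2 * r) ^ 2) (by positivity)))).and
    (nhdsWithin_le_nhds (eventually_gt_nhds (show W.hetVel / 2 < W.hetVel by linarith)))).and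
    self_mem_nhdsWithin |>.exists
  have hs : W.Near s := ⟨h4, h5, h1, h2⟩
  refine ⟨s, hs, ?_⟩
  have h6 : (W.A / 2 * W.gap s) ^ 2 < (W.A / 2 * r) ^ 2 := by
    rw [mul_pow]; exact hs.le_defect.trans_lt h3
  exact lt_of_mul_lt_mul_left (lt_of_pow_lt_pow_left₀ 2 (by positivity) h6) (by positivity)

theorem exists_near_lt_turn (τ : ℝ) : ∃ s, W.Near s ∧ τ < W.turn s := by
  have hB : 0 < W.B - W.m := by linarith [W.m_lt]
  obtain ⟨s, hs, hg⟩ := W.exists_near_gap_le (r := (W.B - W.m) * Real.exp (-(W.K * τ)))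
    (by positivity)
  refine ⟨s, hs, ?_⟩
  have h1 := hs.sub_m_le
  have h2 : W.gap s * Real.exp (W.K * W.turn s) <
      (W.B - W.m) * Real.exp (-(W.K * τ)) * Real.exp (W.K * W.turn s) :=
    mul_lt_mul_of_pos_right hg (Real.exp_pos _)
  rw [mul_assoc, ← Real.exp_add] at h2
  have h3 : (W.B - W.m) * 1 < (W.B - W.m) * Real.exp (-(W.K * τ) + W.K * W.turn s) := by linarith
  have h4 := lt_of_mul_lt_mul_left h3 hB.le
  rw [Real.one_lt_exp_iff] at h4
  have h5 : W.K * τ < W.K * W.turn s := by linarith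
  exact lt_of_mul_lt_mul_left h5 W.K_pos.le

/-- The turning time of one orbit close to the heteroclinic one; beyond it, orbits are parametrized
by their turning time. -/
noncomputable def minTurn : ℝ := W.turn (W.exists_near_lt_turn 0).choose

theorem minTurn_pos : 0 < W.minTurn := (W.exists_near_lt_turn 0).choose_spec.2

theorem exists_near_turn_eq {τ : ℝ} (hτ : W.minTurn < τ) : ∃ s, W.Near s ∧ W.turn s = τ := by
  have h₀ := (W.exists_near_lt_turn 0).choose_spec.1
  rw [minTurn] at hτ
  set s₀ := (W.exists_near_lt_turn 0).choose
  obtain ⟨s₁, h₁, hτ₁⟩ := W.exists_near_lt_turn τ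
  have hle : s₀ ≤ s₁ := by
    by_contra! h
    have := W.strictMonoOn_turn h₁ h₀ h
    linarith
  obtain ⟨s, hs, h⟩ := intermediate_value_Icc hle (f := W.turn)
    (fun x hx => (h₀.of_le hx.1 (hx.2.trans_lt h₁.lt)).continuousAt_turn.continuousWithinAt)
    (show τ ∈ Icc _ _ from ⟨hτ.le, hτ₁.le⟩)
  exact ⟨s, h₀.of_le hs.1 (hs.2.trans_lt h₁.lt), h⟩

open Classical in
/-- The initial velocity of the orbit with turning time `τ`. -/
noncomputable def start (τ : ℝ) : ℝ :=
  if h : W.minTurn < τ then (W.exists_near_turn_eq h).choose else 0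

variable {τ : ℝ} (hτ : W.minTurn < τ)
include hτ

theorem near_start : W.Near (W.start τ) := by
  rw [start, dif_pos hτ]; exact (W.exists_near_turn_eq hτ).choose_spec.1

theorem turn_start : W.turn (W.start τ) = τ := by
  rw [start, dif_pos hτ]; exact (W.exists_near_turn_eq hτ).choose_spec.2

theorem continuousAt_start : ContinuousAt W.start τ := by
  have h₀ := W.near_start hτ
  have hev : ∀ᶠ τ' in nhds τ, W.minTurn < τ' := eventually_gt_nhds hτ
  refine tendsto_order.2 ⟨fun a ha => ?_, fun b hb => ?_⟩
  · obtain ⟨a', ha', hn⟩ := ((eventually_gt_nhds ha).and h₀.eventually_near).filter_mono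
      (nhdsWithin_le_nhds (s := Iio (W.start τ))) |>.and self_mem_nhdsWithin |>.exists
    have hlt := W.strictMonoOn_turn ha'.2 h₀ hn
    rw [W.turn_start hτ] at hlt
    filter_upwards [hev, eventually_gt_nhds hlt] with τ' h1 h2
    by_contra! hle
    have h3 := W.strictMonoOn_turn (W.near_start h1) ha'.2 (hle.trans_lt ha'.1)
    rw [W.turn_start h1] at h3
    linarith
  · obtain ⟨b', hb', hn⟩ := ((eventually_lt_nhds hb).and h₀.eventually_near).filter_mono
      (nhdsWithin_le_nhds (s := Ioi (W.start τ))) |>.and self_mem_nhdsWithin |>.exists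
    have hlt := W.strictMonoOn_turn h₀ hb'.2 hn
    rw [W.turn_start hτ] at hlt
    filter_upwards [hev, eventually_lt_nhds hlt] with τ' h1 h2
    by_contra! hle
    have h3 := W.strictMonoOn_turn hb'.2 (W.near_start h1) (hb'.1.trans_le hle)
    rw [W.turn_start h1] at h3
    linarith

omit hτ in
/-- The derivative of `start`. -/
noncomputable def startDeriv (W : Well) (τ : ℝ) : ℝ :=
  -W.F (W.pos (W.start τ) τ) / W.linVel (W.start τ) τ

theorem hasDerivAt_start : HasDerivAt W.start (W.startDeriv τ) τ := by
  have h₀ := W.near_start hτ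
  have hd := h₀.hasDerivAt_turn
  have := HasDerivAt.of_local_left_inverse (W.continuousAt_start hτ) hd
    (div_pos h₀.linVel_turn_pos (by linarith [h₀.F_turn_neg])).ne'
    ((eventually_gt_nhds hτ).mono fun τ' h => W.turn_start h)
  rw [inv_div, W.turn_start hτ] at this
  exact this

/-- The orbit with turning time `τ` is differentiable jointly in `τ` and in time. -/
theorem hasFDerivAt_pos_start (t : ℝ) :
    HasFDerivAt (fun q : ℝ × ℝ => W.pos (W.start q.1) q.2)
      ((W.lin (W.start τ) t * W.startDeriv τ) • ContinuousLinearMap.fst ℝ ℝ ℝ +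
        W.vel (W.start τ) t • ContinuousLinearMap.snd ℝ ℝ ℝ) (τ, t) := by
  have h1 : HasFDerivAt (fun q : ℝ × ℝ => W.start q.1)
      (W.startDeriv τ • ContinuousLinearMap.fst ℝ ℝ ℝ) (τ, t) :=
    HasDerivAt.comp_hasFDerivAt (τ, t) (h₂ := W.start) (f := Prod.fst) (W.hasDerivAt_start hτ)
      (hasFDerivAt_fst (𝕜 := ℝ) (E := ℝ) (F := ℝ))
  have h2 := h1.prodMk (hasFDerivAt_snd (𝕜 := ℝ) (E := ℝ) (F := ℝ) (p := (τ, t)))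
  have h3 := HasFDerivAt.comp (τ, t) (g := fun q : ℝ × ℝ => W.pos q.1 q.2)
    (W.hasFDerivAt_pos (W.start τ) t) h2
  refine h3.congr_fderiv ?_
  ext <;> simp

/-- The orbit depends on its turning time with a rate bounded by the gap. -/
theorem abs_lin_mul_startDeriv_le {t : ℝ} (ht : t ∈ Icc (-1) τ) :
    |W.lin (W.start τ) t * W.startDeriv τ| ≤ 4 * W.K / W.A * W.gap (W.start τ) := by
  have h₀ := W.near_start hτ
  have hT := W.turn_start hτ
  have hA := W.A_pos
  have h1 := h₀.abs_lin_le_lin_turn (t := t) (by rwa [hT])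
  have h2 := h₀.le_linVel_turn
  have h3 := h₀.neg_F_turn_le
  have h4 := h₀.lin_turn_pos
  have h5 := h₀.linVel_turn_pos
  have h6 := h₀.F_turn_neg
  rw [hT] at h1 h2 h3 h4 h5 h6
  rw [abs_mul, startDeriv, abs_of_pos (div_pos (by linarith) h5), mul_div_assoc', div_le_iff₀ h5]
  calc _ ≤ W.lin (W.start τ) τ * (W.K * W.gap (W.start τ)) :=
        mul_le_mul h1 h3 (by linarith) h4.le
    _ = 4 * W.K / W.A * W.gap (W.start τ) * (W.A / 4 * W.lin (W.start τ) τ) := by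
        field_simp
    _ ≤ _ := mul_le_mul_of_nonneg_left h2
        (by have := W.K_pos; have := h₀.gap_pos; positivity)

omit hτ
variable {W}

namespace Near

variable (hs : W.Near s)
include hs

theorem sqrt_defect_le : Real.sqrt (W.hetVel ^ 2 - s ^ 2) ≤ W.K * W.gap s := by
  have hg := hs.gap_pos
  have hK := W.one_le_K
  rw [Real.sqrt_le_left (by positivity)]
  refine hs.defect_le.trans ?_
  rw [mul_pow]
  exact mul_le_mul_of_nonneg_right (by nlinarith) (sq_nonneg _)

theorem hetVel_sub_le : |s - W.hetVel| ≤ W.K * W.eta / W.hetVel * W.gap s := by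
  have hv := W.hetVel_pos
  rw [abs_sub_comm, abs_of_pos (by linarith [hs.lt]), div_mul_eq_mul_div, le_div_iff₀ hv]
  have h1 := hs.defect_le
  -- the difference is even of second order in the gap, which is at most `eta`
  have h2 : W.gap s * W.gap s ≤ W.eta * W.gap s :=
    mul_le_mul_of_nonneg_right hs.gap_lt_eta.le hs.gap_pos.le
  have h3 := mul_le_mul_of_nonneg_left h2 W.K_pos.le
  nlinarith [hs.pos', hs.lt]

/-- The action of an orbit up to its turning time, with a weight `wt` depending on the position,
differs from the action of the heteroclinic orbit by a multiple of the gap. -/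
theorem abs_integral_vel_sq_sub_le {wt : ℝ → ℝ} {wmax : ℝ} (hwt : Continuous wt)
    (hwt0 : ∀ u, 0 ≤ wt u) (hwt_le : ∀ u, wt u ≤ wmax) :
    |(∫ t in (0 : ℝ)..W.turn s, wt (W.pos s t) * W.vel s t ^ 2) -
      ∫ u in W.m..W.B, wt u * Real.sqrt (2 * W.H u)| ≤ 2 * wmax * W.K * (W.B - W.m) * W.gap s := by
  have hT := hs.turn_pos
  have hwm : 0 ≤ wmax := (hwt0 0).trans (hwt_le 0)
  have hcont : Continuous fun u => wt u * Real.sqrt (2 * W.H u) := by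
    have := W.continuous_H
    fun_prop
  have hcwt := hwt.comp (W.continuous_pos s)
  have hcv := W.continuous_vel s
  set c := Real.sqrt (W.hetVel ^ 2 - s ^ 2) with hc
  have hc2 : c ^ 2 = W.hetVel ^ 2 - s ^ 2 := Real.sq_sqrt hs.defect_pos.le
  have hc0 : 0 ≤ c := Real.sqrt_nonneg _
  have hsub : ∫ t in (0 : ℝ)..W.turn s, wt (W.pos s t) * Real.sqrt (2 * W.H (W.pos s t)) * W.vel s t =
      ∫ u in W.m..W.pos s (W.turn s), wt u * Real.sqrt (2 * W.H u) := by
    have := intervalIntegral.integral_comp_mul_deriv (a := 0) (b := W.turn s) (f := W.pos s)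
      (f' := W.vel s) (g := fun u => wt u * Real.sqrt (2 * W.H u))
      (fun t _ => W.hasDerivAt_pos s t) hcv.continuousOn hcont
    rw [W.pos_zero] at this
    exact this
  have hint : ∫ t in (0 : ℝ)..W.turn s, W.vel s t = W.pos s (W.turn s) - W.m := by
    rw [intervalIntegral.integral_eq_sub_of_hasDerivAt (fun t _ => W.hasDerivAt_pos s t)
      (hcv.intervalIntegrable _ _), W.pos_zero]
  have hsplit : (∫ u in W.m..W.pos s (W.turn s), wt u * Real.sqrt (2 * W.H u)) +
      (∫ u in W.pos s (W.turn s)..W.B, wt u * Real.sqrt (2 * W.H u)) =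
      ∫ u in W.m..W.B, wt u * Real.sqrt (2 * W.H u) :=
    intervalIntegral.integral_add_adjacent_intervals (hcont.intervalIntegrable _ _)
      (hcont.intervalIntegrable _ _)
  have hs2 : Continuous fun t => wt (W.pos s t) * Real.sqrt (2 * W.H (W.pos s t)) * W.vel s t :=
    (hcont.comp (W.continuous_pos s)).mul hcv
  have hs3 : Continuous fun t => wt (W.pos s t) * W.vel s t ^ 2 := hcwt.mul (hcv.pow 2)
  have hs4 : Continuous fun t => wmax * c * W.vel s t := by fun_prop
  -- with the energy defect `c²`, the velocity satisfies `√(2 H) - c ≤ x' ≤ √(2 H)`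
  have hlow : (∫ t in (0 : ℝ)..W.turn s, wt (W.pos s t) * Real.sqrt (2 * W.H (W.pos s t)) * W.vel s t) -
      wmax * c * (∫ t in (0 : ℝ)..W.turn s, W.vel s t) ≤
        ∫ t in (0 : ℝ)..W.turn s, wt (W.pos s t) * W.vel s t ^ 2 := by
    rw [← intervalIntegral.integral_const_mul, ← intervalIntegral.integral_sub
      (hs2.intervalIntegrable _ _) (hs4.intervalIntegrable _ _)]
    refine intervalIntegral.integral_mono_on hT.le ((hs2.sub hs4).intervalIntegrable _ _)
      (hs3.intervalIntegrable _ _) fun t ht => ?_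
    have hv := hs.vel_nonneg ht
    have h1 : Real.sqrt (2 * W.H (W.pos s t)) ≤ W.vel s t + c := by
      rw [Real.sqrt_le_left (by positivity)]
      nlinarith [W.vel_sq s t, mul_nonneg hv hc0]
    have h2 := mul_le_mul_of_nonneg_right
      (mul_le_mul_of_nonneg_left h1 (hwt0 (W.pos s t))) hv
    have h3 := mul_le_mul_of_nonneg_right (hwt_le (W.pos s t)) (mul_nonneg hc0 hv)
    nlinarith
  have hup : ∫ t in (0 : ℝ)..W.turn s, wt (W.pos s t) * W.vel s t ^ 2 ≤
      ∫ t in (0 : ℝ)..W.turn s, wt (W.pos s t) * Real.sqrt (2 * W.H (W.pos s t)) * W.vel s t := by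
    refine intervalIntegral.integral_mono_on hT.le (hs3.intervalIntegrable _ _)
      (hs2.intervalIntegrable _ _) fun t ht => ?_
    have hv := hs.vel_nonneg ht
    have h1 : W.vel s t ≤ Real.sqrt (2 * W.H (W.pos s t)) := by
      refine Real.le_sqrt_of_sq_le ?_
      nlinarith [W.vel_sq s t, hs.defect_pos]
    have h2 := mul_le_mul_of_nonneg_right
      (mul_le_mul_of_nonneg_left h1 (hwt0 (W.pos s t))) hv
    nlinarith
  have hM := hs.m_le_pos (right_mem_Icc.2 hT.le)
  have hg := hs.gap_pos
  have htail : ∫ u in W.pos s (W.turn s)..W.B, wt u * Real.sqrt (2 * W.H u) ≤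
      wmax * (W.K * (W.B - W.m)) * W.gap s := by
    have : ∫ u in W.pos s (W.turn s)..W.B, wt u * Real.sqrt (2 * W.H u) ≤
        ∫ u in W.pos s (W.turn s)..W.B, wmax * (W.K * (W.B - W.m)) := by
      refine intervalIntegral.integral_mono_on hs.pos_turn_mem.2 (hcont.intervalIntegrable _ _)
        (continuous_const.intervalIntegrable _ _) fun u hu => ?_
      refine mul_le_mul (hwt_le u) ?_ (Real.sqrt_nonneg _) hwm
      rw [Real.sqrt_le_left (mul_nonneg W.K_pos.le (by linarith [W.m_lt])), mul_pow]
      refine (W.H_le hu.2).trans ?_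
      have h1 : (W.B - u) ^ 2 ≤ (W.B - W.m) ^ 2 :=
        pow_le_pow_left₀ (by linarith [hu.2]) (by linarith [hu.1]) 2
      have h2 : W.K ≤ W.K ^ 2 := by nlinarith [W.one_le_K]
      exact mul_le_mul h2 h1 (sq_nonneg _) (sq_nonneg _)
    rw [intervalIntegral.integral_const, smul_eq_mul] at this
    rw [gap]; linarith
  have htail0 : 0 ≤ ∫ u in W.pos s (W.turn s)..W.B, wt u * Real.sqrt (2 * W.H u) :=
    intervalIntegral.integral_nonneg hs.pos_turn_mem.2 fun u _ =>
      mul_nonneg (hwt0 u) (Real.sqrt_nonneg _)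
  have hcd : wmax * c * (W.pos s (W.turn s) - W.m) ≤ wmax * (W.K * W.gap s * (W.B - W.m)) := by
    rw [mul_assoc]
    exact mul_le_mul_of_nonneg_left (mul_le_mul hs.sqrt_defect_le (by rw [gap] at hg; linarith)
      (by linarith) (mul_nonneg W.K_pos.le hg.le)) hwm
  have hgB : 0 ≤ wmax * (W.K * W.gap s * (W.B - W.m)) :=
    mul_nonneg hwm (mul_nonneg (mul_nonneg W.K_pos.le hg.le) (by linarith [W.m_lt]))
  rw [hint] at hlow
  rw [hsub] at hlow hup
  rw [abs_le]
  constructor <;> linarith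

end Near

end Well

/-! ### Removing the diffusion coefficient -/

namespace Bistable

variable (P : Bistable)

/-- Projection onto `[α, β]`. -/
def clamp (u : ℝ) : ℝ := max P.α (min P.β u)

theorem clamp_mem (u : ℝ) : P.clamp u ∈ Icc P.α P.β :=
  ⟨le_max_left _ _, max_le P.α_lt_β.le (min_le_left _ _)⟩

theorem clamp_of_mem {u : ℝ} (hu : u ∈ Icc P.α P.β) : P.clamp u = u := by
  rw [clamp, min_eq_right hu.2, max_eq_right hu.1]

theorem abs_clamp_sub_le (u v : ℝ) : |P.clamp u - P.clamp v| ≤ |u - v| := by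
  have := (((LipschitzWith.id (α := ℝ)).const_min P.β).const_max P.α).dist_le_mul u v
  simpa [Real.dist_eq, clamp] using this

theorem continuous_clamp : Continuous P.clamp := by
  unfold clamp; fun_prop

theorem clamp_mem_I (u : ℝ) : P.clamp u ∈ P.I := P.Icc_subset (P.clamp_mem u)

/-- A function which is `C¹` on `I` is globally Lipschitz after composition with the projection onto
`[α, β]`. -/
theorem exists_lipschitz_clamp {g : ℝ → ℝ} (hg : ContDiffOn ℝ 1 g P.I) :
    ∃ C, 0 ≤ C ∧ ∀ u v, |g (P.clamp u) - g (P.clamp v)| ≤ C * |u - v| := by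
  have hd : ContinuousOn (deriv g) P.I := hg.continuousOn_deriv_of_isOpen P.isOpen_I le_rfl
  obtain ⟨C, hC⟩ := isCompact_Icc.exists_bound_of_continuousOn (hd.mono P.Icc_subset)
  have hC0 : 0 ≤ C := (norm_nonneg _).trans (hC P.α (left_mem_Icc.2 P.α_lt_β.le))
  refine ⟨C, hC0, fun u v => ?_⟩
  have := (convex_Icc P.α P.β).norm_image_sub_le_of_norm_hasDerivWithin_le (f := g)
    (f' := deriv g) (C := C) (fun x hx =>
      ((hg.differentiableOn (by simp)).differentiableAt
        (P.isOpen_I.mem_nhds (P.Icc_subset hx))).hasDerivAt.hasDerivWithinAt) hC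
    (P.clamp_mem v) (P.clamp_mem u)
  exact this.trans (mul_le_mul_of_nonneg_left (P.abs_clamp_sub_le u v) hC0)

theorem D_pos {u : ℝ} (hu : u ∈ P.I) : 0 < P.D u := by
  obtain ⟨d, hd, h⟩ := P.D_lower
  exact hd.trans_le (h u hu)

/-- The diffusion coefficient, extended from `[α, β]` by constants. -/
def Dext (u : ℝ) : ℝ := P.D (P.clamp u)

theorem Dext_of_mem {u : ℝ} (hu : u ∈ Icc P.α P.β) : P.Dext u = P.D u := by
  rw [Dext, P.clamp_of_mem hu]

theorem Dext_pos (u : ℝ) : 0 < P.Dext u := P.D_pos (P.clamp_mem_I u)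

theorem continuous_comp_clamp {g : ℝ → ℝ} (hg : ContinuousOn g P.I) :
    Continuous fun u => g (P.clamp u) :=
  hg.comp_continuous P.continuous_clamp P.clamp_mem_I

theorem continuous_Dext : Continuous P.Dext := P.continuous_comp_clamp P.contDiffOn_D.continuousOn

theorem exists_le_Dext : ∃ d > 0, ∀ u, d ≤ P.Dext u := by
  obtain ⟨d, hd, h⟩ := P.D_lower
  exact ⟨d, hd, fun u => h _ (P.clamp_mem_I u)⟩

/-- A positive lower bound of the diffusion coefficient. -/
noncomputable def dmin : ℝ := P.exists_le_Dext.choose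

theorem dmin_pos : 0 < P.dmin := P.exists_le_Dext.choose_spec.1

theorem dmin_le (u : ℝ) : P.dmin ≤ P.Dext u := P.exists_le_Dext.choose_spec.2 u

theorem contDiffOn_deriv_f : ContDiffOn ℝ 1 (deriv P.f) P.I :=
  P.contDiffOn_f.deriv_of_isOpen P.isOpen_I (by norm_num)

/-- The derivative of the reaction term, extended from `[α, β]` by constants. -/
noncomputable def fextDeriv (u : ℝ) : ℝ := deriv P.f (P.clamp u)

theorem continuous_fextDeriv : Continuous P.fextDeriv :=
  P.continuous_comp_clamp P.contDiffOn_deriv_f.continuousOn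

/-- The reaction term, extended from `[α, β]` by affine functions. -/
noncomputable def fext (u : ℝ) : ℝ := ∫ s in P.α..u, P.fextDeriv s

theorem hasDerivAt_fext (u : ℝ) : HasDerivAt P.fext (P.fextDeriv u) u :=
  P.continuous_fextDeriv.integral_hasStrictDerivAt P.α u |>.hasDerivAt

theorem continuous_fext : Continuous P.fext :=
  continuous_iff_continuousAt.2 fun u => (P.hasDerivAt_fext u).continuousAt

theorem hasDerivAt_f {u : ℝ} (hu : u ∈ P.I) : HasDerivAt P.f (deriv P.f u) u :=
  ((P.contDiffOn_f.differentiableOn (by simp)).differentiableAt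
    (P.isOpen_I.mem_nhds hu)).hasDerivAt

theorem fext_of_mem {u : ℝ} (hu : u ∈ Icc P.α P.β) : P.fext u = P.f u := by
  have hsub : uIcc P.α u ⊆ Icc P.α P.β := by
    rw [uIcc_of_le hu.1]
    exact Icc_subset_Icc_right hu.2
  have h := intervalIntegral.integral_eq_sub_of_hasDerivAt (a := P.α) (b := u) (f := P.f)
    (f' := P.fextDeriv) (fun x hx => by
      rw [fextDeriv, P.clamp_of_mem (hsub hx)]
      exact P.hasDerivAt_f (P.Icc_subset (hsub hx))) (P.continuous_fextDeriv.intervalIntegrable _ _)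
  rw [fext, h, P.f_α, sub_zero]

/-- The potential of the extended reaction term. -/
noncomputable def Gext (u : ℝ) : ℝ := ∫ s in P.α..u, P.fext s * P.Dext s

theorem hasDerivAt_Gext (u : ℝ) : HasDerivAt P.Gext (P.fext u * P.Dext u) u :=
  (P.continuous_fext.mul P.continuous_Dext).integral_hasStrictDerivAt P.α u |>.hasDerivAt

theorem Gext_of_mem {u : ℝ} (hu : u ∈ Icc P.α P.β) : P.Gext u = G P u := by
  rw [Gext, G]
  refine intervalIntegral.integral_congr fun s hs => ?_
  rw [uIcc_of_le hu.1] at hs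
  have hs' : s ∈ Icc P.α P.β := ⟨hs.1, hs.2.trans hu.2⟩
  simp only [P.fext_of_mem hs', P.Dext_of_mem hs']

theorem G_α : G P P.α = 0 := by simp [G]

theorem G_β : G P P.β = 0 := P.integral_eq_zero

/-- The Kirchhoff transform `u ↦ ∫_α^u D`, which turns the flux `D(φ) φ'` into a derivative. -/
noncomputable def kirchhoff (u : ℝ) : ℝ := ∫ s in P.α..u, P.Dext s

theorem hasDerivAt_kirchhoff (u : ℝ) : HasDerivAt P.kirchhoff (P.Dext u) u :=
  P.continuous_Dext.integral_hasStrictDerivAt P.α u |>.hasDerivAt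

theorem continuous_kirchhoff : Continuous P.kirchhoff :=
  continuous_iff_continuousAt.2 fun u => (P.hasDerivAt_kirchhoff u).continuousAt

theorem strictMono_kirchhoff : StrictMono P.kirchhoff :=
  strictMono_of_deriv_pos fun u => by
    rw [(P.hasDerivAt_kirchhoff u).deriv]; exact P.Dext_pos u

theorem dmin_mul_le {u v : ℝ} (h : u ≤ v) :
    P.dmin * (v - u) ≤ P.kirchhoff v - P.kirchhoff u :=
  le_image_sub_of_le_deriv h (fun t _ => P.hasDerivAt_kirchhoff t) fun t _ => P.dmin_le t

theorem surjective_kirchhoff : Function.Surjective P.kirchhoff := by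
  have hd := P.dmin_pos
  refine P.continuous_kirchhoff.surjective ?_ ?_
  · refine Filter.tendsto_atTop_mono' _ (f₁ := fun v => P.kirchhoff 0 + P.dmin * v) ?_ ?_
    · filter_upwards [Filter.eventually_ge_atTop 0] with v hv
      have := P.dmin_mul_le hv
      linarith
    · exact Filter.tendsto_atTop_add_const_left _ _ (Filter.tendsto_id.const_mul_atTop hd)
  · refine Filter.tendsto_atBot_mono' _ (f₁ := fun v => P.kirchhoff 0 + P.dmin * v) ?_ ?_
    · filter_upwards [Filter.eventually_le_atBot 0] with v hv
      have := P.dmin_mul_le hv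
      linarith
    · exact Filter.tendsto_atBot_add_const_left _ _ (Filter.tendsto_id.const_mul_atBot hd)

/-- The inverse of the Kirchhoff transform. -/
noncomputable def kirchhoffInv : ℝ ≃o ℝ :=
  (P.strictMono_kirchhoff.orderIsoOfSurjective _ P.surjective_kirchhoff).symm

theorem kirchhoffInv_kirchhoff (u : ℝ) : P.kirchhoffInv (P.kirchhoff u) = u :=
  P.strictMono_kirchhoff.orderIsoOfSurjective_symm_apply_self _ P.surjective_kirchhoff u

theorem kirchhoff_kirchhoffInv (v : ℝ) : P.kirchhoff (P.kirchhoffInv v) = v :=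
  P.strictMono_kirchhoff.orderIsoOfSurjective_self_symm_apply _ P.surjective_kirchhoff v

theorem hasDerivAt_kirchhoffInv (v : ℝ) :
    HasDerivAt P.kirchhoffInv (P.Dext (P.kirchhoffInv v))⁻¹ v :=
  HasDerivAt.of_local_left_inverse P.kirchhoffInv.continuous.continuousAt
    (P.hasDerivAt_kirchhoff _) (P.Dext_pos _).ne'
    (Filter.Eventually.of_forall P.kirchhoff_kirchhoffInv)

theorem abs_kirchhoffInv_sub_le (v w : ℝ) :
    |P.kirchhoffInv v - P.kirchhoffInv w| ≤ P.dmin⁻¹ * |v - w| := by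
  have hd := P.dmin_pos
  refine convex_univ.norm_image_sub_le_of_norm_hasDerivWithin_le (C := P.dmin⁻¹)
    (fun x _ => (P.hasDerivAt_kirchhoffInv x).hasDerivWithinAt) (fun x _ => ?_) (mem_univ w)
    (mem_univ v)
  rw [Real.norm_eq_abs, abs_of_pos (inv_pos.2 (P.Dext_pos _))]
  exact inv_anti₀ hd (P.dmin_le _)

theorem kirchhoffInv_mem_Ioo {v : ℝ} (hv : v ∈ Ioo (P.kirchhoff P.α) (P.kirchhoff P.β)) :
    P.kirchhoffInv v ∈ Ioo P.α P.β := by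
  constructor
  · rw [← P.kirchhoffInv_kirchhoff P.α]
    exact P.kirchhoffInv.strictMono hv.1
  · rw [← P.kirchhoffInv_kirchhoff P.β]
    exact P.kirchhoffInv.strictMono hv.2

/-- The derivative of the force `f ∘ kirchhoffInv` as a function of the original variable. -/
noncomputable def slope (u : ℝ) : ℝ := deriv P.f (P.clamp u) / P.D (P.clamp u)

theorem contDiffOn_slope : ContDiffOn ℝ 1 (fun u => deriv P.f u / P.D u) P.I :=
  P.contDiffOn_deriv_f.div P.contDiffOn_D fun _ hu => (P.D_pos hu).ne'

theorem exists_slope_lip : ∃ C, 0 ≤ C ∧ ∀ u v, |P.slope u - P.slope v| ≤ C * |u - v| :=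
  P.exists_lipschitz_clamp P.contDiffOn_slope

theorem exists_slope_le : ∃ C, 1 ≤ C ∧ ∀ u, |P.slope u| ≤ C := by
  obtain ⟨C, hC⟩ := isCompact_Icc.exists_bound_of_continuousOn
    (P.contDiffOn_slope.continuousOn.mono P.Icc_subset)
  exact ⟨max 1 C, le_max_left _ _, fun u => (hC _ (P.clamp_mem u)).trans (le_max_right _ _)⟩

theorem midValue_mem : midValue P ∈ Ioo P.α P.β := by
  have := P.α_lt_β
  rw [midValue]
  constructor <;> linarith

theorem well_mem (σ : ℝ) : well P σ ∈ Icc P.α P.β := by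
  rw [well]
  split_ifs
  · exact right_mem_Icc.2 P.α_lt_β.le
  · exact left_mem_Icc.2 P.α_lt_β.le

theorem f_well (σ : ℝ) : P.f (well P σ) = 0 := by
  rw [well]; split_ifs <;> simp [P.f_α, P.f_β]

theorem G_well (σ : ℝ) : G P (well P σ) = 0 := by
  rw [well]; split_ifs <;> simp [P.G_α, P.G_β]

theorem deriv_f_well (σ : ℝ) : 0 < deriv P.f (well P σ) := by
  rw [well]; split_ifs <;> simp [P.deriv_f_α, P.deriv_f_β]

theorem well_one : well P 1 = P.β := by simp [well]

theorem well_neg_one : well P (-1) = P.α := by simp [well]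

theorem G_pos {u : ℝ} (hu : u ∈ Ioo P.α P.β) : 0 < G P u :=
  P.integral_pos u (P.Icc_subset (Ioo_subset_Icc_self hu)) hu.1.ne' hu.2.ne

/-- The equation of the profiles in the variable `U = σ kirchhoff(φ)`, after rescaling of `x` by
`ε`: it reads `U'' = F(U)`, and the profile on the side `σ` of the threshold becomes an orbit which
leaves the threshold towards an equilibrium `B` on its right. -/
noncomputable def toWell (σ : ℝ) (hσ : σ = 1 ∨ σ = -1) : Well where
  F U := σ * P.fext (P.kirchhoffInv (σ * U))
  F' U := P.slope (P.kirchhoffInv (σ * U))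
  H U := P.Gext (P.kirchhoffInv (σ * U))
  lo := σ * P.kirchhoff (well P (-σ))
  m := σ * P.kirchhoff (midValue P)
  B := σ * P.kirchhoff (well P σ)
  A := Real.sqrt (deriv P.f (well P σ) / P.D (well P σ))
  K := P.exists_slope_le.choose
  K₂ := P.exists_slope_lip.choose * P.dmin⁻¹
  lo_lt := by
    have h1 := P.strictMono_kirchhoff P.midValue_mem.1
    have h2 := P.strictMono_kirchhoff P.midValue_mem.2
    rcases hσ with rfl | rfl
    · rw [well_neg_one]; linarith
    · rw [neg_neg, well_one]; linarith
  m_lt := by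
    have h1 := P.strictMono_kirchhoff P.midValue_mem.1
    have h2 := P.strictMono_kirchhoff P.midValue_mem.2
    rcases hσ with rfl | rfl
    · rw [well_one]; linarith
    · rw [well_neg_one]; linarith
  A_pos := Real.sqrt_pos.2 (div_pos (P.deriv_f_well σ) (P.D_pos (P.Icc_subset (P.well_mem σ))))
  one_le_K := P.exists_slope_le.choose_spec.1
  K₂_nonneg := mul_nonneg P.exists_slope_lip.choose_spec.1 (inv_nonneg.2 P.dmin_pos.le)
  hasDerivAt_F U := by
    have h1 : HasDerivAt (fun U => σ * U) σ U := by simpa using (hasDerivAt_id U).const_mul σ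
    have h2 := (((P.hasDerivAt_fext _).comp U ((P.hasDerivAt_kirchhoffInv _).comp U h1))).const_mul σ
    refine h2.congr_deriv ?_
    have hσ2 : σ * σ = 1 := by rcases hσ with rfl | rfl <;> norm_num
    simp only [Function.comp_apply]
    rw [slope, fextDeriv, Dext, div_eq_mul_inv]
    linear_combination (deriv P.f (P.clamp (P.kirchhoffInv (σ * U))) *
      (P.D (P.clamp (P.kirchhoffInv (σ * U))))⁻¹) * hσ2
  abs_F'_le U := P.exists_slope_le.choose_spec.2 _
  F'_lip U V := by
    refine (P.exists_slope_lip.choose_spec.2 _ _).trans ?_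
    rw [mul_assoc]
    refine mul_le_mul_of_nonneg_left ((P.abs_kirchhoffInv_sub_le _ _).trans ?_)
      P.exists_slope_lip.choose_spec.1
    have : |σ| = 1 := by rcases hσ with rfl | rfl <;> norm_num
    rw [← mul_sub, abs_mul, this, one_mul]
  hasDerivAt_H U := by
    have h1 : HasDerivAt (fun U => σ * U) σ U := by simpa using (hasDerivAt_id U).const_mul σ
    have h2 := (P.hasDerivAt_Gext _).comp U ((P.hasDerivAt_kirchhoffInv _).comp U h1)
    refine h2.congr_deriv ?_
    have := (P.Dext_pos (P.kirchhoffInv (σ * U))).ne'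
    simp only [Function.comp_apply]
    field_simp
  F_B := by
    have hσ2 : σ * σ = 1 := by rcases hσ with rfl | rfl <;> norm_num
    rw [← mul_assoc, hσ2, one_mul, kirchhoffInv_kirchhoff, P.fext_of_mem (P.well_mem σ), P.f_well,
      mul_zero]
  F'_B := by
    have hσ2 : σ * σ = 1 := by rcases hσ with rfl | rfl <;> norm_num
    rw [← mul_assoc, hσ2, one_mul, kirchhoffInv_kirchhoff, slope, P.clamp_of_mem (P.well_mem σ),
      Real.sq_sqrt (div_pos (P.deriv_f_well σ) (P.D_pos (P.Icc_subset (P.well_mem σ)))).le]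
  H_lo := by
    have hσ2 : σ * σ = 1 := by rcases hσ with rfl | rfl <;> norm_num
    rw [← mul_assoc, hσ2, one_mul, kirchhoffInv_kirchhoff, P.Gext_of_mem (P.well_mem _), P.G_well]
  H_B := by
    have hσ2 : σ * σ = 1 := by rcases hσ with rfl | rfl <;> norm_num
    rw [← mul_assoc, hσ2, one_mul, kirchhoffInv_kirchhoff, P.Gext_of_mem (P.well_mem _), P.G_well]
  H_pos U hU := by
    have hmem : P.kirchhoffInv (σ * U) ∈ Ioo P.α P.β := by
      apply P.kirchhoffInv_mem_Ioo
      rcases hσ with rfl | rfl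
      · rw [well_neg_one, well_one] at hU
        constructor <;> linarith [hU.1, hU.2]
      · rw [neg_neg, well_neg_one, well_one] at hU
        constructor <;> linarith [hU.1, hU.2]
    rw [P.Gext_of_mem (Ioo_subset_Icc_self hmem)]
    exact P.G_pos hmem

variable {P} {σ : ℝ} (hσ : σ = 1 ∨ σ = -1)

theorem hasDerivAt_G {u : ℝ} (hu : u ∈ P.I) : HasDerivAt (G P) (P.f u * P.D u) u := by
  have hc : ContinuousOn (fun s => P.f s * P.D s) P.I :=
    P.contDiffOn_f.continuousOn.mul P.contDiffOn_D.continuousOn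
  have hα : P.α ∈ P.I := P.Icc_subset (left_mem_Icc.2 P.α_lt_β.le)
  refine intervalIntegral.integral_hasDerivAt_right
    ((hc.mono (P.ordConnected_I.uIcc_subset hα hu)).intervalIntegrable)
    (hc.stronglyMeasurableAtFilter P.isOpen_I u hu) (hc.continuousAt (P.isOpen_I.mem_nhds hu))

theorem deriv_deriv_G_well (σ : ℝ) :
    deriv (deriv (G P)) (well P σ) = deriv P.f (well P σ) * P.D (well P σ) := by
  have hmem : well P σ ∈ P.I := P.Icc_subset (P.well_mem σ)
  have hev : deriv (G P) =ᶠ[nhds (well P σ)] fun u => P.f u * P.D u := by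
    filter_upwards [P.isOpen_I.mem_nhds hmem] with u hu using (hasDerivAt_G hu).deriv
  rw [hev.deriv_eq]
  have hD := ((P.contDiffOn_D.differentiableOn (by simp)).differentiableAt
    (P.isOpen_I.mem_nhds hmem)).hasDerivAt
  refine ((P.hasDerivAt_f hmem).mul hD).deriv.trans ?_
  rw [P.f_well]
  ring

theorem rate_le_A : rate P ≤ (P.toWell σ hσ).A := by
  have key : rateAt P (well P σ) = (P.toWell σ hσ).A := by
    have hD := P.D_pos (P.Icc_subset (P.well_mem σ))
    rw [rateAt, deriv_deriv_G_well]
    change _ = Real.sqrt (deriv P.f (well P σ) / P.D (well P σ))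
    rw [div_eq_iff hD.ne', ← Real.sqrt_sq hD.le, ← Real.sqrt_mul' _ (sq_nonneg _),
      Real.sqrt_sq hD.le]
    congr 1
    field_simp
  rw [← key, rate]
  rcases hσ with rfl | rfl
  · rw [well_one]; exact min_le_right _ _
  · rw [well_neg_one]; exact min_le_left _ _

end Bistable

/-! ### Existence and uniqueness of the profiles -/

theorem sign_mul_self {σ : ℝ} (hσ : σ = 1 ∨ σ = -1) : σ * σ = 1 := by
  rcases hσ with rfl | rfl <;> norm_num

theorem abs_sign {σ : ℝ} (hσ : σ = 1 ∨ σ = -1) : |σ| = 1 := by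
  rcases hσ with rfl | rfl <;> norm_num

namespace Bistable

variable (P : Bistable) {ε ℓ σ : ℝ} (hσ : σ = 1 ∨ σ = -1)

theorem toWell_F_kirchhoff (u : ℝ) :
    (P.toWell σ hσ).F (σ * P.kirchhoff u) = σ * P.fext u := by
  change σ * P.fext (P.kirchhoffInv (σ * (σ * P.kirchhoff u))) = _
  rw [← mul_assoc, sign_mul_self hσ, one_mul, kirchhoffInv_kirchhoff]

/-- The profile on the side `σ` of the threshold with rescaled half-period `τ`, as a function of the
rescaled distance `t` to the left end of the interval. -/
noncomputable def profile (τ t : ℝ) : ℝ :=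
  P.kirchhoffInv (σ * (P.toWell σ hσ).pos ((P.toWell σ hσ).start τ) t)

theorem sign_mul_kirchhoff_profile (τ t : ℝ) : σ * P.kirchhoff (P.profile hσ τ t) =
    (P.toWell σ hσ).pos ((P.toWell σ hσ).start τ) t := by
  rw [profile, kirchhoff_kirchhoffInv, ← mul_assoc, sign_mul_self hσ, one_mul]

theorem kirchhoffInv_sign_mul_mem {U : ℝ}
    (hU : U ∈ Ioo (P.toWell σ hσ).lo (P.toWell σ hσ).B) :
    P.kirchhoffInv (σ * U) ∈ Ioo P.α P.β := by
  apply P.kirchhoffInv_mem_Ioo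
  change U ∈ Ioo (σ * P.kirchhoff (well P (-σ))) (σ * P.kirchhoff (well P σ)) at hU
  rcases hσ with rfl | rfl
  · rw [well_neg_one, well_one] at hU
    constructor <;> linarith [hU.1, hU.2]
  · rw [neg_neg, well_neg_one, well_one] at hU
    constructor <;> linarith [hU.1, hU.2]

theorem profile_mem {τ : ℝ} (hτ : (P.toWell σ hσ).minTurn < τ) (t : ℝ) :
    P.profile hσ τ t ∈ Ioo P.α P.β :=
  P.kirchhoffInv_sign_mul_mem hσ (((P.toWell σ hσ).near_start hτ).pos_mem t)

theorem profile_zero (τ : ℝ) : P.profile hσ τ 0 = midValue P := by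
  rw [profile, Well.pos_zero]
  change P.kirchhoffInv (σ * (σ * P.kirchhoff (midValue P))) = _
  rw [← mul_assoc, sign_mul_self hσ, one_mul, kirchhoffInv_kirchhoff]

/-- The derivative of the profile in `t`. -/
noncomputable def profileDt (τ t : ℝ) : ℝ :=
  (P.Dext (P.profile hσ τ t))⁻¹ * (σ * (P.toWell σ hσ).vel ((P.toWell σ hσ).start τ) t)

theorem hasDerivAt_profile (τ t : ℝ) :
    HasDerivAt (P.profile hσ τ) (P.profileDt hσ τ t) t :=
  (P.hasDerivAt_kirchhoffInv _).comp t
    (((P.toWell σ hσ).hasDerivAt_pos ((P.toWell σ hσ).start τ) t).const_mul σ)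

theorem Dext_mul_profileDt (τ t : ℝ) : P.Dext (P.profile hσ τ t) * P.profileDt hσ τ t =
    σ * (P.toWell σ hσ).vel ((P.toWell σ hσ).start τ) t := by
  rw [profileDt, mul_inv_cancel_left₀ (P.Dext_pos _).ne']

theorem isProfile_profile (hε : 0 < ε) (hτ : (P.toWell σ hσ).minTurn < ℓ / (2 * ε)) :
    IsProfile P ε ℓ σ (fun x => P.profile hσ (ℓ / (2 * ε)) (x / ε + ℓ / (2 * ε))) := by
  set W := P.toWell σ hσ with hW
  set τ := ℓ / (2 * ε) with hτdef
  have hs := W.near_start hτ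
  have hT := W.turn_start hτ
  have hmem := fun t => P.profile_mem hσ hτ t
  have hlin : ∀ x, HasDerivAt (fun x => x / ε + τ) ε⁻¹ x := fun x => by
    simpa using ((hasDerivAt_id x).div_const ε).add_const τ
  have hφ : ∀ x, HasDerivAt (fun x => P.profile hσ τ (x / ε + τ))
      (P.profileDt hσ τ (x / ε + τ) * ε⁻¹) x := fun x =>
    (P.hasDerivAt_profile hσ τ _).comp x (hlin x)
  have hflux : (fun x => P.D (P.profile hσ τ (x / ε + τ)) *
      deriv (fun x => P.profile hσ τ (x / ε + τ)) x) =
      fun x => σ * W.vel (W.start τ) (x / ε + τ) * ε⁻¹ := by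
    funext x
    rw [(hφ x).deriv, ← P.Dext_of_mem (Ioo_subset_Icc_self (hmem _)), ← mul_assoc,
      P.Dext_mul_profileDt]
  have hfluxd : ∀ x, HasDerivAt (fun x => σ * W.vel (W.start τ) (x / ε + τ) * ε⁻¹)
      (σ * (W.F (W.pos (W.start τ) (x / ε + τ)) * ε⁻¹) * ε⁻¹) x := fun x =>
    (((W.hasDerivAt_vel (W.start τ) _).comp x (hlin x)).const_mul σ).mul_const _
  have hτ2 : ℓ / 2 / ε = τ := by rw [hτdef]; field_simp
  refine ⟨fun x => P.Icc_subset (Ioo_subset_Icc_self (hmem _)), fun x => (hφ x).differentiableAt,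
    ?_, fun x => ?_, ?_, ?_, fun x hx => ?_⟩
  · rw [hflux]; exact fun x => (hfluxd x).differentiableAt
  · rw [hflux, (hfluxd x).deriv, ← P.sign_mul_kirchhoff_profile hσ, P.toWell_F_kirchhoff,
      P.fext_of_mem (Ioo_subset_Icc_self (hmem _))]
    generalize P.f (P.profile hσ τ (x / ε + τ)) = y
    field_simp
    linear_combination y * sign_mul_self hσ
  · rw [neg_div, hτ2, neg_add_cancel, P.profile_zero]
  · have := (hs.pos_turn_add τ).1
    rw [hT, sub_self] at this
    rw [hτ2, profile, ← hW, this, ← P.profile_zero hσ τ, profile]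
  · have hx' : x / ε + τ ∈ Ioo 0 (2 * τ) := by
      have h1 : -τ < x / ε := by rw [← hτ2, ← neg_div]; exact div_lt_div_of_pos_right hx.1 hε
      have h2 : x / ε < τ := by rw [← hτ2]; exact div_lt_div_of_pos_right hx.2 hε
      constructor <;> linarith
    have h1 := hs.m_lt_pos (t := x / ε + τ) (by rwa [hT])
    rw [← P.sign_mul_kirchhoff_profile hσ] at h1
    change σ * P.kirchhoff (midValue P) < _ at h1
    rcases hσ with rfl | rfl
    · rw [one_mul, one_mul] at h1
      have := P.strictMono_kirchhoff.lt_iff_lt.1 h1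
      linarith
    · have := P.strictMono_kirchhoff.lt_iff_lt.1 (neg_lt_neg_iff.1 (by simpa using h1))
      linarith

end Bistable

namespace IsProfile

variable {P : Bistable} {ε ℓ σ : ℝ} {φ : ℝ → ℝ}

theorem hasDerivAt (hφ : IsProfile P ε ℓ σ φ) (x : ℝ) : HasDerivAt φ (deriv φ x) x :=
  (hφ.differentiable x).hasDerivAt

theorem hasDerivAt_flux (hφ : IsProfile P ε ℓ σ φ) (hε : 0 < ε) (x : ℝ) :
    HasDerivAt (fun x => P.D (φ x) * deriv φ x) (P.f (φ x) / ε ^ 2) x := by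
  refine (hφ.differentiable_flux x).hasDerivAt.congr_deriv ?_
  rw [eq_div_iff (by positivity)]
  linarith [hφ.ode x]

theorem energy (hφ : IsProfile P ε ℓ σ φ) (hε : 0 < ε) (x y : ℝ) :
    ε ^ 2 * (P.D (φ x) * deriv φ x) ^ 2 - 2 * G P (φ x) =
      ε ^ 2 * (P.D (φ y) * deriv φ y) ^ 2 - 2 * G P (φ y) := by
  have hd : ∀ x, HasDerivAt
      (fun x => ε ^ 2 * (P.D (φ x) * deriv φ x) ^ 2 - 2 * G P (φ x)) 0 x := fun x => by
    have h1 := ((hφ.hasDerivAt_flux hε x).pow 2).const_mul (ε ^ 2)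
    have h2 := ((Bistable.hasDerivAt_G (hφ.mem_I x)).comp x (hφ.hasDerivAt x)).const_mul 2
    refine (h1.sub h2).congr_deriv ?_
    field_simp
    ring
  exact is_const_of_deriv_eq_zero (fun x => (hd x).differentiableAt) (fun x => (hd x).deriv) x y

theorem continuous (hφ : IsProfile P ε ℓ σ φ) : Continuous φ := hφ.differentiable.continuous

/-- In the variable `σ kirchhoff(φ)`, a profile is an orbit of `U'' = F(U)` wherever it takes values
in `[α, β]`. -/
theorem hasDerivAt_orbit (hφ : IsProfile P ε ℓ σ φ) (hσ : σ = 1 ∨ σ = -1) (hε : 0 < ε) (x₀ : ℝ)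
    {t : ℝ} (h : φ (x₀ + ε * t) ∈ Icc P.α P.β) :
    HasDerivAt (fun t => σ * P.kirchhoff (φ (x₀ + ε * t)))
      (σ * (P.D (φ (x₀ + ε * t)) * deriv φ (x₀ + ε * t) * ε)) t ∧
    HasDerivAt (fun t => σ * (P.D (φ (x₀ + ε * t)) * deriv φ (x₀ + ε * t) * ε))
      ((P.toWell σ hσ).F (σ * P.kirchhoff (φ (x₀ + ε * t)))) t := by
  have hlin : HasDerivAt (fun t => x₀ + ε * t) ε t := by
    simpa using ((hasDerivAt_id t).const_mul ε).const_add x₀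
  constructor
  · have h1 := ((P.hasDerivAt_kirchhoff _).comp t ((hφ.hasDerivAt _).comp t hlin)).const_mul σ
    refine h1.congr_deriv ?_
    simp only [Function.comp_apply]
    rw [P.Dext_of_mem h]
    ring
  · have h1 := (((hφ.hasDerivAt_flux hε _).comp t hlin).mul_const ε).const_mul σ
    refine h1.congr_deriv ?_
    rw [P.toWell_F_kirchhoff, P.fext_of_mem h]
    field_simp

/-- A profile takes its values strictly between the two wells. -/
theorem mem_Ioo (hφ : IsProfile P ε ℓ σ φ) (hσ : σ = 1 ∨ σ = -1) (hε : 0 < ε) (hℓ : 0 < ℓ) (x : ℝ) :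
    φ x ∈ Ioo P.α P.β := by
  obtain ⟨x₀, hx₀, hcrit⟩ := exists_deriv_eq_zero (f := φ) (show -(ℓ / 2) < ℓ / 2 by linarith)
    hφ.continuous.continuousOn (by rw [hφ.left, hφ.right])
  have hside := hφ.side x₀ hx₀
  have hmid := P.midValue_mem
  by_cases hw : φ x₀ = well P σ
  · -- the profile touches the well with zero velocity, hence stays there up to `ℓ / 2`
    exfalso
    have hE : ∀ x, ε ^ 2 * (P.D (φ x) * deriv φ x) ^ 2 = 2 * G P (φ x) := fun x => by
      have := hφ.energy hε x x₀
      rw [hcrit, hw, P.G_well] at this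
      linarith
    set S := {x | x ∈ Icc x₀ (ℓ / 2) ∧ φ x = well P σ} with hS
    have hScl : IsClosed S := isClosed_Icc.inter (isClosed_eq hφ.continuous continuous_const)
    have hSne : S.Nonempty := ⟨x₀, left_mem_Icc.2 hx₀.2.le, hw⟩
    have hSbd : BddAbove S := ⟨ℓ / 2, fun x hx => hx.1.2⟩
    set x₁ := sSup S with hx₁
    obtain ⟨hx₁mem, hx₁w⟩ : x₁ ∈ S := hScl.csSup_mem hSne hSbd
    have hne : midValue P ≠ well P σ := by
      rcases hσ with rfl | rfl
      · rw [P.well_one]; exact hmid.2.ne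
      · rw [P.well_neg_one]; exact hmid.1.ne'
    have hx₁lt : x₁ < ℓ / 2 := hx₁mem.2.lt_of_ne fun h => hne (by rw [← hφ.right, ← h, hx₁w])
    have hafter : ∀ x ∈ Ioc x₁ (ℓ / 2), φ x ≠ well P σ := fun x hx h =>
      absurd (le_csSup hSbd (show x ∈ S from ⟨⟨hx₁mem.1.trans hx.1.le, hx.2⟩, h⟩)) (not_le.2 hx.1)
    have hmem : ∀ x ∈ Icc x₁ (ℓ / 2), φ x ∈ Icc P.α P.β := by
      intro x hx
      rcases hx.1.eq_or_lt with h | h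
      · rw [← h, hx₁w]; exact P.well_mem σ
      have hs : 0 ≤ σ * (φ x - midValue P) := by
        rcases hx.2.eq_or_lt with h' | h'
        · rw [h', hφ.right]; simp
        · exact (hφ.side x ⟨by linarith [hx₀.1, hx₁mem.1], h'⟩).le
      have hcont : ContinuousOn φ (Icc x (ℓ / 2)) := hφ.continuous.continuousOn
      rcases hσ with rfl | rfl
      · refine ⟨by linarith [hmid.1], ?_⟩
        by_contra! hlt
        obtain ⟨y, hy, hy'⟩ := intermediate_value_Icc' hx.2 hcont
          (show P.β ∈ Icc _ _ from ⟨by rw [hφ.right]; exact hmid.2.le, hlt.le⟩)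
        exact hafter y ⟨h.trans_le hy.1, hy.2⟩ (by rw [hy', P.well_one])
      · refine ⟨?_, by linarith [hmid.2]⟩
        by_contra! hlt
        obtain ⟨y, hy, hy'⟩ := intermediate_value_Icc hx.2 hcont
          (show P.α ∈ Icc _ _ from ⟨hlt.le, by rw [hφ.right]; exact hmid.1.le⟩)
        exact hafter y ⟨h.trans_le hy.1, hy.2⟩ (by rw [hy', P.well_neg_one])
    have hp0 : P.D (φ x₁) * deriv φ x₁ = 0 := by
      have := hE x₁
      rw [hx₁w, P.G_well, mul_zero] at this
      rw [hx₁w]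
      exact pow_eq_zero_iff two_ne_zero |>.1 ((mul_eq_zero.1 this).resolve_left (by positivity))
    have hend := (P.toWell σ hσ).eqOn_of_solution (τ := (ℓ / 2 - x₁) / ε)
      (t := (ℓ / 2 - x₁) / ε)
      (x := fun t => σ * P.kirchhoff (φ (x₁ + ε * t)))
      (v := fun t => σ * (P.D (φ (x₁ + ε * t)) * deriv φ (x₁ + ε * t) * ε))
      (y := fun _ => (P.toWell σ hσ).B) (w := fun _ => 0)
      (fun t ht => hφ.hasDerivAt_orbit hσ hε x₁ (hmem _ (by
        have h1 := mul_nonneg hε.le ht.1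
        have h2 := mul_le_mul_of_nonneg_left ht.2 hε.le
        rw [mul_div_cancel₀ _ hε.ne'] at h2
        constructor <;> linarith)))
      (fun t _ => ⟨hasDerivAt_const _ _, by rw [(P.toWell σ hσ).F_B]; exact hasDerivAt_const _ _⟩)
      (by simp only [mul_zero, add_zero, hx₁w]; rfl) (by simp [hp0])
      (right_mem_Icc.2 (div_nonneg (by linarith) hε.le))
    simp only [mul_div_cancel₀ _ hε.ne', add_sub_cancel, hφ.right] at hend
    exact ((P.toWell σ hσ).m_lt).ne hend
  · -- otherwise, by conservation of energy, `G(φ)` is positive and `φ` never meets `α` or `β`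
    have hG : ∀ y, 0 < G P (φ y) := by
      have h0 : 0 < G P (φ x₀) := by
        rcases hσ with rfl | rfl
        · rw [P.well_one] at hw
          exact P.integral_pos _ (hφ.mem_I _) (by intro h; rw [h] at hside; linarith [hmid.1]) hw
        · rw [P.well_neg_one] at hw
          exact P.integral_pos _ (hφ.mem_I _) hw (by intro h; rw [h] at hside; linarith [hmid.2])
      intro y
      have := hφ.energy hε y x₀
      rw [hcrit, mul_zero] at this
      nlinarith [mul_nonneg (sq_nonneg ε) (sq_nonneg (P.D (φ y) * deriv φ y))]
    constructor
    · by_contra! h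
      obtain ⟨y, hy⟩ := mem_range_of_exists_le_of_exists_ge hφ.continuous ⟨x, h⟩
        ⟨ℓ / 2, by rw [hφ.right]; exact hmid.1.le⟩
      have := hG y
      rw [hy, P.G_α] at this
      exact lt_irrefl _ this
    · by_contra! h
      obtain ⟨y, hy⟩ := mem_range_of_exists_le_of_exists_ge hφ.continuous
        ⟨ℓ / 2, by rw [hφ.right]; exact hmid.2.le⟩ ⟨x, h⟩
      have := hG y
      rw [hy, P.G_β] at this
      exact lt_irrefl _ this

/-- A profile which is at least as close to the well as `Bistable.profile` is equal to it. -/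
theorem eq_profile (hφ : IsProfile P ε ℓ σ φ) (hσ : σ = 1 ∨ σ = -1) (hε : 0 < ε)
    (hτ : (P.toWell σ hσ).minTurn < ℓ / (2 * ε))
    (hle : |φ 0 - well P σ| ≤ |P.profile hσ (ℓ / (2 * ε)) (ℓ / (2 * ε)) - well P σ|) :
    φ = fun x => P.profile hσ (ℓ / (2 * ε)) (x / ε + ℓ / (2 * ε)) := by
  set W := P.toWell σ hσ with hW
  set τ := ℓ / (2 * ε) with hτdef
  have hτ0 : 0 < τ := W.minTurn_pos.trans hτ
  have hℓ : 0 < ℓ := by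
    rw [hτdef] at hτ0
    exact (div_pos_iff_of_pos_right (by positivity)).1 hτ0
  have hετ : ε * τ = ℓ / 2 := by rw [hτdef]; field_simp
  have hmem := hφ.mem_Ioo hσ hε hℓ
  set U := fun t => σ * P.kirchhoff (φ (-(ℓ / 2) + ε * t)) with hU
  set V := fun t => σ * (P.D (φ (-(ℓ / 2) + ε * t)) * deriv φ (-(ℓ / 2) + ε * t) * ε) with hV
  have hUV : ∀ t, HasDerivAt U (V t) t ∧ HasDerivAt V (W.F (U t)) t := fun t =>
    hφ.hasDerivAt_orbit hσ hε _ (Ioo_subset_Icc_self (hmem _))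
  have hU0 : U 0 = W.m := by
    simp only [hU, mul_zero, add_zero, hφ.left]; rfl
  have hU2 : U (2 * τ) = W.m := by
    have : -(ℓ / 2) + ε * (2 * τ) = ℓ / 2 := by linarith
    simp only [hU, this, hφ.right]; rfl
  have hUgt : ∀ t ∈ Ioo 0 (2 * τ), W.m < U t := by
    intro t ht
    have := hφ.side (-(ℓ / 2) + ε * t) (by
      have h1 := mul_pos hε ht.1
      have h2 := mul_lt_mul_of_pos_left ht.2 hε
      constructor <;> linarith)
    change σ * P.kirchhoff (midValue P) < σ * P.kirchhoff (φ (-(ℓ / 2) + ε * t))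
    rcases hσ with rfl | rfl
    · rw [one_mul, one_mul]
      exact P.strictMono_kirchhoff (by linarith)
    · have := P.strictMono_kirchhoff (show φ (-(ℓ / 2) + ε * t) < midValue P by linarith)
      linarith
  have hUB : ∀ t, U t < W.B := by
    intro t
    change σ * P.kirchhoff (φ (-(ℓ / 2) + ε * t)) < σ * P.kirchhoff (well P σ)
    have := hmem (-(ℓ / 2) + ε * t)
    rcases hσ with rfl | rfl
    · rw [P.well_one]
      have := P.strictMono_kirchhoff this.2
      linarith
    · rw [P.well_neg_one]
      have := P.strictMono_kirchhoff this.1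
      linarith
  -- by uniqueness, `U` is the orbit that leaves `m` with the velocity `V 0`
  have hpos : ∀ t, U t = W.pos (V 0) t ∧ V t = W.vel (V 0) t := fun t =>
    W.eq_of_solution hUV (fun t => ⟨W.hasDerivAt_pos _ t, W.hasDerivAt_vel _ t⟩)
      (by rw [hU0, W.pos_zero]) (by rw [W.vel_zero]) t
  -- critical points are centres of symmetry, so there is only the one at `τ`
  have hcrit : ∀ t ∈ Ioo 0 (2 * τ), V t = 0 → t = τ := by
    intro t ht hVt
    have hsymm : ∀ y, U (t + y) = U (t - y) := fun y => by
      refine (W.eq_of_solution (x := fun y => U (t + y)) (v := fun y => V (t + y))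
        (y := fun y => U (t - y)) (w := fun y => -V (t - y)) (fun y => ⟨?_, ?_⟩)
        (fun y => ⟨?_, ?_⟩) (by simp) (by simp [hVt]) y).1
      · exact (hUV _).1.comp_const_add _ _
      · exact (hUV _).2.comp_const_add _ _
      · exact (hUV _).1.comp_const_sub _ _
      · exact ((hUV _).2.comp_const_sub _ _).fun_neg.congr_deriv (by simp)
    rcases lt_trichotomy t τ with h | h | h
    · have h1 := hsymm t
      rw [sub_self, hU0] at h1
      exact absurd h1 (hUgt _ ⟨by linarith [ht.1], by linarith⟩).ne'
    · exact h
    · have h1 := hsymm (2 * τ - t)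
      rw [add_sub_cancel, hU2] at h1
      exact absurd h1 (hUgt _ ⟨by linarith [ht.1], by linarith [ht.2]⟩).ne
  have hVτ : V τ = 0 := by
    obtain ⟨t, ht, hVt⟩ := exists_hasDerivAt_eq_zero (f := U) (f' := V) (a := 0) (b := 2 * τ)
      (by linarith) (fun t _ => (hUV t).1.continuousAt.continuousWithinAt) (by rw [hU0, hU2])
      (fun t _ => (hUV t).1)
    rwa [← hcrit t ht hVt]
  have hV0 : 0 ≤ V 0 := by
    by_contra! hneg
    have hev := ((hUV 0).2.continuousAt.eventually_lt continuousAt_const hneg)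
    obtain ⟨r, hr, hball⟩ := Metric.eventually_nhds_iff.1 hev
    have hmin : 0 < min (r / 2) τ := lt_min (by linarith) hτ0
    have := image_sub_le_of_deriv_le (g := U) (g' := V) (a := 0) (b := min (r / 2) τ) (C := 0)
      hmin.le (fun t _ => (hUV t).1) (fun t ht => (hball (by
        rw [Real.dist_eq, sub_zero, abs_of_nonneg ht.1]
        linarith [ht.2, min_le_left (r / 2) τ])).le)
    have h2 := hUgt (min (r / 2) τ) ⟨hmin, by linarith [min_le_right (r / 2) τ]⟩
    rw [hU0] at this
    linarith
  have hs := W.near_start hτ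
  have hT := W.turn_start hτ
  have hcenter : -(ℓ / 2) + ε * τ = 0 := by linarith
  have hcloser : W.pos (W.start τ) τ ≤ U τ := by
    rw [← P.sign_mul_kirchhoff_profile hσ]
    change _ ≤ σ * P.kirchhoff (φ (-(ℓ / 2) + ε * τ))
    rw [hcenter]
    have h1 := hmem 0
    have h2 := P.profile_mem hσ hτ τ
    rcases hσ with rfl | rfl
    · rw [P.well_one, abs_of_neg (by linarith [h1.2]), abs_of_neg (by linarith [h2.2])] at hle
      rw [one_mul, one_mul]
      exact P.strictMono_kirchhoff.monotone (by linarith)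
    · rw [P.well_neg_one, abs_of_pos (by linarith [h1.1]), abs_of_pos (by linarith [h2.1])] at hle
      have := P.strictMono_kirchhoff.monotone (show φ 0 ≤ P.profile (σ := -1) (Or.inr rfl) τ τ by linarith)
      linarith
  -- `H` decreases towards `B`, so `φ` leaves the threshold at least as fast as the given profile
  have hH : W.H (U τ) ≤ W.H (W.pos (W.start τ) τ) := by
    have hmem' := hs.pos_turn_mem
    rw [hT] at hmem'
    have := image_sub_le_of_deriv_le (g := W.H) (g' := W.F) (C := 0) hcloser
      (fun t _ => W.hasDerivAt_H t) (fun t ht => by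
        have h1 := W.F_le (u := t) ⟨hmem'.1.trans ht.1, ht.2.trans (hUB τ).le⟩
        have h2 : 0 ≤ (W.A / 2) ^ 2 * (W.B - t) :=
          mul_nonneg (sq_nonneg _) (by linarith [ht.2, hUB τ])
        linarith)
    linarith
  have hHpos : 0 < W.H (U τ) := W.H_pos _ ⟨W.lo_lt.trans (hUgt τ ⟨hτ0, by linarith⟩), hUB τ⟩
  have hVsq : V 0 ^ 2 = W.hetVel ^ 2 - 2 * W.H (U τ) := by
    have := W.vel_sq (V 0) τ
    rw [← (hpos τ).1, ← (hpos τ).2, hVτ] at this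
    linarith
  have hssq := hs.two_mul_H_turn
  rw [hT] at hssq
  have hle' : W.start τ ≤ V 0 :=
    (le_abs_self _).trans (abs_le_of_sq_le_sq (by linarith) hV0)
  have hlt : V 0 < W.hetVel := by
    nlinarith [W.hetVel_pos]
  have hnear : W.Near (V 0) := hs.of_le hle' hlt
  -- both orbits turn at `τ`, and the turning time determines the initial velocity
  have hturn : W.turn (V 0) = τ := by
    have h1 : W.turn (V 0) ≤ τ := csInf_le ⟨0, fun t ht => ht.1⟩ ⟨hτ0.le, by rw [← (hpos τ).2, hVτ]⟩
    exact hcrit _ ⟨hnear.turn_pos, by linarith⟩ (by rw [(hpos _).2, hnear.vel_turn])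
  have hstart : V 0 = W.start τ := W.strictMonoOn_turn.injOn hnear hs (by rw [hturn, hT])
  funext x
  have hx : x = -(ℓ / 2) + ε * (x / ε + τ) := by
    rw [mul_add, mul_div_cancel₀ _ hε.ne', hετ]; ring
  have h3 := (hpos (x / ε + τ)).1
  rw [hstart, ← P.sign_mul_kirchhoff_profile hσ] at h3
  have h4 : σ * P.kirchhoff (φ x) = σ * P.kirchhoff (P.profile hσ τ (x / ε + τ)) := by
    rw [← h3]
    change _ = σ * P.kirchhoff (φ (-(ℓ / 2) + ε * (x / ε + τ)))
    rw [← hx]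
  have hσ0 : σ ≠ 0 := by rcases hσ with rfl | rfl <;> norm_num
  exact P.strictMono_kirchhoff.injective (mul_left_cancel₀ hσ0 h4)

end IsProfile

namespace Bistable

variable (P : Bistable) {ε ℓ σ : ℝ} (hσ : σ = 1 ∨ σ = -1)

theorem isWellProfile_iff (hε : 0 < ε) (hτ : (P.toWell σ hσ).minTurn < ℓ / (2 * ε)) (φ : ℝ → ℝ) :
    IsWellProfile P ε ℓ σ φ ↔
      φ = fun x => P.profile hσ (ℓ / (2 * ε)) (x / ε + ℓ / (2 * ε)) := by
  have hprof := P.isProfile_profile hσ hε hτ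
  constructor
  · intro h
    refine h.1.eq_profile hσ hε hτ ?_
    simpa using h.2 _ hprof
  · rintro rfl
    refine ⟨hprof, fun ψ hψ => ?_⟩
    by_contra! hlt
    have := hψ.eq_profile hσ hε hτ (by simpa using hlt.le)
    rw [this] at hlt
    exact lt_irrefl _ hlt

theorem existsUnique_isWellProfile (hε : 0 < ε) (hτ : (P.toWell σ hσ).minTurn < ℓ / (2 * ε)) :
    ∃! φ : ℝ → ℝ, IsWellProfile P ε ℓ σ φ :=
  ⟨_, (P.isWellProfile_iff hσ hε hτ _).2 rfl, fun φ h => (P.isWellProfile_iff hσ hε hτ φ).1 h⟩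

theorem phi_eq (hε : 0 < ε) (hτ : (P.toWell σ hσ).minTurn < ℓ / (2 * ε)) (x : ℝ) :
    phi P ε ℓ σ x = P.profile hσ (ℓ / (2 * ε)) (x / ε + ℓ / (2 * ε)) := by
  have h := Classical.epsilon_spec (P.existsUnique_isWellProfile hσ hε hτ).exists
  rw [P.isWellProfile_iff hσ hε hτ] at h
  rw [phi, h]

/-- The profile is symmetric about the centre of its interval. -/
theorem profile_symm {τ : ℝ} (hτ : (P.toWell σ hσ).minTurn < τ) (t : ℝ) :
    P.profile hσ τ (2 * τ - t) = P.profile hσ τ t := by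
  have h := (((P.toWell σ hσ).near_start hτ).pos_turn_add (τ - t)).1
  rw [(P.toWell σ hσ).turn_start hτ, show τ + (τ - t) = 2 * τ - t by ring, sub_sub_cancel] at h
  rw [profile, profile, h]

end Bistable

/-! ### Estimates for the profiles -/

namespace Bistable

variable (P : Bistable) {σ : ℝ} (hσ : σ = 1 ∨ σ = -1) {τ : ℝ}

/-- The distance from the well of the profile at the centre of its interval. -/
noncomputable def delta (τ : ℝ) : ℝ := σ * (well P σ - P.profile hσ τ τ)

/-- The derivative of the profile in the rescaled half-period `τ`. -/
noncomputable def profileDtau (τ t : ℝ) : ℝ :=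
  (P.Dext (P.profile hσ τ t))⁻¹ * (σ * ((P.toWell σ hσ).lin ((P.toWell σ hσ).start τ) t *
    (P.toWell σ hσ).startDeriv τ))

theorem hasFDerivAt_profile (hτ : (P.toWell σ hσ).minTurn < τ) (t : ℝ) :
    HasFDerivAt (fun q : ℝ × ℝ => P.profile hσ q.1 q.2)
      (P.profileDtau hσ τ t • ContinuousLinearMap.fst ℝ ℝ ℝ +
        P.profileDt hσ τ t • ContinuousLinearMap.snd ℝ ℝ ℝ) (τ, t) := by
  have h1 := ((P.toWell σ hσ).hasFDerivAt_pos_start hτ t).const_mul σ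
  have h2 := HasDerivAt.comp_hasFDerivAt (τ, t) (h₂ := P.kirchhoffInv)
    (f := fun q : ℝ × ℝ => σ * (P.toWell σ hσ).pos ((P.toWell σ hσ).start q.1) q.2)
    (P.hasDerivAt_kirchhoffInv _) h1
  refine h2.congr_fderiv ?_
  ext <;> simp [profileDtau, profileDt, profile]

theorem continuous_profile (τ : ℝ) : Continuous (P.profile hσ τ) :=
  continuous_iff_continuousAt.2 fun t => (P.hasDerivAt_profile hσ τ t).continuousAt

theorem continuous_inv_Dext_profile (τ : ℝ) :
    Continuous fun t => (P.Dext (P.profile hσ τ t))⁻¹ :=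
  (P.continuous_Dext.comp (P.continuous_profile hσ τ)).inv₀ fun _ => (P.Dext_pos _).ne'

theorem continuous_profileDt (τ : ℝ) : Continuous (P.profileDt hσ τ) :=
  (P.continuous_inv_Dext_profile hσ τ).mul
    (continuous_const.mul ((P.toWell σ hσ).continuous_vel _))

theorem continuous_profileDtau (τ : ℝ) : Continuous (P.profileDtau hσ τ) :=
  (P.continuous_inv_Dext_profile hσ τ).mul
    (continuous_const.mul (((P.toWell σ hσ).continuous_lin _).mul continuous_const))

theorem exists_Dext_le : ∃ C, 0 ≤ C ∧ ∀ u, P.Dext u ≤ C := by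
  obtain ⟨C, hC⟩ := isCompact_Icc.exists_bound_of_continuousOn
    (P.contDiffOn_D.continuousOn.mono P.Icc_subset)
  exact ⟨C, (norm_nonneg _).trans (hC P.α (left_mem_Icc.2 P.α_lt_β.le)),
    fun u => (le_abs_self _).trans (hC _ (P.clamp_mem u))⟩

/-- An upper bound of the diffusion coefficient on `[α, β]`. -/
noncomputable def dmax : ℝ := P.exists_Dext_le.choose

theorem dmax_nonneg : 0 ≤ P.dmax := P.exists_Dext_le.choose_spec.1

theorem le_dmax (u : ℝ) : P.Dext u ≤ P.dmax := P.exists_Dext_le.choose_spec.2 u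

theorem inv_Dext_le (u : ℝ) : (P.Dext u)⁻¹ ≤ P.dmin⁻¹ := inv_anti₀ P.dmin_pos (P.dmin_le u)

theorem le_dmax_mul {u v : ℝ} (h : u ≤ v) :
    P.kirchhoff v - P.kirchhoff u ≤ P.dmax * (v - u) :=
  image_sub_le_of_deriv_le h (fun t _ => P.hasDerivAt_kirchhoff t) fun t _ => P.le_dmax t

theorem delta_nonneg (hτ : (P.toWell σ hσ).minTurn < τ) : 0 ≤ P.delta hσ τ := by
  have h := P.profile_mem hσ hτ τ
  rw [delta]
  rcases hσ with rfl | rfl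
  · rw [well_one]; linarith [h.2]
  · rw [well_neg_one]; linarith [h.1]

theorem gap_eq (hτ : (P.toWell σ hσ).minTurn < τ) :
    (P.toWell σ hσ).gap ((P.toWell σ hσ).start τ) =
      σ * (P.kirchhoff (well P σ) - P.kirchhoff (P.profile hσ τ τ)) := by
  rw [Well.gap, (P.toWell σ hσ).turn_start hτ, ← P.sign_mul_kirchhoff_profile hσ, mul_sub]
  rfl

theorem gap_le_delta (hτ : (P.toWell σ hσ).minTurn < τ) :
    (P.toWell σ hσ).gap ((P.toWell σ hσ).start τ) ≤ P.dmax * P.delta hσ τ := by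
  have h := P.profile_mem hσ hτ τ
  rw [P.gap_eq hσ hτ, delta]
  rcases hσ with rfl | rfl
  · rw [well_one] at *
    have := P.le_dmax_mul h.2.le
    linarith
  · rw [well_neg_one] at *
    have := P.le_dmax_mul h.1.le
    linarith

theorem dmin_mul_delta_le (hτ : (P.toWell σ hσ).minTurn < τ) :
    P.dmin * P.delta hσ τ ≤ (P.toWell σ hσ).gap ((P.toWell σ hσ).start τ) := by
  have h := P.profile_mem hσ hτ τ
  rw [P.gap_eq hσ hτ, delta]
  rcases hσ with rfl | rfl
  · rw [well_one] at *
    have := P.dmin_mul_le h.2.le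
    linarith
  · rw [well_neg_one] at *
    have := P.dmin_mul_le h.1.le
    linarith

/-- Bounds for the profiles on the side `σ` of the threshold, with a common constant `C`. -/
structure ProfileBounds (C : ℝ) : Prop where
  abs_dt_le : ∀ τ, (P.toWell σ hσ).minTurn < τ → ∀ t, |P.profileDt hσ τ t| ≤ C
  abs_dtau_le : ∀ τ, (P.toWell σ hσ).minTurn < τ → ∀ t ∈ Icc (-1) τ,
    |P.profileDtau hσ τ t| ≤ C * P.delta hσ τ
  abs_dt_center_le : ∀ τ, (P.toWell σ hσ).minTurn < τ → ∀ t, |t - τ| ≤ 2 →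
    |P.profileDt hσ τ t| ≤ C * P.delta hσ τ
  action : ∀ τ, (P.toWell σ hσ).minTurn < τ →
    |(∫ t in (0 : ℝ)..τ, P.Dext (P.profile hσ τ t) * P.profileDt hσ τ t ^ 2) -
      σ * ∫ u in midValue P..well P σ, Real.sqrt (2 * P.Gext u)| ≤ C * P.delta hσ τ
  delta_le : ∀ τ, (P.toWell σ hσ).minTurn < τ → P.delta hσ τ ≤ C * Real.exp (-(rate P * τ))
  start_le : ∀ τ, (P.toWell σ hσ).minTurn < τ →
    |(P.toWell σ hσ).start τ - (P.toWell σ hσ).hetVel| ≤ C * P.delta hσ τ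

variable {P hσ} in
theorem ProfileBounds.mono {C C' : ℝ} (h : P.ProfileBounds hσ C) (hC : C ≤ C') :
    P.ProfileBounds hσ C' :=
  have hδ : ∀ τ, (P.toWell σ hσ).minTurn < τ → C * P.delta hσ τ ≤ C' * P.delta hσ τ := fun _ hτ =>
    mul_le_mul_of_nonneg_right hC (P.delta_nonneg hσ hτ)
  ⟨fun τ hτ t => (h.abs_dt_le τ hτ t).trans hC,
    fun τ hτ t ht => (h.abs_dtau_le τ hτ t ht).trans (hδ τ hτ),
    fun τ hτ t ht => (h.abs_dt_center_le τ hτ t ht).trans (hδ τ hτ),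
    fun τ hτ => (h.action τ hτ).trans (hδ τ hτ),
    fun τ hτ => (h.delta_le τ hτ).trans (mul_le_mul_of_nonneg_right hC (Real.exp_pos _).le),
    fun τ hτ => (h.start_le τ hτ).trans (hδ τ hτ)⟩

theorem abs_profileDt_le {y : ℝ} {t : ℝ}
    (h : |(P.toWell σ hσ).vel ((P.toWell σ hσ).start τ) t| ≤ y) :
    |P.profileDt hσ τ t| ≤ P.dmin⁻¹ * y := by
  rw [profileDt, abs_mul, abs_of_pos (inv_pos.2 (P.Dext_pos _)), abs_mul, abs_sign hσ, one_mul]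
  exact mul_le_mul (P.inv_Dext_le _) h (abs_nonneg _) (inv_nonneg.2 P.dmin_pos.le)

theorem abs_vel_start_le (hτ : (P.toWell σ hσ).minTurn < τ) (t : ℝ) :
    |(P.toWell σ hσ).vel ((P.toWell σ hσ).start τ) t| ≤
      (P.toWell σ hσ).K * ((P.toWell σ hσ).B - (P.toWell σ hσ).lo) := by
  have hs := (P.toWell σ hσ).near_start hτ
  exact (hs.abs_vel_le t).trans (mul_le_mul_of_nonneg_left (by linarith [(hs.pos_mem t).1])
    (P.toWell σ hσ).K_pos.le)

/-- The action of the heteroclinic orbit in the original variable. -/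
theorem integral_sqrt_H_eq :
    ∫ U in (P.toWell σ hσ).m..(P.toWell σ hσ).B, (P.Dext (P.kirchhoffInv (σ * U)))⁻¹ *
        Real.sqrt (2 * (P.toWell σ hσ).H U) =
      σ * ∫ u in midValue P..well P σ, Real.sqrt (2 * P.Gext u) := by
  have hc : Continuous fun U => (P.Dext (P.kirchhoffInv (σ * U)))⁻¹ := by
    refine (P.continuous_Dext.comp (P.kirchhoffInv.continuous.comp
      (continuous_const.mul continuous_id))).inv₀ fun _ => (P.Dext_pos _).ne'
  have hG : Continuous fun u => Real.sqrt (2 * P.Gext u) := by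
    have : Continuous P.Gext :=
      continuous_iff_continuousAt.2 fun u => (P.hasDerivAt_Gext u).continuousAt
    fun_prop
  have h := intervalIntegral.integral_comp_mul_deriv (a := (P.toWell σ hσ).m)
    (b := (P.toWell σ hσ).B) (f := fun U => P.kirchhoffInv (σ * U))
    (f' := fun U => (P.Dext (P.kirchhoffInv (σ * U)))⁻¹ * σ)
    (g := fun u => Real.sqrt (2 * P.Gext u))
    (fun U _ => (P.hasDerivAt_kirchhoffInv _).comp U
      (by simpa using (hasDerivAt_id U).const_mul σ))
    (hc.mul continuous_const).continuousOn hG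
  have hm : P.kirchhoffInv (σ * (P.toWell σ hσ).m) = midValue P := by
    change P.kirchhoffInv (σ * (σ * P.kirchhoff (midValue P))) = _
    rw [← mul_assoc, sign_mul_self hσ, one_mul, kirchhoffInv_kirchhoff]
  have hB : P.kirchhoffInv (σ * (P.toWell σ hσ).B) = well P σ := by
    change P.kirchhoffInv (σ * (σ * P.kirchhoff (well P σ))) = _
    rw [← mul_assoc, sign_mul_self hσ, one_mul, kirchhoffInv_kirchhoff]
  rw [hm, hB] at h
  rw [← h, ← intervalIntegral.integral_const_mul]
  refine intervalIntegral.integral_congr fun U _ => ?_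
  change _ * Real.sqrt (2 * P.Gext (P.kirchhoffInv (σ * U))) =
    σ * (Real.sqrt (2 * P.Gext (P.kirchhoffInv (σ * U))) * _)
  linear_combination (-((P.Dext (P.kirchhoffInv (σ * U)))⁻¹ *
    Real.sqrt (2 * P.Gext (P.kirchhoffInv (σ * U))))) * sign_mul_self hσ

theorem exists_profileBounds_sign : ∃ C, 0 ≤ C ∧ P.ProfileBounds hσ C := by
  set W := P.toWell σ hσ with hW
  have hd := P.dmin_pos
  have hdi : 0 ≤ P.dmin⁻¹ := inv_nonneg.2 hd.le
  have hD := P.dmax_nonneg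
  have hK := W.K_pos
  have hA := W.A_pos
  have hη := W.eta_pos
  have hv := W.hetVel_pos
  have hBm : 0 < W.B - W.m := by linarith [W.m_lt]
  have hBlo : 0 < W.B - W.lo := by linarith [W.m_lt, W.lo_lt]
  set C₁ := P.dmin⁻¹ * (W.K * (W.B - W.lo)) with hC₁
  set C₂ := P.dmin⁻¹ * (4 * W.K / W.A * P.dmax) with hC₂
  set C₃ := P.dmin⁻¹ * (Real.exp (2 * W.K) * P.dmax) with hC₃
  set C₄ := 2 * P.dmin⁻¹ * W.K * (W.B - W.m) * P.dmax with hC₄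
  set C₅ := P.dmin⁻¹ * ((W.K * W.eta + W.A * W.eta) / W.A *
    Real.exp (W.A * W.entryTime + W.K₂ / (W.A * (W.A / 2) ^ 2) * (W.K * W.eta))) with hC₅
  set C₆ := W.K * W.eta / W.hetVel * P.dmax with hC₆
  have p1 : 0 ≤ C₁ := by positivity
  have p2 : 0 ≤ C₂ := by positivity
  have p3 : 0 ≤ C₃ := by positivity
  have p4 : 0 ≤ C₄ := by positivity
  have p5 : 0 ≤ C₅ := by positivity
  have p6 : 0 ≤ C₆ := by positivity
  have hle : ∀ {x y : ℝ} (τ : ℝ), W.minTurn < τ → x ≤ y * W.gap (W.start τ) → 0 ≤ y →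
      ∀ {z : ℝ}, y * P.dmax ≤ z → x ≤ z * P.delta hσ τ := by
    intro x y τ hτ hx hy z hz
    have h1 := mul_le_mul_of_nonneg_left (P.gap_le_delta hσ hτ) hy
    have h2 := mul_le_mul_of_nonneg_right hz (P.delta_nonneg hσ hτ)
    calc x ≤ _ := hx
      _ ≤ _ := h1
      _ = y * P.dmax * P.delta hσ τ := by ring
      _ ≤ _ := h2
  refine ⟨C₁ + C₂ + C₃ + C₄ + C₅ + C₆, by positivity, ?_, ?_, ?_, ?_, ?_, ?_⟩
  · intro τ hτ t
    exact (P.abs_profileDt_le hσ (P.abs_vel_start_le hσ hτ t)).trans (by linarith)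
  · intro τ hτ t ht
    refine hle (y := P.dmin⁻¹ * (4 * W.K / W.A)) τ hτ ?_ (by positivity)
      (by rw [mul_assoc]; linarith)
    rw [profileDtau, abs_mul, abs_of_pos (inv_pos.2 (P.Dext_pos _)), abs_mul, abs_sign hσ, one_mul,
      mul_assoc]
    exact mul_le_mul (P.inv_Dext_le _) (W.abs_lin_mul_startDeriv_le hτ ht) (abs_nonneg _) hdi
  · intro τ hτ t ht
    have hs := W.near_start hτ
    refine hle (y := P.dmin⁻¹ * Real.exp (2 * W.K)) τ hτ ?_ (by positivity)
      (by rw [mul_assoc]; linarith)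
    rw [mul_assoc]
    exact P.abs_profileDt_le hσ (hs.abs_vel_near_turn (by rwa [W.turn_start hτ]))
  · intro τ hτ
    have hs := W.near_start hτ
    refine hle (y := 2 * P.dmin⁻¹ * W.K * (W.B - W.m)) τ hτ ?_ (by positivity) (by linarith)
    have hc : Continuous fun U => (P.Dext (P.kirchhoffInv (σ * U)))⁻¹ := by
      refine (P.continuous_Dext.comp (P.kirchhoffInv.continuous.comp
        (continuous_const.mul continuous_id))).inv₀ fun _ => (P.Dext_pos _).ne'
    have := hs.abs_integral_vel_sq_sub_le hc (fun U => (inv_pos.2 (P.Dext_pos _)).le)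
      (fun U => P.inv_Dext_le _)
    rw [P.integral_sqrt_H_eq hσ, W.turn_start hτ] at this
    have heq : (∫ t in (0 : ℝ)..τ, P.Dext (P.profile hσ τ t) * P.profileDt hσ τ t ^ 2) =
        ∫ t in (0 : ℝ)..τ, (P.Dext (P.kirchhoffInv (σ * W.pos (W.start τ) t)))⁻¹ *
          W.vel (W.start τ) t ^ 2 := by
      refine intervalIntegral.integral_congr fun t _ => ?_
      change P.Dext (P.profile hσ τ t) * P.profileDt hσ τ t ^ 2 =
        (P.Dext (P.profile hσ τ t))⁻¹ * W.vel (W.start τ) t ^ 2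
      have h1 := (P.Dext_pos (P.profile hσ τ t)).ne'
      rw [profileDt]
      field_simp
      linear_combination (W.vel (W.start τ) t ^ 2) * sign_mul_self hσ
    rw [heq]
    exact this
  · intro τ hτ
    have hs := W.near_start hτ
    have h1 := hs.gap_le
    rw [W.turn_start hτ] at h1
    have h2 := P.dmin_mul_delta_le hσ hτ
    have h3 : Real.exp (-(W.A * τ)) ≤ Real.exp (-(rate P * τ)) :=
      Real.exp_le_exp.2 (neg_le_neg (mul_le_mul_of_nonneg_right (P.rate_le_A hσ)
        (W.minTurn_pos.trans hτ).le))
    have h4 : P.delta hσ τ ≤ C₅ * Real.exp (-(W.A * τ)) := by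
      rw [hC₅, mul_assoc, ← div_eq_inv_mul, le_div_iff₀ hd]
      linarith
    refine h4.trans ((mul_le_mul_of_nonneg_left h3 p5).trans
      (mul_le_mul_of_nonneg_right (by linarith) (Real.exp_pos _).le))
  · intro τ hτ
    have hs := W.near_start hτ
    exact hle τ hτ hs.hetVel_sub_le (by positivity) (by linarith)

theorem exists_profileBounds :
    ∃ C, 0 ≤ C ∧ ∀ (σ : ℝ) (hσ : σ = 1 ∨ σ = -1), P.ProfileBounds hσ C := by
  obtain ⟨C, hC, h⟩ := P.exists_profileBounds_sign (σ := 1) (Or.inl rfl)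
  obtain ⟨C', hC', h'⟩ := P.exists_profileBounds_sign (σ := -1) (Or.inr rfl)
  refine ⟨C + C', by positivity, fun σ hσ => ?_⟩
  rcases hσ with rfl | rfl
  · exact h.mono (by linarith)
  · exact h'.mono (by linarith)

/-- A profile is monotone on either half of its interval, so its variation there is bounded. -/
theorem integral_abs_profileDt_le (hτ : (P.toWell σ hσ).minTurn < τ) :
    ∫ t in (0 : ℝ)..τ, |P.profileDt hσ τ t| ≤ P.β - P.α := by
  set W := P.toWell σ hσ with hW
  have hs := W.near_start hτ
  have hτ0 : 0 ≤ τ := (W.minTurn_pos.trans hτ).le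
  have hcongr : ∫ t in (0 : ℝ)..τ, |P.profileDt hσ τ t| =
      ∫ t in (0 : ℝ)..τ, σ * P.profileDt hσ τ t := by
    refine intervalIntegral.integral_congr fun t ht => ?_
    rw [uIcc_of_le hτ0] at ht
    have h1 := hs.vel_nonneg (t := t) (by rwa [W.turn_start hτ])
    have h2 : σ * P.profileDt hσ τ t =
        (P.Dext (P.profile hσ τ t))⁻¹ * W.vel (W.start τ) t := by
      rw [profileDt]
      linear_combination ((P.Dext (P.profile hσ τ t))⁻¹ * W.vel (W.start τ) t) * sign_mul_self hσ
    have h3 : |P.profileDt hσ τ t| = |σ * P.profileDt hσ τ t| := by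
      rw [abs_mul, abs_sign hσ, one_mul]
    simp only [h3]
    rw [h2, abs_of_nonneg (mul_nonneg (inv_pos.2 (P.Dext_pos _)).le h1)]
  rw [hcongr, intervalIntegral.integral_const_mul, intervalIntegral.integral_eq_sub_of_hasDerivAt
    (fun t _ => P.hasDerivAt_profile hσ τ t) ((P.continuous_profileDt hσ τ).intervalIntegrable _ _),
    P.profile_zero]
  have h1 := P.profile_mem hσ hτ τ
  have h2 := P.midValue_mem
  rcases hσ with rfl | rfl <;> linarith [h1.1, h1.2, h2.1, h2.2]

/-- On both sides of the threshold the orbits are those of the single equation `v'' = F(v)`, run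
forwards or backwards in time. -/
theorem sign_mul_pos_toWell (s t : ℝ) :
    σ * (P.toWell σ hσ).pos s t = (P.toWell 1 (Or.inl rfl)).pos s (σ * t) ∧
      (P.toWell σ hσ).vel s t = (P.toWell 1 (Or.inl rfl)).vel s (σ * t) := by
  rcases hσ with rfl | rfl
  · simp
  · have key := (P.toWell (-1) (Or.inr rfl)).eq_of_solution
      (x := fun t => -(P.toWell 1 (Or.inl rfl)).pos s (-t))
      (v := fun t => (P.toWell 1 (Or.inl rfl)).vel s (-t))
      (y := (P.toWell (-1) (Or.inr rfl)).pos s) (w := (P.toWell (-1) (Or.inr rfl)).vel s)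
      (fun t => ⟨(hasDerivAt_comp_neg ((P.toWell 1 (Or.inl rfl)).hasDerivAt_pos s _)).fun_neg.congr_deriv
          (by simp), (hasDerivAt_comp_neg ((P.toWell 1 (Or.inl rfl)).hasDerivAt_vel s _)).congr_deriv
          (by simp [toWell])⟩)
      (fun t => ⟨Well.hasDerivAt_pos _ s t, Well.hasDerivAt_vel _ s t⟩)
      (by rw [neg_zero, Well.pos_zero, Well.pos_zero]; simp [toWell])
      (by rw [neg_zero, Well.vel_zero, Well.vel_zero]) t
    rw [neg_one_mul, neg_one_mul, ← key.1, ← key.2, neg_neg]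
    exact ⟨rfl, rfl⟩

theorem hetVel_toWell : (P.toWell σ hσ).hetVel = (P.toWell 1 (Or.inl rfl)).hetVel := by
  have : ∀ (σ : ℝ) (hσ : σ = 1 ∨ σ = -1),
      (P.toWell σ hσ).hetVel = Real.sqrt (2 * P.Gext (midValue P)) := fun σ hσ => by
    rw [Well.hetVel]
    change Real.sqrt (2 * P.Gext (P.kirchhoffInv (σ * (σ * P.kirchhoff (midValue P))))) = _
    rw [← mul_assoc, sign_mul_self hσ, one_mul, kirchhoffInv_kirchhoff]
  rw [this, this]

theorem exists_Dext_lip : ∃ C, 0 ≤ C ∧ ∀ u v, |P.Dext u - P.Dext v| ≤ C * |u - v| :=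
  P.exists_lipschitz_clamp P.contDiffOn_D

/-- Across an interface, the two adjacent profiles and their derivatives differ by a multiple of
the distances from the wells, because both are close to the heteroclinic orbit. -/
theorem exists_interface_bound : ∃ C, 0 ≤ C ∧ ∀ (σ : ℝ) (hσ : σ = 1 ∨ σ = -1)
    (hσ' : -σ = 1 ∨ -σ = -1) (τ τ' : ℝ), (P.toWell σ hσ).minTurn < τ →
    (P.toWell (-σ) hσ').minTurn < τ' → ∀ z, |z| ≤ 1 →
    |P.profile hσ τ (-z) - P.profile hσ' τ' z| ≤ C * (P.delta hσ τ + P.delta hσ' τ') ∧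
    |-P.profileDt hσ τ (-z) - P.profileDt hσ' τ' z| ≤
      C * (P.delta hσ τ + P.delta hσ' τ') := by
  obtain ⟨C₀, hC₀, hb⟩ := P.exists_profileBounds
  obtain ⟨CD, hCD, hDlip⟩ := P.exists_Dext_lip
  set W := P.toWell 1 (Or.inl rfl) with hW
  have hd := P.dmin_pos
  set d' := P.dmin⁻¹ with hd'
  have hdi : 0 < d' := inv_pos.2 hd
  have hK := W.K_pos
  set E := Real.exp W.K with hE
  have hE0 : 0 < E := Real.exp_pos _
  set C₁ := d' * (C₀ * E) with hC₁
  set V := C₀ * P.dmax with hV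
  have hD := P.dmax_nonneg
  refine ⟨C₁ + (d' * (C₀ * E) + d' ^ 2 * (CD * C₁) * V), by positivity, ?_⟩
  intro σ hσ hσ' τ τ' hτ hτ' z hz
  set s := (P.toWell σ hσ).start τ with hs
  set s' := (P.toWell (-σ) hσ').start τ' with hs'
  set Δ := P.delta hσ τ + P.delta hσ' τ' with hΔ
  have hΔ0 : 0 ≤ Δ := add_nonneg (P.delta_nonneg hσ hτ) (P.delta_nonneg hσ' hτ')
  have hss : |s - s'| ≤ C₀ * Δ := by
    have h1 := (hb σ hσ).start_le τ hτ
    have h2 := (hb (-σ) hσ').start_le τ' hτ'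
    rw [P.hetVel_toWell] at h1 h2
    calc |s - s'| = |(s - W.hetVel) - (s' - W.hetVel)| := by ring_nf
      _ ≤ |s - W.hetVel| + |s' - W.hetVel| := abs_sub _ _
      _ ≤ _ := by rw [hΔ, mul_add]; exact add_le_add h1 h2
  set y := -σ * z with hy
  have hyz : |y| ≤ 1 := by rw [hy, abs_mul, abs_neg, abs_sign hσ, one_mul]; exact hz
  -- both profiles are orbits of the same flow, at the same time `y`
  have hp : P.profile hσ τ (-z) = P.kirchhoffInv (W.pos s y) := by
    rw [profile, (P.sign_mul_pos_toWell hσ _ _).1, hy, neg_mul, mul_neg]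
  have hp' : P.profile hσ' τ' z = P.kirchhoffInv (W.pos s' y) := by
    rw [profile, (P.sign_mul_pos_toWell hσ' _ _).1]
  have hv : -P.profileDt hσ τ (-z) =
      -σ * ((P.Dext (P.profile hσ τ (-z)))⁻¹ * W.vel s y) := by
    rw [profileDt, (P.sign_mul_pos_toWell hσ _ _).2, hy, neg_mul, mul_neg, neg_mul, mul_left_comm]
  have hv' : P.profileDt hσ' τ' z =
      -σ * ((P.Dext (P.profile hσ' τ' z))⁻¹ * W.vel s' y) := by
    rw [profileDt, (P.sign_mul_pos_toWell hσ' _ _).2, mul_left_comm]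
  have hexp : |s - s'| * Real.exp (W.K * |y|) ≤ C₀ * E * Δ := by
    have h1 : Real.exp (W.K * |y|) ≤ E := Real.exp_le_exp.2 (by nlinarith)
    calc _ ≤ (C₀ * Δ) * E := mul_le_mul hss h1 (Real.exp_pos _).le (by positivity)
      _ = _ := by ring
  have hpos := W.abs_pos_sub_le s' s y
  have h1 : |P.profile hσ τ (-z) - P.profile hσ' τ' z| ≤ C₁ * Δ := by
    rw [hp, hp']
    refine (P.abs_kirchhoffInv_sub_le _ _).trans ?_
    rw [hC₁, mul_assoc]
    exact mul_le_mul_of_nonneg_left (hpos.1.trans hexp) hdi.le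
  have hrest : 0 ≤ (d' * (C₀ * E) + d' ^ 2 * (CD * C₁) * V) * Δ := by positivity
  refine ⟨by rw [add_mul]; linarith, ?_⟩
  have hvb : |W.vel s' y| ≤ V := by
    have h2 := P.Dext_mul_profileDt hσ' τ' z
    rw [(P.sign_mul_pos_toWell hσ' _ _).2] at h2
    have h3 : |W.vel s' y| = |P.Dext (P.profile hσ' τ' z) * P.profileDt hσ' τ' z| := by
      rw [h2, abs_mul, abs_sign hσ', one_mul]
    rw [h3, abs_mul, abs_of_pos (P.Dext_pos _), mul_comm, hV]
    exact mul_le_mul ((hb _ hσ').abs_dt_le τ' hτ' z) (P.le_dmax _) (P.Dext_pos _).le hC₀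
  rw [hv, hv', ← mul_sub, abs_mul, abs_neg, abs_sign hσ, one_mul]
  set x := P.Dext (P.profile hσ τ (-z)) with hx
  set x' := P.Dext (P.profile hσ' τ' z) with hx'
  have hx0 : 0 < x := P.Dext_pos _
  have hx0' : 0 < x' := P.Dext_pos _
  have hxx : |x⁻¹ - x'⁻¹| ≤ d' ^ 2 * (CD * C₁) * Δ := by
    have : x⁻¹ - x'⁻¹ = x⁻¹ * x'⁻¹ * (x' - x) := by field_simp
    rw [this, abs_mul, abs_of_pos (by positivity), mul_assoc]
    have h3 : |x' - x| ≤ CD * C₁ * Δ := by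
      rw [abs_sub_comm, mul_assoc]
      exact (hDlip _ _).trans (mul_le_mul_of_nonneg_left h1 hCD)
    calc x⁻¹ * (x'⁻¹ * |x' - x|) = x⁻¹ * x'⁻¹ * |x' - x| := by ring
      _ ≤ d' * d' * (CD * C₁ * Δ) := mul_le_mul
          (mul_le_mul (P.inv_Dext_le _) (P.inv_Dext_le _) (by positivity) hdi.le) h3
          (abs_nonneg _) (by positivity)
      _ = _ := by ring
  have h4 : x⁻¹ * W.vel s y - x'⁻¹ * W.vel s' y =
      x⁻¹ * (W.vel s y - W.vel s' y) + (x⁻¹ - x'⁻¹) * W.vel s' y := by ring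
  have h5 : |x⁻¹ * (W.vel s y - W.vel s' y)| ≤ d' * (C₀ * E * Δ) := by
    rw [abs_mul, abs_of_pos (inv_pos.2 hx0)]
    exact mul_le_mul (P.inv_Dext_le _) (hpos.2.trans hexp) (abs_nonneg _) hdi.le
  have h6 : |(x⁻¹ - x'⁻¹) * W.vel s' y| ≤ d' ^ 2 * (CD * C₁) * Δ * V := by
    rw [abs_mul]
    exact mul_le_mul hxx hvb (abs_nonneg _) (by positivity)
  have h7 : 0 ≤ C₁ * Δ := by positivity
  rw [h4]
  refine (abs_add_le _ _).trans ?_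
  calc _ ≤ d' * (C₀ * E * Δ) + d' ^ 2 * (CD * C₁) * Δ * V := add_le_add h5 h6
    _ ≤ C₁ * Δ + (d' * (C₀ * E * Δ) + d' ^ 2 * (CD * C₁) * Δ * V) := by linarith
    _ = _ := by ring

end Bistable

/-! ### The rescaled transition layer -/

namespace Cutoff

variable (X : Cutoff)

/-- The cut-off function `z ↦ 1 - χ(-z)`. Exchanging `χ` for it reflects a transition layer, so
that the two sides of a layer can be treated alike. -/
def flip : Cutoff where
  χ z := 1 - X.χ (-z)
  contDiff := contDiff_const.sub (X.contDiff.comp contDiff_neg)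
  mem_Icc x := ⟨by linarith [(X.mem_Icc (-x)).2], by linarith [(X.mem_Icc (-x)).1]⟩
  eq_zero x hx := by rw [X.eq_one _ (by linarith), sub_self]
  eq_one x hx := by rw [X.eq_zero _ (by linarith), sub_zero]

theorem hasDerivAt (z : ℝ) : HasDerivAt X.χ (deriv X.χ z) z :=
  ((X.contDiff.differentiable (by simp)) z).hasDerivAt

theorem continuous : Continuous X.χ := X.contDiff.continuous

theorem continuous_deriv : Continuous (deriv X.χ) := X.contDiff.continuous_deriv (by simp)

theorem deriv_flip (z : ℝ) : deriv X.flip.χ z = deriv X.χ (-z) := by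
  have h := (hasDerivAt_comp_neg (X.hasDerivAt (-z))).const_sub 1
  rw [show deriv X.flip.χ z = deriv (fun z => 1 - X.χ (-z)) z from rfl, h.deriv, neg_neg]

/-- At a point of `[1, ∞)` the function `χ` attains its maximum. -/
theorem deriv_eq_zero {z : ℝ} (hz : 1 ≤ z) : deriv X.χ z = 0 :=
  IsLocalMax.deriv_eq_zero (Filter.Eventually.of_forall fun y => by
    rw [X.eq_one z hz]; exact (X.mem_Icc y).2)

theorem exists_abs_deriv_le : ∃ M, 0 ≤ M ∧ ∀ z, |z| ≤ 1 → |deriv X.χ z| ≤ M := by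
  obtain ⟨M, hM⟩ := (isCompact_Icc (a := (-1 : ℝ)) (b := 1)).exists_bound_of_continuousOn
    X.continuous_deriv.continuousOn
  exact ⟨M, (norm_nonneg _).trans (hM 0 (by norm_num)), fun z hz => hM z (abs_le.1 hz)⟩

/-- The rescaled cut-off function `γ^j`, in the coordinate `z` centred at the layer, for a cell that
extends from `-τ` to `τ'`. -/
def window (τ τ' z : ℝ) : ℝ := X.χ (z + τ - 1) * (1 - X.χ (z - τ' + 1))

variable {X} {τ τ' z : ℝ}

theorem window_mem : X.window τ τ' z ∈ Icc (0 : ℝ) 1 := by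
  have h1 := X.mem_Icc (z + τ - 1)
  have h2 := X.mem_Icc (z - τ' + 1)
  exact ⟨mul_nonneg h1.1 (by linarith [h2.2]), mul_le_one₀ h1.2 (by linarith [h2.2])
    (by linarith [h2.1])⟩

theorem window_eq_zero (hz : z ∉ Ioo (-τ) τ') : X.window τ τ' z = 0 := by
  rw [window]
  by_cases h : -τ < z
  · rw [X.eq_one (z - τ' + 1) (by linarith [not_lt.1 fun h' => hz ⟨h, h'⟩]), sub_self, mul_zero]
  · rw [X.eq_zero (z + τ - 1) (by linarith), zero_mul]

theorem window_eq_one (h1 : 2 - τ ≤ z) (h2 : z ≤ τ' - 2) : X.window τ τ' z = 1 := by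
  rw [window, X.eq_one _ (by linarith), X.eq_zero _ (by linarith)]
  norm_num

theorem window_flip : X.flip.window τ' τ (-z) = X.window τ τ' z := by
  change (1 - X.χ (-(-z + τ' - 1))) * (1 - (1 - X.χ (-(-z - τ + 1)))) =
    X.χ (z + τ - 1) * (1 - X.χ (z - τ' + 1))
  rw [show -(-z + τ' - 1) = z - τ' + 1 by ring, show -(-z - τ + 1) = z + τ - 1 by ring]
  ring

theorem continuous_window : Continuous (X.window τ τ') := by
  have := X.continuous
  unfold window
  fun_prop

end Cutoff

namespace Bistable

variable (P : Bistable) (X : Cutoff) {σ σ' : ℝ} (hσ : σ = 1 ∨ σ = -1) (hσ' : σ' = 1 ∨ σ' = -1)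
  {τ τ' : ℝ}

/-- The rescaled function `u^h` near a layer at `z = 0`: the profiles on the sides `σ` and `σ'`,
with half-periods `τ` and `τ'`, joined by `χ`. -/
noncomputable def layer (τ τ' z : ℝ) : ℝ :=
  (1 - X.χ z) * P.profile hσ τ (-z) + X.χ z * P.profile hσ' τ' z

/-- The derivative of `layer` in `z`. -/
noncomputable def layerDz (τ τ' z : ℝ) : ℝ :=
  deriv X.χ z * (P.profile hσ' τ' z - P.profile hσ τ (-z)) -
    (1 - X.χ z) * P.profileDt hσ τ (-z) + X.χ z * P.profileDt hσ' τ' z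

/-- The derivative of `layer` in `τ`, which only enters through the profile on the left. -/
noncomputable def layerDleft (τ z : ℝ) : ℝ := (1 - X.χ z) * P.profileDtau hσ τ (-z)

/-- The derivative of `layer` in `τ'`, which only enters through the profile on the right. -/
noncomputable def layerDright (τ' z : ℝ) : ℝ := X.χ z * P.profileDtau hσ' τ' z

theorem hasDerivAt_layer {T T' ζ : ℝ → ℝ} {T₁ T₁' ζ₁ t : ℝ}
    (hτ : (P.toWell σ hσ).minTurn < T t) (hτ' : (P.toWell σ' hσ').minTurn < T' t)
    (hT : HasDerivAt T T₁ t) (hT' : HasDerivAt T' T₁' t) (hζ : HasDerivAt ζ ζ₁ t) :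
    HasDerivAt (fun t => P.layer X hσ hσ' (T t) (T' t) (ζ t))
      (T₁ * P.layerDleft X hσ (T t) (ζ t) + T₁' * P.layerDright X hσ' (T' t) (ζ t) +
        ζ₁ * P.layerDz X hσ hσ' (T t) (T' t) (ζ t)) t := by
  have h1 : HasDerivAt (fun t => P.profile hσ (T t) (-ζ t)) _ t :=
    HasFDerivAt.comp_hasDerivAt (f := fun t => (T t, -ζ t)) t
      (P.hasFDerivAt_profile hσ hτ (-ζ t)) (hT.prodMk hζ.fun_neg)
  have h2 : HasDerivAt (fun t => P.profile hσ' (T' t) (ζ t)) _ t :=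
    HasFDerivAt.comp_hasDerivAt (f := fun t => (T' t, ζ t)) t
      (P.hasFDerivAt_profile hσ' hτ' (ζ t)) (hT'.prodMk hζ)
  have h3 : HasDerivAt (fun t => X.χ (ζ t)) _ t := (X.hasDerivAt (ζ t)).comp t hζ
  refine (((h3.const_sub 1).mul h1).add (h3.mul h2)).congr_deriv ?_
  simp only [layerDleft, layerDright, layerDz, add_apply,
    smul_apply, ContinuousLinearMap.coe_fst', ContinuousLinearMap.coe_snd',
    smul_eq_mul]
  ring

theorem layer_mem (hτ : (P.toWell σ hσ).minTurn < τ) (hτ' : (P.toWell σ' hσ').minTurn < τ')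
    (z : ℝ) : P.layer X hσ hσ' τ τ' z ∈ Icc P.α P.β := by
  have h := X.mem_Icc z
  exact convex_Icc P.α P.β (Ioo_subset_Icc_self (P.profile_mem hσ hτ (-z)))
    (Ioo_subset_Icc_self (P.profile_mem hσ' hτ' z)) (by linarith [h.2]) h.1 (by ring)

theorem layer_flip (τ τ' z : ℝ) :
    P.layer X.flip hσ' hσ τ' τ (-z) = P.layer X hσ hσ' τ τ' z := by
  change (1 - (1 - X.χ (-(-z)))) * _ + (1 - X.χ (-(-z))) * _ = _
  rw [neg_neg, layer]
  ring

theorem layerDz_flip (τ τ' z : ℝ) :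
    P.layerDz X.flip hσ' hσ τ' τ (-z) = -P.layerDz X hσ hσ' τ τ' z := by
  rw [layerDz, Cutoff.deriv_flip, neg_neg]
  change _ - (1 - (1 - X.χ (-(-z)))) * _ + (1 - X.χ (-(-z))) * _ = _
  rw [neg_neg, layerDz]
  ring

theorem continuous_layer (τ τ' : ℝ) : Continuous (P.layer X hσ hσ' τ τ') := by
  have h1 := X.continuous
  have h2 := P.continuous_profile hσ τ
  have h3 := P.continuous_profile hσ' τ'
  unfold layer
  fun_prop

theorem continuous_layerDz (τ τ' : ℝ) : Continuous (P.layerDz X hσ hσ' τ τ') := by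
  have h1 := X.continuous
  have h2 := P.continuous_profile hσ τ
  have h3 := P.continuous_profile hσ' τ'
  have h4 := X.continuous_deriv
  have h5 := P.continuous_profileDt hσ τ
  have h6 := P.continuous_profileDt hσ' τ'
  unfold layerDz
  fun_prop

theorem continuous_layerDleft (τ : ℝ) : Continuous (P.layerDleft X hσ τ) := by
  have h1 := X.continuous
  have h2 := P.continuous_profileDtau hσ τ
  unfold layerDleft
  fun_prop

theorem continuous_layerDright (τ' : ℝ) : Continuous (P.layerDright X hσ' τ') := by
  have h1 := X.continuous
  have h2 := P.continuous_profileDtau hσ' τ'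
  unfold layerDright
  fun_prop

/-- The rescaled density `γ D(u) u_x²` of the action of a layer. -/
noncomputable def layerAction (τ τ' z : ℝ) : ℝ :=
  X.window τ τ' z * P.Dext (P.layer X hσ hσ' τ τ' z) * P.layerDz X hσ hσ' τ τ' z ^ 2

theorem continuous_layerAction (τ τ' : ℝ) : Continuous (P.layerAction X hσ hσ' τ τ') := by
  have h1 := P.continuous_layer X hσ hσ' τ τ'
  have h2 := P.continuous_layerDz X hσ hσ' τ τ'
  have h3 := X.continuous_window (τ := τ) (τ' := τ')
  have h4 := P.continuous_Dext
  unfold layerAction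
  fun_prop

theorem layerAction_flip (τ τ' z : ℝ) :
    P.layerAction X.flip hσ' hσ τ' τ (-z) = P.layerAction X hσ hσ' τ τ' z := by
  rw [layerAction, Cutoff.window_flip, layer_flip, layerDz_flip, neg_sq, layerAction]

theorem delta_le_width (hτ : (P.toWell σ hσ).minTurn < τ) : P.delta hσ τ ≤ P.β - P.α := by
  have h1 := P.profile_mem hσ hτ τ
  rw [delta]
  rcases hσ with rfl | rfl
  · rw [well_one]; linarith [h1.1]
  · rw [well_neg_one]; linarith [h1.2]

/-- On the right half of a cell the layer differs little from the profile there. -/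
theorem exists_layer_bound : ∃ C, 0 ≤ C ∧ ∀ (σ : ℝ) (hσ : σ = 1 ∨ σ = -1) (σ' : ℝ)
    (hσ' : σ' = 1 ∨ σ' = -1), σ' = -σ → ∀ τ τ', (P.toWell σ hσ).minTurn < τ →
    (P.toWell σ' hσ').minTurn < τ' → ∀ z ∈ Icc (0 : ℝ) 1,
    |P.layer X hσ hσ' τ τ' z - P.profile hσ' τ' z| ≤ C * (P.delta hσ τ + P.delta hσ' τ') ∧
    |P.layerDz X hσ hσ' τ τ' z - P.profileDt hσ' τ' z| ≤
      C * (P.delta hσ τ + P.delta hσ' τ') := by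
  obtain ⟨C, hC, h⟩ := P.exists_interface_bound
  obtain ⟨M, hM, hχ⟩ := X.exists_abs_deriv_le
  refine ⟨(M + 1) * C, by positivity, ?_⟩
  rintro σ hσ _ hσ' rfl τ τ' hτ hτ' z hz
  have hz' : |z| ≤ 1 := abs_le.2 ⟨by linarith [hz.1], hz.2⟩
  obtain ⟨h1, h2⟩ := h σ hσ hσ' τ τ' hτ hτ' z hz'
  set Δ := P.delta hσ τ + P.delta hσ' τ' with hΔ
  have hΔ0 : 0 ≤ Δ := add_nonneg (P.delta_nonneg hσ hτ) (P.delta_nonneg hσ' hτ')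
  have hm := X.mem_Icc z
  have hm1 : |1 - X.χ z| ≤ 1 := abs_le.2 ⟨by linarith [hm.2], by linarith [hm.1]⟩
  have hCΔ : 0 ≤ C * Δ := by positivity
  have e1 : P.layer X hσ hσ' τ τ' z - P.profile hσ' τ' z =
      (1 - X.χ z) * (P.profile hσ τ (-z) - P.profile hσ' τ' z) := by rw [layer]; ring
  have e2 : P.layerDz X hσ hσ' τ τ' z - P.profileDt hσ' τ' z =
      -(deriv X.χ z * (P.profile hσ τ (-z) - P.profile hσ' τ' z)) +
        (1 - X.χ z) * (-P.profileDt hσ τ (-z) - P.profileDt hσ' τ' z) := by rw [layerDz]; ring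
  have b1 : |(1 - X.χ z) * (P.profile hσ τ (-z) - P.profile hσ' τ' z)| ≤ 1 * (C * Δ) := by
    rw [abs_mul]; exact mul_le_mul hm1 h1 (abs_nonneg _) zero_le_one
  have b2 : |(1 - X.χ z) * (-P.profileDt hσ τ (-z) - P.profileDt hσ' τ' z)| ≤ 1 * (C * Δ) := by
    rw [abs_mul]; exact mul_le_mul hm1 h2 (abs_nonneg _) zero_le_one
  have b3 : |deriv X.χ z * (P.profile hσ τ (-z) - P.profile hσ' τ' z)| ≤ M * (C * Δ) := by
    rw [abs_mul]; exact mul_le_mul (hχ z hz') h1 (abs_nonneg _) hM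
  have hMC : 0 ≤ M * (C * Δ) := by positivity
  refine ⟨?_, ?_⟩
  · rw [e1]
    calc _ ≤ _ := b1
      _ ≤ M * (C * Δ) + 1 * (C * Δ) := by linarith
      _ = _ := by ring
  · rw [e2]
    refine (abs_add_le _ _).trans ?_
    rw [abs_neg]
    calc _ ≤ M * (C * Δ) + 1 * (C * Δ) := add_le_add b3 b2
      _ = _ := by ring

theorem layer_eq_right {z : ℝ} (hz : 1 ≤ z) :
    P.layer X hσ hσ' τ τ' z = P.profile hσ' τ' z ∧
      P.layerDz X hσ hσ' τ τ' z = P.profileDt hσ' τ' z := by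
  rw [layer, layerDz, X.eq_one z hz, X.deriv_eq_zero hz]
  exact ⟨by ring, by ring⟩

/-- The variation and the action of a layer on the right half of its cell. -/
theorem exists_half_layer_bound : ∃ C, 0 ≤ C ∧ ∀ (σ : ℝ) (hσ : σ = 1 ∨ σ = -1) (σ' : ℝ)
    (hσ' : σ' = 1 ∨ σ' = -1), σ' = -σ → ∀ τ τ', (P.toWell σ hσ).minTurn < τ →
    (P.toWell σ' hσ').minTurn < τ' → 3 ≤ τ → 3 ≤ τ' →
    (∫ z in (0 : ℝ)..τ', |P.layerDz X hσ hσ' τ τ' z|) ≤ C ∧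
    |(∫ z in (0 : ℝ)..τ', P.layerAction X hσ hσ' τ τ' z) -
      σ' * ∫ u in midValue P..well P σ', Real.sqrt (2 * P.Gext u)| ≤
        C * (P.delta hσ τ + P.delta hσ' τ') := by
  obtain ⟨C₀, hC₀, hb⟩ := P.exists_profileBounds
  obtain ⟨C₁, hC₁, hl⟩ := P.exists_layer_bound X
  obtain ⟨CD, hCD, hDlip⟩ := P.exists_Dext_lip
  have hD := P.dmax_nonneg
  have hw : 0 < P.β - P.α := sub_pos.2 P.α_lt_β
  set w := P.β - P.α with hw'
  set K := C₀ + C₁ * (2 * w) with hK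
  have hK0 : 0 ≤ K := by positivity
  set E := CD * C₁ * K ^ 2 + P.dmax * (C₁ * (2 * K)) with hE
  have hE0 : 0 ≤ E := by positivity
  refine ⟨(K + w) + (C₀ + E + P.dmax * C₀ * w), by positivity, ?_⟩
  intro σ hσ σ' hσ' hσσ τ τ' hτ hτ' h3 h3'
  have hl' := hl σ hσ σ' hσ' hσσ τ τ' hτ hτ'
  have hδ := P.delta_nonneg hσ hτ
  have hδ' := P.delta_nonneg hσ' hτ'
  have hδw := P.delta_le_width hσ hτ
  have hδw' := P.delta_le_width hσ' hτ'
  set Δ := P.delta hσ τ + P.delta hσ' τ' with hΔ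
  have hΔ0 : 0 ≤ Δ := add_nonneg hδ hδ'
  have hΔw : Δ ≤ 2 * w := by rw [hΔ]; linarith
  have hdt : ∀ z, |P.profileDt hσ' τ' z| ≤ C₀ := (hb σ' hσ').abs_dt_le τ' hτ'
  have hLK : ∀ z ∈ Icc (0 : ℝ) 1, |P.layerDz X hσ hσ' τ τ' z| ≤ K := by
    intro z hz
    have e : P.layerDz X hσ hσ' τ τ' z = P.profileDt hσ' τ' z +
      (P.layerDz X hσ hσ' τ τ' z - P.profileDt hσ' τ' z) := by ring
    rw [e]
    exact (abs_add_le _ _).trans (add_le_add (hdt z)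
      ((hl' z hz).2.trans (mul_le_mul_of_nonneg_left hΔw hC₁)))
  have cL := P.continuous_layerDz X hσ hσ' τ τ'
  have cZ := P.continuous_profileDt hσ' τ'
  have cA := P.continuous_layerAction X hσ hσ' τ τ'
  have cP : Continuous fun z => P.Dext (P.profile hσ' τ' z) * P.profileDt hσ' τ' z ^ 2 :=
    (P.continuous_Dext.comp (P.continuous_profile hσ' τ')).mul (cZ.pow 2)
  have hvar : ∫ z in (1 : ℝ)..τ', |P.profileDt hσ' τ' z| ≤ w := by
    refine le_trans ?_ (P.integral_abs_profileDt_le hσ' hτ')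
    rw [← intervalIntegral.integral_add_adjacent_intervals
      (cZ.abs.intervalIntegrable 0 1) (cZ.abs.intervalIntegrable 1 τ')]
    have := intervalIntegral.integral_nonneg (μ := volume) (zero_le_one' ℝ)
      fun z _ => abs_nonneg (P.profileDt hσ' τ' z)
    linarith
  refine ⟨?_, ?_⟩
  · rw [← intervalIntegral.integral_add_adjacent_intervals
      (cL.abs.intervalIntegrable 0 1) (cL.abs.intervalIntegrable 1 τ')]
    have i1 : ∫ z in (0 : ℝ)..1, |P.layerDz X hσ hσ' τ τ' z| ≤ ∫ z in (0 : ℝ)..1, K :=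
      intervalIntegral.integral_mono_on zero_le_one (cL.abs.intervalIntegrable 0 1)
        (continuous_const.intervalIntegrable 0 1) hLK
    have i2 : ∫ z in (1 : ℝ)..τ', |P.layerDz X hσ hσ' τ τ' z| =
        ∫ z in (1 : ℝ)..τ', |P.profileDt hσ' τ' z| := by
      refine intervalIntegral.integral_congr fun z hz => ?_
      rw [uIcc_of_le (by linarith)] at hz
      simp only [(P.layer_eq_right X hσ hσ' hz.1).2]
    simp only [intervalIntegral.integral_const, smul_eq_mul, sub_zero, one_mul] at i1
    have : 0 ≤ P.dmax * C₀ * w := by positivity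
    rw [i2]
    linarith
  · have hact := (hb σ' hσ').action τ' hτ'
    -- the action of the layer is compared with that of the profile, piece by piece
    have i1 : |∫ z in (0 : ℝ)..1, (P.layerAction X hσ hσ' τ τ' z -
        P.Dext (P.profile hσ' τ' z) * P.profileDt hσ' τ' z ^ 2)| ≤ E * Δ := by
      have := intervalIntegral.norm_integral_le_of_norm_le_const (a := (0 : ℝ)) (b := 1)
        (C := E * Δ) (f := fun z => P.layerAction X hσ hσ' τ τ' z -
          P.Dext (P.profile hσ' τ' z) * P.profileDt hσ' τ' z ^ 2) ?_
      · simpa using this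
      intro z hz
      rw [uIoc_of_le zero_le_one] at hz
      have hz' : z ∈ Icc (0 : ℝ) 1 := Ioc_subset_Icc_self hz
      obtain ⟨l1, l2⟩ := hl' z hz'
      have e : P.layerAction X hσ hσ' τ τ' z -
          P.Dext (P.profile hσ' τ' z) * P.profileDt hσ' τ' z ^ 2 =
          (P.Dext (P.layer X hσ hσ' τ τ' z) - P.Dext (P.profile hσ' τ' z)) *
            P.layerDz X hσ hσ' τ τ' z ^ 2 + P.Dext (P.profile hσ' τ' z) *
            ((P.layerDz X hσ hσ' τ τ' z - P.profileDt hσ' τ' z) *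
              (P.layerDz X hσ hσ' τ τ' z + P.profileDt hσ' τ' z)) := by
        rw [layerAction, X.window_eq_one (by linarith [hz'.1]) (by linarith [hz'.2])]
        ring
      rw [e, Real.norm_eq_abs]
      have b1 : |(P.Dext (P.layer X hσ hσ' τ τ' z) - P.Dext (P.profile hσ' τ' z)) *
          P.layerDz X hσ hσ' τ τ' z ^ 2| ≤ CD * (C₁ * Δ) * K ^ 2 := by
        rw [abs_mul, abs_pow]
        exact mul_le_mul ((hDlip _ _).trans (mul_le_mul_of_nonneg_left l1 hCD))
          (pow_le_pow_left₀ (abs_nonneg _) (hLK z hz') 2) (by positivity) (by positivity)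
      have hsum : |P.layerDz X hσ hσ' τ τ' z + P.profileDt hσ' τ' z| ≤ 2 * K := by
        refine (abs_add_le _ _).trans ?_
        have : 0 ≤ C₁ * (2 * w) := by positivity
        linarith [hLK z hz', hdt z]
      have b2 : |P.Dext (P.profile hσ' τ' z) *
            ((P.layerDz X hσ hσ' τ τ' z - P.profileDt hσ' τ' z) *
              (P.layerDz X hσ hσ' τ τ' z + P.profileDt hσ' τ' z))| ≤
          P.dmax * (C₁ * Δ * (2 * K)) := by
        rw [abs_mul, abs_of_pos (P.Dext_pos _), abs_mul]
        exact mul_le_mul (P.le_dmax _) (mul_le_mul l2 hsum (abs_nonneg _) (by positivity))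
          (by positivity) hD
      refine (abs_add_le _ _).trans ((add_le_add b1 b2).trans (le_of_eq ?_))
      rw [hE]; ring
    have i2 : |∫ z in (1 : ℝ)..τ', (P.layerAction X hσ hσ' τ τ' z -
        P.Dext (P.profile hσ' τ' z) * P.profileDt hσ' τ' z ^ 2)| ≤ P.dmax * C₀ * Δ * w := by
      have hpt : ∀ z ∈ Icc (1 : ℝ) τ', |P.layerAction X hσ hσ' τ τ' z -
          P.Dext (P.profile hσ' τ' z) * P.profileDt hσ' τ' z ^ 2| ≤
          P.dmax * C₀ * Δ * |P.profileDt hσ' τ' z| := by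
        intro z hz
        obtain ⟨l1, l2⟩ := P.layer_eq_right X hσ hσ' (τ := τ) (τ' := τ') hz.1
        rw [layerAction, l1, l2]
        have e : X.window τ τ' z * P.Dext (P.profile hσ' τ' z) * P.profileDt hσ' τ' z ^ 2 -
            P.Dext (P.profile hσ' τ' z) * P.profileDt hσ' τ' z ^ 2 =
            (X.window τ τ' z - 1) * P.Dext (P.profile hσ' τ' z) * P.profileDt hσ' τ' z *
              P.profileDt hσ' τ' z := by ring
        rw [e, abs_mul _ (P.profileDt hσ' τ' z)]
        refine mul_le_mul_of_nonneg_right ?_ (abs_nonneg _)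
        by_cases hc : z ≤ τ' - 2
        · rw [X.window_eq_one (by linarith [hz.1]) hc, sub_self, zero_mul, zero_mul, abs_zero]
          positivity
        · have hg : |X.window τ τ' z - 1| ≤ 1 := by
            have := X.window_mem (τ := τ) (τ' := τ') (z := z)
            exact abs_le.2 ⟨by linarith [this.1], by linarith [this.2]⟩
          have h1 := (hb σ' hσ').abs_dt_center_le τ' hτ' z
            (abs_le.2 ⟨by linarith [not_le.1 hc], by linarith [hz.2]⟩)
          rw [abs_mul, abs_mul, abs_of_pos (P.Dext_pos _), mul_assoc P.dmax]
          refine mul_le_mul ?_ (h1.trans (mul_le_mul_of_nonneg_left (by linarith) hC₀))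
            (abs_nonneg _) hD
          calc _ ≤ 1 * P.dmax := mul_le_mul hg (P.le_dmax _) (P.Dext_pos _).le zero_le_one
            _ = _ := one_mul _
      have h1 : (1 : ℝ) ≤ τ' := by linarith
      calc _ ≤ ∫ z in (1 : ℝ)..τ', |P.layerAction X hσ hσ' τ τ' z -
            P.Dext (P.profile hσ' τ' z) * P.profileDt hσ' τ' z ^ 2| :=
            intervalIntegral.abs_integral_le_integral_abs h1
        _ ≤ ∫ z in (1 : ℝ)..τ', P.dmax * C₀ * Δ * |P.profileDt hσ' τ' z| :=
            intervalIntegral.integral_mono_on h1 ((cA.sub cP).abs.intervalIntegrable _ _)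
              ((continuous_const.mul cZ.abs).intervalIntegrable _ _) hpt
        _ = P.dmax * C₀ * Δ * ∫ z in (1 : ℝ)..τ', |P.profileDt hσ' τ' z| :=
            intervalIntegral.integral_const_mul _ _
        _ ≤ _ := mul_le_mul_of_nonneg_left hvar (by positivity)
    have hsplit : (∫ z in (0 : ℝ)..τ', P.layerAction X hσ hσ' τ τ' z) -
        ∫ z in (0 : ℝ)..τ', P.Dext (P.profile hσ' τ' z) * P.profileDt hσ' τ' z ^ 2 =
        (∫ z in (0 : ℝ)..1, (P.layerAction X hσ hσ' τ τ' z -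
          P.Dext (P.profile hσ' τ' z) * P.profileDt hσ' τ' z ^ 2)) +
        ∫ z in (1 : ℝ)..τ', (P.layerAction X hσ hσ' τ τ' z -
          P.Dext (P.profile hσ' τ' z) * P.profileDt hσ' τ' z ^ 2) := by
      have hi : ∀ x y, IntervalIntegrable (fun z => P.layerAction X hσ hσ' τ τ' z -
          P.Dext (P.profile hσ' τ' z) * P.profileDt hσ' τ' z ^ 2) volume x y := fun x y =>
        (cA.sub cP).intervalIntegrable x y
      rw [intervalIntegral.integral_add_adjacent_intervals (hi _ _) (hi _ _),
        intervalIntegral.integral_sub (cA.intervalIntegrable _ _) (cP.intervalIntegrable _ _)]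
    rw [abs_le] at i1 i2 hact ⊢
    have h4 : C₀ * P.delta hσ' τ' ≤ C₀ * Δ := mul_le_mul_of_nonneg_left (by linarith) hC₀
    have h5 : 0 ≤ (K + w) * Δ := by positivity
    have h6 : ((K + w) + (C₀ + E + P.dmax * C₀ * w)) * Δ =
        (K + w) * Δ + C₀ * Δ + E * Δ + P.dmax * C₀ * Δ * w := by ring
    rw [h6]
    constructor <;> linarith [i1.1, i1.2, i2.1, i2.2, hact.1, hact.2]

/-- The actions of the two halves of a heteroclinic orbit add up to `S_G`. -/
theorem action_add_action {σ σ' : ℝ} (hσ : σ = 1 ∨ σ = -1) (hσσ : σ' = -σ) :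
    (σ * ∫ u in midValue P..well P σ, Real.sqrt (2 * P.Gext u)) +
      σ' * ∫ u in midValue P..well P σ', Real.sqrt (2 * P.Gext u) = SG P := by
  have hG : Continuous fun u => Real.sqrt (2 * P.Gext u) := by
    have : Continuous P.Gext :=
      continuous_iff_continuousAt.2 fun u => (P.hasDerivAt_Gext u).continuousAt
    fun_prop
  have key : (∫ u in midValue P..P.β, Real.sqrt (2 * P.Gext u)) -
      ∫ u in midValue P..P.α, Real.sqrt (2 * P.Gext u) = SG P := by
    rw [intervalIntegral.integral_interval_sub_left (hG.intervalIntegrable _ _)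
      (hG.intervalIntegrable _ _), SG]
    refine intervalIntegral.integral_congr fun u hu => ?_
    rw [uIcc_of_le P.α_lt_β.le] at hu
    simp only [P.Gext_of_mem hu]
  subst hσσ
  rcases hσ with rfl | rfl
  · rw [well_one, well_neg_one]; linarith
  · rw [neg_neg, well_one, well_neg_one]; linarith

/-- The variation of a layer is bounded, and its action is close to `S_G`. -/
theorem exists_full_layer_bound : ∃ C, 0 ≤ C ∧ ∀ (σ : ℝ) (hσ : σ = 1 ∨ σ = -1) (σ' : ℝ)
    (hσ' : σ' = 1 ∨ σ' = -1), σ' = -σ → ∀ τ τ', (P.toWell σ hσ).minTurn < τ →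
    (P.toWell σ' hσ').minTurn < τ' → 3 ≤ τ → 3 ≤ τ' →
    (∫ z in -τ..τ', |P.layerDz X hσ hσ' τ τ' z|) ≤ C ∧
    |(∫ z in -τ..τ', P.layerAction X hσ hσ' τ τ' z) - SG P| ≤
        C * (P.delta hσ τ + P.delta hσ' τ') := by
  obtain ⟨C, hC, h⟩ := P.exists_half_layer_bound X
  obtain ⟨C', hC', h'⟩ := P.exists_half_layer_bound X.flip
  refine ⟨C' + C, by positivity, ?_⟩
  intro σ hσ σ' hσ' hσσ τ τ' hτ hτ' h3 h3'
  obtain ⟨r1, r2⟩ := h σ hσ σ' hσ' hσσ τ τ' hτ hτ' h3 h3'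
  obtain ⟨l1, l2⟩ := h' σ' hσ' σ hσ (by rw [hσσ, neg_neg]) τ' τ hτ' hτ h3' h3
  have cL := (P.continuous_layerDz X hσ hσ' τ τ').abs
  have cA := P.continuous_layerAction X hσ hσ' τ τ'
  have e1 : ∫ z in -τ..0, |P.layerDz X hσ hσ' τ τ' z| =
      ∫ z in (0 : ℝ)..τ, |P.layerDz X.flip hσ' hσ τ' τ z| := by
    rw [← neg_zero, ← intervalIntegral.integral_comp_neg, neg_zero]
    refine intervalIntegral.integral_congr fun z _ => ?_
    rw [← abs_neg, ← layerDz_flip, neg_neg]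
  have e2 : ∫ z in -τ..0, P.layerAction X hσ hσ' τ τ' z =
      ∫ z in (0 : ℝ)..τ, P.layerAction X.flip hσ' hσ τ' τ z := by
    rw [← neg_zero, ← intervalIntegral.integral_comp_neg, neg_zero]
    refine intervalIntegral.integral_congr fun z _ => ?_
    rw [← layerAction_flip, neg_neg]
  rw [← intervalIntegral.integral_add_adjacent_intervals (cL.intervalIntegrable (-τ) 0)
    (cL.intervalIntegrable 0 τ'), ← intervalIntegral.integral_add_adjacent_intervals
    (cA.intervalIntegrable (-τ) 0) (cA.intervalIntegrable 0 τ'), e1, e2,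
    ← P.action_add_action hσ hσσ]
  refine ⟨add_le_add l1 r1, ?_⟩
  rw [abs_le] at l2 r2 ⊢
  constructor <;> linarith [l2.1, l2.2, r2.1, r2.2]

end Bistable

/-! ### Nodes and cells -/

section Cells

variable {a b : ℝ} {N : ℕ} {ε κ : ℝ} {h : ℕ → ℝ} {i j k : ℕ} {x : ℝ}

theorem node_of_mem (h1 : 1 ≤ j) (h2 : j ≤ N) : node a b N h j = h j := by
  rw [node, if_neg (by omega), if_neg (by omega)]

theorem node_last : node a b N h (N + 1) = 2 * b - h N := by
  rw [node, if_neg (by omega), if_pos rfl]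

theorem mid_one (hN : 1 ≤ N) : mid a b N h 1 = a := by
  rw [mid, node_of_mem le_rfl hN, node, if_pos rfl]
  ring

theorem mid_last (hN : 1 ≤ N) : mid a b N h (N + 1) = b := by
  rw [mid, node_last, Nat.add_sub_cancel, node_of_mem hN le_rfl]
  ring

/-- Consecutive nodes are more than `κ` apart. -/
def Separated (a b : ℝ) (N : ℕ) (κ : ℝ) (h : ℕ → ℝ) : Prop :=
  ∀ j ∈ Finset.Icc 1 (N + 1), κ < len a b N h j

theorem Separated.lt_len (hs : Separated a b N κ h) (h1 : 1 ≤ j) (h2 : j ≤ N + 1) :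
    κ < len a b N h j := hs j (Finset.mem_Icc.2 ⟨h1, h2⟩)

theorem Separated.node_add_lt (hs : Separated a b N κ h) (hκ : 0 ≤ κ) (hij : i < j)
    (hj : j ≤ N + 1) : node a b N h i + κ < node a b N h j := by
  induction j, hij using Nat.le_induction with
  | base =>
    have := hs.lt_len (j := i + 1) (by omega) hj
    rw [len, Nat.add_sub_cancel] at this
    linarith
  | succ n hn ih =>
    have := hs.lt_len (j := n + 1) (by omega) hj
    rw [len, Nat.add_sub_cancel] at this
    linarith [ih (by omega)]

theorem Separated.mid_lt (hs : Separated a b N κ h) (hκ : 0 ≤ κ) (hi : 1 ≤ i) (hij : i < j)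
    (hj : j ≤ N + 1) : mid a b N h i < mid a b N h j := by
  have h1 := hs.node_add_lt hκ hij hj
  have h2 := hs.node_add_lt (i := i - 1) (j := j - 1) hκ (by omega) (by omega)
  rw [mid, mid]
  linarith

theorem Separated.mid_le (hs : Separated a b N κ h) (hκ : 0 ≤ κ) (hi : 1 ≤ i) (hij : i ≤ j)
    (hj : j ≤ N + 1) : mid a b N h i ≤ mid a b N h j := by
  rcases hij.eq_or_lt with rfl | hij
  · exact le_rfl
  · exact (hs.mid_lt hκ hi hij hj).le

theorem Separated.cellIndex_eq (hs : Separated a b N κ h) (hκ : 0 ≤ κ) (h1 : 1 ≤ j) (hjN : j ≤ N)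
    (hl : j = 1 ∨ mid a b N h j < x) (hr : j = N ∨ x ≤ mid a b N h (j + 1)) :
    cellIndex a b N h x = j := by
  have : (Finset.Icc 2 N).filter (fun i => mid a b N h i < x) = Finset.Icc 2 j := by
    ext i
    simp only [Finset.mem_filter, Finset.mem_Icc]
    constructor
    · rintro ⟨⟨hi, hiN⟩, hx⟩
      refine ⟨hi, ?_⟩
      by_contra! hij
      rcases hr with rfl | hr
      · omega
      · exact absurd hx (not_lt.2 (hr.trans (hs.mid_le hκ (by omega) hij (by omega))))
    · rintro ⟨hi, hij⟩
      refine ⟨⟨hi, by omega⟩, ?_⟩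
      rcases hl with rfl | hl
      · omega
      · exact (hs.mid_le hκ (by omega) hij (by omega)).trans_lt hl
  rw [cellIndex, this, Nat.card_Icc]
  omega

theorem exists_cell (hN : 1 ≤ N) (h : ℕ → ℝ) (x : ℝ) : ∃ j, 1 ≤ j ∧ j ≤ N ∧
    (j = 1 ∨ mid a b N h j < x) ∧ (j = N ∨ x ≤ mid a b N h (j + 1)) := by
  by_contra! hc
  have key : ∀ j, 1 ≤ j → j ≤ N → (j = 1 ∨ mid a b N h j < x) := by
    intro j hj
    induction j, hj using Nat.le_induction with
    | base => exact fun _ => Or.inl rfl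
    | succ n hn ih => exact fun hnN => Or.inr (hc n hn (by omega) (ih (by omega))).2
  exact (hc N hN le_rfl (key N hN le_rfl)).1 rfl

/-- A neighbourhood of the cell `I_j`, on which `u^h` only involves the layer at `h_j`. There is no
restriction beyond the end points of `[a, b]`. -/
def InCell (a b : ℝ) (N : ℕ) (ε : ℝ) (h : ℕ → ℝ) (j : ℕ) (x : ℝ) : Prop :=
  (j = 1 ∨ node a b N h (j - 1) + ε < x) ∧ (j = N ∨ x < node a b N h (j + 1) - ε)

theorem Separated.inCell (hs : Separated a b N κ h) (hε : 0 < ε) (hκ : 2 * ε ≤ κ) (h1 : 1 ≤ j)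
    (hjN : j ≤ N) (hl : j = 1 ∨ mid a b N h j ≤ x) (hr : j = N ∨ x ≤ mid a b N h (j + 1)) :
    InCell a b N ε h j x := by
  have e1 := hs.node_add_lt (i := j - 1) (j := j) (by linarith) (by omega) (by omega)
  have e2 := hs.node_add_lt (i := j) (j := j + 1) (by linarith) (by omega) (by omega)
  refine ⟨hl.imp_right fun hl => ?_, hr.imp_right fun hr => ?_⟩
  · rw [mid] at hl; linarith
  · rw [mid, Nat.add_sub_cancel] at hr; linarith

/-- The half-period, in the rescaled variable, of the profile between the nodes `j - 1` and `j`. -/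
noncomputable def half (a b : ℝ) (N : ℕ) (ε : ℝ) (h : ℕ → ℝ) (j : ℕ) : ℝ :=
  len a b N h j / (2 * ε)

/-- The derivative of the `j`-th node in `h_k`. The nodes depend affinely on `h`, with linear part
given by the reflections at `a = b = 0`. -/
noncomputable def nodeDeriv (N k j : ℕ) : ℝ := node 0 0 N (Pi.single k 1) j

theorem hasDerivAt_node (a b : ℝ) (N : ℕ) (h : ℕ → ℝ) (k j : ℕ) :
    HasDerivAt (fun t => node a b N (Function.update h k t) j) (nodeDeriv N k j) (h k) := by
  have hu : ∀ i, HasDerivAt (fun t => Function.update h k t i) ((Pi.single k 1 : ℕ → ℝ) i)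
      (h k) := by
    intro i
    by_cases hi : i = k
    · subst hi
      simpa using hasDerivAt_id' (h i)
    · simpa [hi] using hasDerivAt_const (h k) (h i)
  unfold nodeDeriv node
  split_ifs
  · simpa using (hu 1).const_sub (2 * a)
  · simpa using (hu N).const_sub (2 * b)
  · exact hu j

theorem nodeDeriv_self (h1 : 1 ≤ k) (hk : k ≤ N) : nodeDeriv N k k = 1 := by
  rw [nodeDeriv, node_of_mem h1 hk, Pi.single_eq_same]

theorem nodeDeriv_of_ne (h1 : 1 ≤ j) (hj : j ≤ N) (hjk : j ≠ k) : nodeDeriv N k j = 0 := by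
  rw [nodeDeriv, node_of_mem h1 hj, Pi.single_eq_of_ne hjk]

theorem nodeDeriv_zero (hk : k ≠ 1) : nodeDeriv N k 0 = 0 := by
  rw [nodeDeriv, node, if_pos rfl, Pi.single_eq_of_ne hk.symm]
  norm_num

theorem nodeDeriv_last (hk : k ≠ N) : nodeDeriv N k (N + 1) = 0 := by
  rw [nodeDeriv, node_last, Pi.single_eq_of_ne hk.symm]
  norm_num

theorem abs_nodeDeriv_le (N k j : ℕ) : |nodeDeriv N k j| ≤ 1 := by
  have hu : ∀ i, |(Pi.single k 1 : ℕ → ℝ) i| ≤ 1 := by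
    intro i
    by_cases hi : i = k
    · subst hi; simp
    · simp [hi]
  unfold nodeDeriv node
  split_ifs
  · simpa using hu 1
  · simpa using hu N
  · exact hu j

end Cells

/-! ### The function `u^h` and its derivatives -/

theorem neg_one_pow_succ (j : ℕ) : (-1 : ℝ) ^ (j + 1) = -(-1) ^ j := by ring

/-- The sign `(-1)^j` of the side on which the profile between the nodes `j - 1` and `j` lies. -/
theorem sgn (j : ℕ) : (-1 : ℝ) ^ j = 1 ∨ (-1 : ℝ) ^ j = -1 := neg_one_pow_eq_or ℝ j

namespace Bistable

variable (P : Bistable) (X : Cutoff) {a b : ℝ} {N : ℕ} {ε : ℝ} {h : ℕ → ℝ} {j k : ℕ} {x : ℝ}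

/-- A half-period from which on the profiles on both sides are defined and the pieces of a cell on
which the cut-off functions vary do not overlap. -/
noncomputable def minHalf : ℝ :=
  max 3 (max (P.toWell 1 (Or.inl rfl)).minTurn (P.toWell (-1) (Or.inr rfl)).minTurn)

theorem three_le_minHalf : 3 ≤ P.minHalf := le_max_left _ _

theorem minTurn_le_minHalf {σ : ℝ} (hσ : σ = 1 ∨ σ = -1) :
    (P.toWell σ hσ).minTurn ≤ P.minHalf := by
  rcases hσ with rfl | rfl
  · exact (le_max_left _ _).trans (le_max_right _ _)
  · exact (le_max_right _ _).trans (le_max_right _ _)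

/-- The layer positions are so far apart that all profiles are defined. -/
def WellSeparated (P : Bistable) (a b : ℝ) (N : ℕ) (ε : ℝ) (h : ℕ → ℝ) : Prop :=
  Separated a b N (2 * ε * P.minHalf) h

variable {P}

theorem WellSeparated.minHalf_lt (hs : P.WellSeparated a b N ε h) (hε : 0 < ε) (h1 : 1 ≤ j)
    (hj : j ≤ N + 1) : P.minHalf < half a b N ε h j := by
  rw [half, lt_div_iff₀' (by positivity)]
  exact Separated.lt_len hs h1 hj

theorem WellSeparated.minTurn_lt (hs : P.WellSeparated a b N ε h) (hε : 0 < ε) (h1 : 1 ≤ j)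
    (hj : j ≤ N + 1) {σ : ℝ} (hσ : σ = 1 ∨ σ = -1) :
    (P.toWell σ hσ).minTurn < half a b N ε h j :=
  (P.minTurn_le_minHalf hσ).trans_lt (hs.minHalf_lt hε h1 hj)

theorem two_mul_le_minHalf (hε : 0 < ε) : 2 * ε ≤ 2 * ε * P.minHalf := by
  nlinarith [P.three_le_minHalf]

theorem WellSeparated.phiJ_eq_left (hs : P.WellSeparated a b N ε h) (hε : 0 < ε) (h1 : 1 ≤ j)
    (hj : j ≤ N + 1) (x : ℝ) : phiJ P a b N ε h j x =
      P.profile (sgn j) (half a b N ε h j) ((x - node a b N h (j - 1)) / ε) := by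
  rw [phiJ, P.phi_eq (sgn j) hε (hs.minTurn_lt hε h1 hj (sgn j)), half, mid, len]
  congr 1
  field_simp
  ring

theorem WellSeparated.phiJ_eq_right (hs : P.WellSeparated a b N ε h) (hε : 0 < ε) (h1 : 1 ≤ j)
    (hj : j ≤ N + 1) (x : ℝ) : phiJ P a b N ε h j x =
      P.profile (sgn j) (half a b N ε h j) (-((x - node a b N h j) / ε)) := by
  rw [hs.phiJ_eq_left hε h1 hj, ← P.profile_symm (sgn j) (hs.minTurn_lt hε h1 hj (sgn j)), half, len]
  congr 1
  field_simp
  ring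

variable (P)

/-- The layer at the node `j` in the original variable. -/
noncomputable def cellFun (a b : ℝ) (N : ℕ) (ε : ℝ) (h : ℕ → ℝ) (j : ℕ) (x : ℝ) : ℝ :=
  P.layer X (sgn j) (sgn (j + 1)) (half a b N ε h j) (half a b N ε h (j + 1))
    ((x - node a b N h j) / ε)

variable {P}

theorem WellSeparated.uh_eq (hs : P.WellSeparated a b N ε h) (hε : 0 < ε) (h1 : 1 ≤ j)
    (hjN : j ≤ N) (hx : InCell a b N ε h j x) :
    uh P X a b N ε h x = P.cellFun X a b N ε h j x := by
  have hκ : (0 : ℝ) ≤ 2 * ε * P.minHalf := by linarith [P.two_mul_le_minHalf hε]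
  have hκ' := P.two_mul_le_minHalf hε
  have hs' : Separated a b N (2 * ε * P.minHalf) h := hs
  obtain ⟨J, hJ1, hJN, hJl, hJr⟩ := exists_cell (a := a) (b := b) (h1.trans hjN) h x
  rw [uh, hs'.cellIndex_eq hκ hJ1 hJN hJl hJr, cellFun, layer,
    ← hs.phiJ_eq_right hε h1 (by omega)]
  have hφ := hs.phiJ_eq_left (j := j + 1) hε (by omega) (by omega) x
  rw [Nat.add_sub_cancel] at hφ
  rw [← hφ, chiJ]
  have hnode : ∀ i, 1 ≤ i → i ≤ N + 1 → node a b N h (i - 1) + 2 * ε < node a b N h i :=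
    fun i hi hi' => lt_of_le_of_lt (by linarith)
      (hs'.node_add_lt (i := i - 1) (j := i) hκ (by omega) hi')
  -- left of `h_j - ε`, and right of `h_j + ε`, only one of the two profiles is left
  have hχ0 : ∀ i, x ≤ node a b N h i - ε → X.χ ((x - node a b N h i) / ε) = 0 := fun i hi =>
    X.eq_zero _ (by rw [div_le_iff₀ hε]; linarith)
  have hχ1 : ∀ i, node a b N h i + ε ≤ x → X.χ ((x - node a b N h i) / ε) = 1 := fun i hi =>
    X.eq_one _ (by rw [le_div_iff₀ hε]; linarith)
  rw [← node_of_mem (a := a) (b := b) (h := h) hJ1 hJN]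
  rcases lt_trichotomy J j with hlt | rfl | hlt
  · have hxl : node a b N h (j - 1) + ε < x := hx.1.resolve_left (by omega)
    have hxr : x ≤ mid a b N h (J + 1) := hJr.resolve_left (by omega)
    have hJ : J + 1 = j := by
      by_contra hne
      have h2 := hs'.mid_le hκ (i := J + 1) (j := j - 1) (by omega) (by omega) (by omega)
      have h3 := hnode (j - 1) (by omega) (by omega)
      rw [mid] at h2
      rw [mid] at hxr h2
      linarith
    subst hJ
    have h3 := hnode (J + 1) (by omega) (by omega)
    rw [mid] at hxr
    rw [Nat.add_sub_cancel] at *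
    rw [hχ1 J hxl.le, hχ0 (J + 1) (by linarith)]
    ring
  · rfl
  · have hxr : x < node a b N h (j + 1) - ε := hx.2.resolve_left (by omega)
    have hxl : mid a b N h J < x := hJl.resolve_left (by omega)
    have hJ : J = j + 1 := by
      by_contra hne
      have h2 := hs'.mid_le hκ (i := j + 2) (j := J) (by omega) (by omega) (by omega)
      have h3 := hnode (j + 2) (by omega) (by omega)
      rw [mid, mid, show j + 2 - 1 = j + 1 by omega] at h2
      rw [show j + 2 - 1 = j + 1 by omega] at h3
      rw [mid] at hxl
      linarith
    subst hJ
    have h3 := hnode (j + 1) (by omega) (by omega)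
    rw [mid] at hxl
    rw [Nat.add_sub_cancel] at *
    rw [hχ1 j (by linarith), hχ0 (j + 1) hxr.le]
    ring

/-- The derivative of `u^h` along a curve in the space of the pairs `(h, x)`. -/
theorem WellSeparated.hasDerivAt_uh {H : ℝ → ℕ → ℝ} {ξ : ℝ → ℝ} {ν : ℕ → ℝ} {ξ₁ t : ℝ}
    (hs : P.WellSeparated a b N ε (H t)) (hε : 0 < ε) (h1 : 1 ≤ j) (hjN : j ≤ N)
    (hx : InCell a b N ε (H t) j (ξ t))
    (hH : ∀ i, HasDerivAt (fun t => node a b N (H t) i) (ν i) t) (hξ : HasDerivAt ξ ξ₁ t) :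
    HasDerivAt (fun t => uh P X a b N ε (H t) (ξ t))
      ((ν j - ν (j - 1)) / (2 * ε) *
          P.layerDleft X (sgn j) (half a b N ε (H t) j) ((ξ t - node a b N (H t) j) / ε) +
        (ν (j + 1) - ν j) / (2 * ε) * P.layerDright X (sgn (j + 1))
          (half a b N ε (H t) (j + 1)) ((ξ t - node a b N (H t) j) / ε) +
        (ξ₁ - ν j) / ε * P.layerDz X (sgn j) (sgn (j + 1)) (half a b N ε (H t) j)
          (half a b N ε (H t) (j + 1)) ((ξ t - node a b N (H t) j) / ε)) t := by
  have hT : ∀ i, HasDerivAt (fun t => half a b N ε (H t) i) ((ν i - ν (i - 1)) / (2 * ε)) t :=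
    fun i => ((hH i).fun_sub (hH (i - 1))).div_const _
  have hmain := P.hasDerivAt_layer X (sgn j) (sgn (j + 1)) (T := fun t => half a b N ε (H t) j)
    (T' := fun t => half a b N ε (H t) (j + 1)) (t := t) (hs.minTurn_lt hε h1 (by omega) _)
    (hs.minTurn_lt hε (by omega) (by omega) _) (hT j) (hT (j + 1))
    ((hξ.fun_sub (hH j)).div_const ε)
  rw [Nat.add_sub_cancel] at hmain
  refine hmain.congr_of_eventuallyEq ?_
  have hsep : ∀ᶠ t' in nhds t, P.WellSeparated a b N ε (H t') := by
    refine (Filter.eventually_all_finset _).2 fun i hi => ?_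
    exact ((hH i).fun_sub (hH (i - 1))).continuousAt.eventually_const_lt (hs i hi)
  have hcell : ∀ᶠ t' in nhds t, InCell a b N ε (H t') j (ξ t') := by
    refine Filter.Eventually.and ?_ ?_
    · rcases hx.1 with h | h
      · exact Filter.Eventually.of_forall fun _ => Or.inl h
      · exact (((hH (j - 1)).continuousAt.add_const ε).eventually_lt hξ.continuousAt h).mono
          fun _ => Or.inr
    · rcases hx.2 with h | h
      · exact Filter.Eventually.of_forall fun _ => Or.inl h
      · exact (hξ.continuousAt.eventually_lt ((hH (j + 1)).continuousAt.sub_const ε) h).mono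
          fun _ => Or.inr
  filter_upwards [hsep, hcell] with t' h2 h3
  exact h2.uh_eq X hε h1 hjN h3

theorem WellSeparated.hasDerivAt_uh_x (hs : P.WellSeparated a b N ε h) (hε : 0 < ε) (h1 : 1 ≤ j)
    (hjN : j ≤ N) (hx : InCell a b N ε h j x) :
    HasDerivAt (uh P X a b N ε h)
      (ε⁻¹ * P.layerDz X (sgn j) (sgn (j + 1)) (half a b N ε h j) (half a b N ε h (j + 1))
        ((x - node a b N h j) / ε)) x := by
  refine (WellSeparated.hasDerivAt_uh X (H := fun _ => h) (ξ := id) (ν := fun _ => 0) hs hε h1 hjN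
    hx (fun i => hasDerivAt_const _ _) (hasDerivAt_id x)).congr_deriv ?_
  simp

theorem WellSeparated.hasDerivAt_uh_update (hs : P.WellSeparated a b N ε h) (hε : 0 < ε)
    (h1 : 1 ≤ j) (hjN : j ≤ N) (hx : InCell a b N ε h j x) (k : ℕ) :
    HasDerivAt (fun t => uh P X a b N ε (Function.update h k t) x)
      (-(ε⁻¹ * (nodeDeriv N k j * P.layerDz X (sgn j) (sgn (j + 1)) (half a b N ε h j)
          (half a b N ε h (j + 1)) ((x - node a b N h j) / ε) -
        (nodeDeriv N k j - nodeDeriv N k (j - 1)) / 2 *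
          P.layerDleft X (sgn j) (half a b N ε h j) ((x - node a b N h j) / ε) -
        (nodeDeriv N k (j + 1) - nodeDeriv N k j) / 2 * P.layerDright X (sgn (j + 1))
          (half a b N ε h (j + 1)) ((x - node a b N h j) / ε)))) (h k) := by
  have hh : Function.update h k (h k) = h := Function.update_eq_self k h
  have := WellSeparated.hasDerivAt_uh X (H := fun t => Function.update h k t) (ξ := fun _ => x)
    (t := h k) (by rwa [hh]) hε h1 hjN (by rwa [hh]) (fun i => hasDerivAt_node a b N h k i)
    (hasDerivAt_const _ x)
  simp only [hh] at this
  refine this.congr_deriv ?_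
  field_simp
  ring

/-! ### The entries of the matrix -/

variable (P) in
/-- The product `u^h_k τ^h_j`, up to the factor `ε⁻²`, in the coordinate `z = (x - h_j) / ε`. -/
noncomputable def cellIntegrand (a b : ℝ) (N : ℕ) (ε : ℝ) (h : ℕ → ℝ) (k j : ℕ) (z : ℝ) : ℝ :=
  X.window (half a b N ε h j) (half a b N ε h (j + 1)) z *
    P.Dext (P.layer X (sgn j) (sgn (j + 1)) (half a b N ε h j) (half a b N ε h (j + 1)) z) *
    P.layerDz X (sgn j) (sgn (j + 1)) (half a b N ε h j) (half a b N ε h (j + 1)) z *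
    (nodeDeriv N k j *
      P.layerDz X (sgn j) (sgn (j + 1)) (half a b N ε h j) (half a b N ε h (j + 1)) z -
      (nodeDeriv N k j - nodeDeriv N k (j - 1)) / 2 *
        P.layerDleft X (sgn j) (half a b N ε h j) z -
      (nodeDeriv N k (j + 1) - nodeDeriv N k j) / 2 *
        P.layerDright X (sgn (j + 1)) (half a b N ε h (j + 1)) z)

theorem continuous_cellIntegrand (a b : ℝ) (N : ℕ) (ε : ℝ) (h : ℕ → ℝ) (k j : ℕ) :
    Continuous (P.cellIntegrand X a b N ε h k j) := by
  have h1 := X.continuous_window (τ := half a b N ε h j) (τ' := half a b N ε h (j + 1))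
  have h2 := P.continuous_Dext
  have h3 := P.continuous_layer X (sgn j) (sgn (j + 1)) (half a b N ε h j) (half a b N ε h (j + 1))
  have h4 := P.continuous_layerDz X (sgn j) (sgn (j + 1)) (half a b N ε h j)
    (half a b N ε h (j + 1))
  have h5 := P.continuous_layerDleft X (sgn j) (half a b N ε h j)
  have h6 := P.continuous_layerDright X (sgn (j + 1)) (half a b N ε h (j + 1))
  unfold cellIntegrand
  fun_prop

theorem gammaJ_eq (hε : 0 < ε) (a b : ℝ) (N : ℕ) (h : ℕ → ℝ) (j : ℕ) (x : ℝ) :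
    gammaJ X a b N ε h j x = X.window (half a b N ε h j) (half a b N ε h (j + 1))
      ((x - node a b N h j) / ε) := by
  rw [gammaJ, Cutoff.window, half, half, len, len, mid, mid, Nat.add_sub_cancel]
  congr 2
  · field_simp
    ring
  · congr 2
    field_simp
    ring

theorem WellSeparated.mul_tau_eq (hs : P.WellSeparated a b N ε h) (hε : 0 < ε) (h1 : 1 ≤ j)
    (hjN : j ≤ N) (k : ℕ) (x : ℝ) :
    uhPartial P X a b N ε h k x * tau P X a b N ε h j x =
      ε⁻¹ ^ 2 * P.cellIntegrand X a b N ε h k j (x / ε - node a b N h j / ε) := by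
  rw [← sub_div, tau, gammaJ_eq X hε]
  set z := (x - node a b N h j) / ε with hz
  by_cases hmem : z ∈ Ioo (-half a b N ε h j) (half a b N ε h (j + 1))
  · have hx : InCell a b N ε h j x := by
      refine Separated.inCell hs hε (P.two_mul_le_minHalf hε) h1 hjN (Or.inr ?_) (Or.inr ?_)
      · have := hmem.1
        rw [hz, half, len, lt_div_iff₀ hε] at this
        rw [mid]
        field_simp at this
        linarith
      · have := hmem.2
        rw [hz, half, len, div_lt_iff₀ hε, Nat.add_sub_cancel] at this
        rw [mid, Nat.add_sub_cancel]
        field_simp at this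
        linarith
    have hu := hs.uh_eq X hε h1 hjN hx
    rw [uhPartial, (hs.hasDerivAt_uh_update X hε h1 hjN hx k).deriv,
      (hs.hasDerivAt_uh_x X hε h1 hjN hx).deriv, hu, cellFun, ← hz, ← P.Dext_of_mem
      (P.layer_mem X (sgn j) (sgn (j + 1)) (hs.minTurn_lt hε h1 (by omega) _)
        (hs.minTurn_lt hε (by omega) (by omega) _) z), cellIntegrand]
    ring
  · rw [cellIntegrand, Cutoff.window_eq_zero hmem]
    ring

theorem WellSeparated.intervalIntegrable (hs : P.WellSeparated a b N ε h) (hε : 0 < ε)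
    (h1 : 1 ≤ j) (hjN : j ≤ N) (k : ℕ) : IntervalIntegrable
      (fun x => uhPartial P X a b N ε h k x * tau P X a b N ε h j x) volume a b := by
  simp only [hs.mul_tau_eq X hε h1 hjN k]
  have := continuous_cellIntegrand (P := P) X a b N ε h k j
  exact Continuous.intervalIntegrable (by fun_prop) _ _

theorem WellSeparated.entry_eq (hs : P.WellSeparated a b N ε h) (hε : 0 < ε) (h1 : 1 ≤ j)
    (hjN : j ≤ N) (k : ℕ) : entry P X a b N ε h k j =
      ε⁻¹ * ∫ z in -half a b N ε h j..half a b N ε h (j + 1),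
        P.cellIntegrand X a b N ε h k j z := by
  have hκ : (0 : ℝ) ≤ 2 * ε * P.minHalf := by linarith [P.two_mul_le_minHalf hε]
  have hsupp : Function.support (P.cellIntegrand X a b N ε h k j) ⊆
      Ioo (-half a b N ε h j) (half a b N ε h (j + 1)) := by
    intro z hz
    by_contra hc
    exact hz (by rw [cellIntegrand, Cutoff.window_eq_zero hc]; ring)
  have ha : a ≤ mid a b N h j := by
    have := Separated.mid_le hs hκ le_rfl h1 (by omega)
    rwa [mid_one (h1.trans hjN)] at this
  have hb : mid a b N h (j + 1) ≤ b := by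
    have := Separated.mid_le hs hκ (i := j + 1) (by omega) (Nat.succ_le_succ hjN) le_rfl
    rwa [mid_last (h1.trans hjN)] at this
  have e1 : a / ε - node a b N h j / ε ≤ -half a b N ε h j := by
    rw [mid] at ha
    rw [half, len, ← sub_div, div_le_iff₀ hε]
    field_simp
    linarith
  have e2 : half a b N ε h (j + 1) ≤ b / ε - node a b N h j / ε := by
    rw [mid, Nat.add_sub_cancel] at hb
    rw [half, len, ← sub_div, le_div_iff₀ hε, Nat.add_sub_cancel]
    field_simp
    linarith
  simp only [entry, hs.mul_tau_eq X hε h1 hjN k]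
  rw [intervalIntegral.integral_const_mul, intervalIntegral.integral_comp_div_sub
    (P.cellIntegrand X a b N ε h k j) hε.ne', smul_eq_mul,
    intervalIntegral.integral_eq_integral_of_support_subset
      (hsupp.trans ((Ioo_subset_Ioo e1 e2).trans Ioo_subset_Ioc_self)),
    intervalIntegral.integral_eq_integral_of_support_subset (hsupp.trans Ioo_subset_Ioc_self),
    ← mul_assoc]
  congr 1
  field_simp

end Bistable

/-! ### Estimates for the entries -/

theorem rate_nonneg (P : Bistable) : 0 ≤ rate P := by
  have h : ∀ γ ∈ Icc P.α P.β, 0 ≤ rateAt P γ := fun γ hγ =>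
    div_nonneg (Real.sqrt_nonneg _) (P.D_pos (P.Icc_subset hγ)).le
  exact le_min (h _ (left_mem_Icc.2 P.α_lt_β.le)) (h _ (right_mem_Icc.2 P.α_lt_β.le))

namespace Bistable

variable {P : Bistable} (X : Cutoff) {a b : ℝ} {N : ℕ} {ε : ℝ} {h : ℕ → ℝ} {j : ℕ}

theorem WellSeparated.deltaJ_eq (hs : P.WellSeparated a b N ε h) (hε : 0 < ε) (h1 : 1 ≤ j)
    (hj : j ≤ N + 1) : deltaJ P a b N ε h j = P.delta (sgn j) (half a b N ε h j) := by
  have key : ∀ (σ : ℝ) (hσ : σ = 1 ∨ σ = -1), P.delta hσ (half a b N ε h j) =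
      σ * (well P σ - phi P ε (len a b N h j) σ 0) := fun σ hσ => by
    rw [P.phi_eq hσ hε (hs.minTurn_lt hε h1 hj hσ), zero_div, zero_add]
    rfl
  rw [key, deltaJ]
  split_ifs with hodd
  · rw [hodd.neg_one_pow, well_neg_one]
    ring
  · rw [(Nat.not_odd_iff_even.1 hodd).neg_one_pow, well_one]
    ring

theorem WellSeparated.deltaJ_nonneg (hs : P.WellSeparated a b N ε h) (hε : 0 < ε) (h1 : 1 ≤ j)
    (hj : j ≤ N + 1) : 0 ≤ deltaJ P a b N ε h j := by
  rw [hs.deltaJ_eq hε h1 hj]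
  exact P.delta_nonneg _ (hs.minTurn_lt hε h1 hj _)

theorem WellSeparated.wellDefined (hs : P.WellSeparated a b N ε h) (hε : 0 < ε) (hN : 1 ≤ N) :
    WellDefined P X a b N ε h := by
  have hcell : ∀ x, ∃ j, 1 ≤ j ∧ j ≤ N ∧ InCell a b N ε h j x := fun x => by
    obtain ⟨j, h1, hjN, hl, hr⟩ := exists_cell (a := a) (b := b) hN h x
    exact ⟨j, h1, hjN, Separated.inCell hs hε (P.two_mul_le_minHalf hε) h1 hjN
      (hl.imp_right le_of_lt) hr⟩
  refine ⟨fun j hj => ?_, fun x _ => ?_, fun k _ x _ => ?_, fun k _ j hj => ?_⟩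
  · obtain ⟨h1, h2⟩ := Finset.mem_Icc.1 hj
    exact P.existsUnique_isWellProfile (sgn j) hε (hs.minTurn_lt hε h1 h2 _)
  · obtain ⟨j, h1, hjN, hx⟩ := hcell x
    exact (hs.hasDerivAt_uh_x X hε h1 hjN hx).differentiableAt
  · obtain ⟨j, h1, hjN, hx⟩ := hcell x
    exact (hs.hasDerivAt_uh_update X hε h1 hjN hx k).differentiableAt
  · obtain ⟨h1, h2⟩ := Finset.mem_Icc.1 hj
    exact hs.intervalIntegrable X hε h1 h2 k

variable (P)

theorem abs_layerDleft_le {C σ τ z : ℝ} {hσ : σ = 1 ∨ σ = -1} (hb : P.ProfileBounds hσ C)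
    (hC : 0 ≤ C) (hτ : (P.toWell σ hσ).minTurn < τ) (hz : -τ ≤ z) :
    |P.layerDleft X hσ τ z| ≤ C * P.delta hσ τ := by
  have hδ := mul_nonneg hC (P.delta_nonneg hσ hτ)
  rw [layerDleft]
  rcases le_total z 1 with h1 | h1
  · have hm := X.mem_Icc z
    rw [abs_mul]
    calc _ ≤ 1 * (C * P.delta hσ τ) := mul_le_mul
          (abs_le.2 ⟨by linarith [hm.2], by linarith [hm.1]⟩)
          (hb.abs_dtau_le τ hτ (-z) ⟨by linarith, by linarith⟩) (abs_nonneg _) zero_le_one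
      _ = _ := one_mul _
  · rw [X.eq_one z h1, sub_self, zero_mul, abs_zero]
    exact hδ

theorem abs_layerDright_le {C σ τ z : ℝ} {hσ : σ = 1 ∨ σ = -1} (hb : P.ProfileBounds hσ C)
    (hC : 0 ≤ C) (hτ : (P.toWell σ hσ).minTurn < τ) (hz : z ≤ τ) :
    |P.layerDright X hσ τ z| ≤ C * P.delta hσ τ := by
  have hδ := mul_nonneg hC (P.delta_nonneg hσ hτ)
  rw [layerDright]
  rcases le_total (-1) z with h1 | h1
  · have hm := X.mem_Icc z
    rw [abs_mul]
    calc _ ≤ 1 * (C * P.delta hσ τ) := mul_le_mul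
          (abs_le.2 ⟨by linarith [hm.1], hm.2⟩)
          (hb.abs_dtau_le τ hτ z ⟨h1, hz⟩) (abs_nonneg _) zero_le_one
      _ = _ := one_mul _
  · rw [X.eq_zero z h1, zero_mul, abs_zero]
    exact hδ

/-- Up to exponentially small terms, an entry is the action of the layer `j` times the derivative
of the node `j` in `h_k`. The error comes from the change of the lengths of the two adjacent
intervals. -/
theorem exists_entry_bound : ∃ C, 0 ≤ C ∧ ∀ (a b : ℝ) (N : ℕ) (ε : ℝ) (h : ℕ → ℝ), 0 < ε →
    P.WellSeparated a b N ε h → ∀ j, 1 ≤ j → j ≤ N → ∃ S,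
      |S - SG P| ≤ C * (deltaJ P a b N ε h j + deltaJ P a b N ε h (j + 1)) ∧
      ∀ k, |entry P X a b N ε h k j - ε⁻¹ * (nodeDeriv N k j * S)| ≤
        ε⁻¹ * (C * (|nodeDeriv N k j - nodeDeriv N k (j - 1)| * deltaJ P a b N ε h j +
          |nodeDeriv N k (j + 1) - nodeDeriv N k j| * deltaJ P a b N ε h (j + 1))) := by
  obtain ⟨C₀, hC₀, hb⟩ := P.exists_profileBounds
  obtain ⟨V, hV, hfull⟩ := P.exists_full_layer_bound X
  have hD := P.dmax_nonneg
  refine ⟨V + P.dmax * C₀ * V, by positivity, ?_⟩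
  intro a b N ε h hε hs j h1 hjN
  have t1 := hs.minTurn_lt hε h1 (by omega) (sgn j)
  have t2 := hs.minTurn_lt hε (j := j + 1) (by omega) (by omega) (sgn (j + 1))
  have m1 := P.three_le_minHalf.trans (hs.minHalf_lt hε h1 (by omega)).le
  have m2 := P.three_le_minHalf.trans (hs.minHalf_lt hε (j := j + 1) (by omega) (by omega)).le
  obtain ⟨v1, v2⟩ := hfull _ (sgn j) _ (sgn (j + 1)) (neg_one_pow_succ j) _ _ t1 t2 m1 m2
  rw [hs.deltaJ_eq hε h1 (by omega), hs.deltaJ_eq hε (j := j + 1) (by omega) (by omega)]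
  have d1 := P.delta_nonneg _ t1
  have d2 := P.delta_nonneg _ t2
  set δ := P.delta (sgn j) (half a b N ε h j) with hδ
  set δ' := P.delta (sgn (j + 1)) (half a b N ε h (j + 1)) with hδ'
  set τ := half a b N ε h j with hτ
  set τ' := half a b N ε h (j + 1) with hτ'
  refine ⟨∫ z in -τ..τ', P.layerAction X (sgn j) (sgn (j + 1)) τ τ' z, ?_, fun k => ?_⟩
  · refine v2.trans (mul_le_mul_of_nonneg_right ?_ (by positivity))
    have : 0 ≤ P.dmax * C₀ * V := by positivity
    linarith
  set c := nodeDeriv N k j - nodeDeriv N k (j - 1) with hc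
  set c' := nodeDeriv N k (j + 1) - nodeDeriv N k j with hc'
  set R := |c| * δ + |c'| * δ' with hR
  have hR0 : 0 ≤ R := by positivity
  have cA := P.continuous_layerAction X (sgn j) (sgn (j + 1)) τ τ'
  have cL := P.continuous_layerDz X (sgn j) (sgn (j + 1)) τ τ'
  have cB : Continuous fun z => nodeDeriv N k j *
      P.layerAction X (sgn j) (sgn (j + 1)) τ τ' z := continuous_const.mul cA
  have cI := continuous_cellIntegrand (P := P) X a b N ε h k j
  have hle : -τ ≤ τ' := by linarith
  have hpt : ∀ z ∈ Icc (-τ) τ', |P.cellIntegrand X a b N ε h k j z -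
      nodeDeriv N k j * P.layerAction X (sgn j) (sgn (j + 1)) τ τ' z| ≤
      P.dmax * C₀ * R * |P.layerDz X (sgn j) (sgn (j + 1)) τ τ' z| := by
    intro z hz
    have e : P.cellIntegrand X a b N ε h k j z -
        nodeDeriv N k j * P.layerAction X (sgn j) (sgn (j + 1)) τ τ' z =
        -(X.window τ τ' z * P.Dext (P.layer X (sgn j) (sgn (j + 1)) τ τ' z) *
          (c / 2 * P.layerDleft X (sgn j) τ z + c' / 2 * P.layerDright X (sgn (j + 1)) τ' z) *
          P.layerDz X (sgn j) (sgn (j + 1)) τ τ' z) := by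
      rw [cellIntegrand, layerAction]
      ring
    have b1 := P.abs_layerDleft_le X (hb _ (sgn j)) hC₀ t1 hz.1
    have b2 := P.abs_layerDright_le X (hb _ (sgn (j + 1))) hC₀ t2 hz.2
    have b3 : |c / 2 * P.layerDleft X (sgn j) τ z + c' / 2 * P.layerDright X (sgn (j + 1)) τ' z| ≤
        C₀ * R := by
      refine (abs_add_le _ _).trans ?_
      rw [abs_mul, abs_mul, abs_div, abs_div, abs_two]
      have g1 := mul_le_mul_of_nonneg_left b1 (abs_nonneg c)
      have g2 := mul_le_mul_of_nonneg_left b2 (abs_nonneg c')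
      have g3 : 0 ≤ C₀ * R := by positivity
      have g4 : |c| * (C₀ * δ) + |c'| * (C₀ * δ') = C₀ * R := by rw [hR]; ring
      linarith
    have hw := X.window_mem (τ := τ) (τ' := τ') (z := z)
    rw [e, abs_neg, abs_mul, mul_assoc P.dmax]
    refine mul_le_mul_of_nonneg_right ?_ (abs_nonneg _)
    rw [abs_mul, abs_mul, abs_of_nonneg hw.1, abs_of_pos (P.Dext_pos _)]
    refine mul_le_mul ?_ b3 (abs_nonneg _) hD
    calc _ ≤ 1 * P.dmax := mul_le_mul hw.2 (P.le_dmax _) (P.Dext_pos _).le zero_le_one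
      _ = _ := one_mul _
  have hint : |(∫ z in -τ..τ', P.cellIntegrand X a b N ε h k j z) - nodeDeriv N k j *
      ∫ z in -τ..τ', P.layerAction X (sgn j) (sgn (j + 1)) τ τ' z| ≤ P.dmax * C₀ * R * V := by
    rw [← intervalIntegral.integral_const_mul, ← intervalIntegral.integral_sub
      (cI.intervalIntegrable _ _) (cB.intervalIntegrable _ _)]
    calc _ ≤ ∫ z in -τ..τ', |P.cellIntegrand X a b N ε h k j z -
          nodeDeriv N k j * P.layerAction X (sgn j) (sgn (j + 1)) τ τ' z| :=
          intervalIntegral.abs_integral_le_integral_abs hle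
      _ ≤ ∫ z in -τ..τ', P.dmax * C₀ * R * |P.layerDz X (sgn j) (sgn (j + 1)) τ τ' z| :=
          intervalIntegral.integral_mono_on hle
            ((cI.sub cB).abs.intervalIntegrable _ _)
            ((continuous_const.mul cL.abs).intervalIntegrable _ _) hpt
      _ = P.dmax * C₀ * R * ∫ z in -τ..τ', |P.layerDz X (sgn j) (sgn (j + 1)) τ τ' z| :=
          intervalIntegral.integral_const_mul _ _
      _ ≤ _ := mul_le_mul_of_nonneg_left v1 (by positivity)
  rw [hs.entry_eq X hε h1 hjN k, ← mul_sub, abs_mul, abs_of_pos (inv_pos.2 hε)]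
  refine mul_le_mul_of_nonneg_left (hint.trans ?_) (inv_pos.2 hε).le
  have : 0 ≤ V * R := by positivity
  linarith

theorem exists_deltaJ_le : ∃ C, 0 ≤ C ∧ ∀ (a b : ℝ) (N : ℕ) (ε : ℝ) (h : ℕ → ℝ), 0 < ε →
    P.WellSeparated a b N ε h → ∀ j, 1 ≤ j → j ≤ N + 1 → ∀ l ≤ len a b N h j,
      deltaJ P a b N ε h j ≤ C * Real.exp (-(rate P * l / (2 * ε))) := by
  obtain ⟨C, hC, hb⟩ := P.exists_profileBounds
  refine ⟨C, hC, fun a b N ε h hε hs j h1 hj l hl => ?_⟩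
  rw [hs.deltaJ_eq hε h1 hj]
  refine ((hb _ (sgn j)).delta_le _ (hs.minTurn_lt hε h1 hj _)).trans
    (mul_le_mul_of_nonneg_left (Real.exp_le_exp.2 (neg_le_neg ?_)) hC)
  rw [half, ← mul_div_assoc]
  exact div_le_div_of_nonneg_right (mul_le_mul_of_nonneg_left hl (rate_nonneg P)) (by positivity)

theorem wellSeparated_of_mem_Omega {P : Bistable} {ρ : ℝ} (hε : 0 < ε) (hρ : 0 < ρ)
    (hρ' : ρ < (2 * P.minHalf)⁻¹) (hh : h ∈ Omega a b N ε ρ) : P.WellSeparated a b N ε h := by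
  intro j hj
  have hm := P.three_le_minHalf
  refine lt_trans ?_ (hh.2.2.2 j hj)
  have h1 : 2 * P.minHalf < ρ⁻¹ := (lt_inv_comm₀ hρ (by positivity)).1 hρ'
  rw [div_eq_mul_inv]
  calc 2 * ε * P.minHalf = ε * (2 * P.minHalf) := by ring
    _ < _ := mul_lt_mul_of_pos_left h1 hε

end Bistable

end LayerDynamics

theorem mainTheorem2 (P : LayerDynamics.Bistable) (X : LayerDynamics.Cutoff)
    (a b : ℝ) (hab : a < b) (N : ℕ) (hN : 1 ≤ N) :
    ∃ ρbar C₁ C₂ : ℝ, 0 < ρbar ∧ 0 < C₁ ∧ 0 < C₂ ∧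
      ∀ ε ρ : ℝ, 0 < ε → 0 < ρ → ρ < ρbar → ∀ h ∈ LayerDynamics.Omega a b N ε ρ,
        LayerDynamics.WellDefined P X a b N ε h ∧
        (∀ j ∈ Finset.Icc 1 N,
          |LayerDynamics.entry P X a b N ε h j j - ε⁻¹ * LayerDynamics.SG P|
              ≤ C₁ * ε⁻¹ * max (LayerDynamics.deltaJ P a b N ε h j)
                  (LayerDynamics.deltaJ P a b N ε h (j + 1)) ∧
          C₁ * ε⁻¹ * max (LayerDynamics.deltaJ P a b N ε h j)
                  (LayerDynamics.deltaJ P a b N ε h (j + 1))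
              ≤ C₂ * ε⁻¹ * Real.exp (-(LayerDynamics.rate P *
                  min (LayerDynamics.len a b N h j) (LayerDynamics.len a b N h (j + 1))
                    / (2 * ε)))) ∧
        (∀ j ∈ Finset.Icc 1 (N - 1),
          |LayerDynamics.entry P X a b N ε h j (j + 1)|
                + |LayerDynamics.entry P X a b N ε h (j + 1) j|
              ≤ C₁ * ε⁻¹ * LayerDynamics.deltaJ P a b N ε h (j + 1) ∧
          C₁ * ε⁻¹ * LayerDynamics.deltaJ P a b N ε h (j + 1)
              ≤ C₂ * ε⁻¹ * Real.exp (-(LayerDynamics.rate P *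
                  LayerDynamics.len a b N h (j + 1) / (2 * ε)))) ∧
        (∀ k ∈ Finset.Icc 1 N, ∀ j ∈ Finset.Icc 1 N, 1 < |(k : ℤ) - (j : ℤ)| →
          LayerDynamics.entry P X a b N ε h k j = 0) := by
  open LayerDynamics in
  obtain ⟨C, hC, hentry⟩ := P.exists_entry_bound X
  obtain ⟨C', hC', hdelta⟩ := P.exists_deltaJ_le
  have hm := P.three_le_minHalf
  refine ⟨(2 * P.minHalf)⁻¹, 6 * C + 1, (6 * C + 1) * (C' + 1), by positivity, by positivity,
    by positivity, ?_⟩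
  intro ε ρ hε hρ hρ' h hh
  have hs := Bistable.wellSeparated_of_mem_Omega hε hρ hρ' hh
  have hε' : 0 < ε⁻¹ := inv_pos.2 hε
  have hexp : ∀ {δ l : ℝ}, δ ≤ C' * Real.exp (-(rate P * l / (2 * ε))) →
      (6 * C + 1) * ε⁻¹ * δ ≤
        (6 * C + 1) * (C' + 1) * ε⁻¹ * Real.exp (-(rate P * l / (2 * ε))) := by
    intro δ l hδ
    have h0 := Real.exp_pos (-(rate P * l / (2 * ε)))
    calc (6 * C + 1) * ε⁻¹ * δ
        ≤ (6 * C + 1) * ε⁻¹ * ((C' + 1) * Real.exp (-(rate P * l / (2 * ε)))) :=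
          mul_le_mul_of_nonneg_left (by linarith) (by positivity)
      _ = _ := by ring
  refine ⟨hs.wellDefined X hε hN, fun j hj => ?_, fun j hj => ?_, fun k hk j hj hkj => ?_⟩
  · obtain ⟨h1, hjN⟩ := Finset.mem_Icc.1 hj
    have d1 := hdelta a b N ε h hε hs j h1 (by omega) _ (min_le_left _ (len a b N h (j + 1)))
    have d2 := hdelta a b N ε h hε hs (j + 1) (by omega) (by omega) _
      (min_le_right (len a b N h j) _)
    refine ⟨?_, hexp (max_le d1 d2)⟩
    have p1 := hs.deltaJ_nonneg hε h1 (by omega)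
    have p2 := hs.deltaJ_nonneg hε (j := j + 1) (by omega) (by omega)
    obtain ⟨S, hS, hE⟩ := hentry a b N ε h hε hs j h1 hjN
    have hE := hE j
    rw [nodeDeriv_self h1 hjN, one_mul] at hE
    set δ := deltaJ P a b N ε h j
    set δ' := deltaJ P a b N ε h (j + 1)
    -- the derivatives of the lengths are `±1`, except at the first and the last layer, where the
    -- reflected node moves too and they are `±2`
    have c1 : |1 - nodeDeriv N j (j - 1)| ≤ 2 :=
      (abs_sub _ _).trans (by rw [abs_one]; linarith [abs_nodeDeriv_le N j (j - 1)])
    have c2 : |nodeDeriv N j (j + 1) - 1| ≤ 2 :=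
      (abs_sub _ _).trans (by rw [abs_one]; linarith [abs_nodeDeriv_le N j (j + 1)])
    have e : entry P X a b N ε h j j - ε⁻¹ * SG P =
        (entry P X a b N ε h j j - ε⁻¹ * S) + ε⁻¹ * (S - SG P) := by ring
    rw [e]
    refine (abs_add_le _ _).trans ((add_le_add hE (abs_mul _ _).le).trans ?_)
    rw [abs_of_pos hε', ← mul_add, mul_comm (6 * C + 1), mul_assoc ε⁻¹]
    refine mul_le_mul_of_nonneg_left ?_ hε'.le
    have q1 : |1 - nodeDeriv N j (j - 1)| * δ ≤ 2 * max δ δ' :=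
      mul_le_mul c1 (le_max_left _ _) p1 zero_le_two
    have q2 : |nodeDeriv N j (j + 1) - 1| * δ' ≤ 2 * max δ δ' :=
      mul_le_mul c2 (le_max_right _ _) p2 zero_le_two
    have q3 : δ + δ' ≤ 2 * max δ δ' := by linarith [le_max_left δ δ', le_max_right δ δ']
    have q4 : 0 ≤ max δ δ' := p1.trans (le_max_left _ _)
    calc _ ≤ C * (2 * max δ δ' + 2 * max δ δ') + C * (2 * max δ δ') :=
          add_le_add (mul_le_mul_of_nonneg_left (add_le_add q1 q2) hC)
            (hS.trans (mul_le_mul_of_nonneg_left q3 hC))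
      _ ≤ _ := by linarith
  · obtain ⟨h1, hjN⟩ := Finset.mem_Icc.1 hj
    have d2 := hdelta a b N ε h hε hs (j + 1) (by omega) (by omega) _ le_rfl
    refine ⟨?_, hexp d2⟩
    have p2 := hs.deltaJ_nonneg hε (j := j + 1) (by omega) (by omega)
    obtain ⟨S, -, hE⟩ := hentry a b N ε h hε hs (j + 1) (by omega) (by omega)
    obtain ⟨S', -, hE'⟩ := hentry a b N ε h hε hs j h1 (by omega)
    have hE := hE j
    have hE' := hE' (j + 1)
    have z1 : nodeDeriv N j (j + 1 + 1) = 0 := by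
      rcases eq_or_ne (j + 1) N with hN' | hN'
      · rw [hN']; exact nodeDeriv_last (by omega)
      · exact nodeDeriv_of_ne (by omega) (by omega) (by omega)
    have z2 : nodeDeriv N (j + 1) (j - 1) = 0 := by
      rcases eq_or_ne j 1 with rfl | hj1
      · exact nodeDeriv_zero (by omega)
      · exact nodeDeriv_of_ne (by omega) (by omega) (by omega)
    rw [Nat.add_sub_cancel, z1, nodeDeriv_self h1 (by omega),
      nodeDeriv_of_ne (j := j + 1) (k := j) (by omega) (by omega) (by omega)] at hE
    rw [z2, nodeDeriv_self (k := j + 1) (by omega) (by omega),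
      nodeDeriv_of_ne (j := j) (k := j + 1) h1 (by omega) (by omega)] at hE'
    norm_num at hE hE'
    set δ := deltaJ P a b N ε h (j + 1)
    have : 0 ≤ ε⁻¹ * (C * δ) := by positivity
    have : 0 ≤ ε⁻¹ * δ := by positivity
    calc _ ≤ ε⁻¹ * (C * δ) + ε⁻¹ * (C * δ) := add_le_add hE hE'
      _ ≤ 6 * (ε⁻¹ * (C * δ)) + ε⁻¹ * δ := by linarith
      _ = _ := by ring
  · obtain ⟨k1, kN⟩ := Finset.mem_Icc.1 hk
    obtain ⟨h1, hjN⟩ := Finset.mem_Icc.1 hj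
    have hkj' : k + 1 < j ∨ j + 1 < k := by
      rcases lt_abs.1 hkj with h' | h' <;> omega
    obtain ⟨S, -, hE⟩ := hentry a b N ε h hε hs j h1 hjN
    have hE := hE k
    have z1 : nodeDeriv N k (j + 1) = 0 := by
      rcases eq_or_ne j N with rfl | hN'
      · exact nodeDeriv_last (by omega)
      · exact nodeDeriv_of_ne (by omega) (by omega) (by omega)
    have z2 : nodeDeriv N k (j - 1) = 0 := by
      rcases eq_or_ne j 1 with rfl | hj1
      · exact nodeDeriv_zero (by omega)
      · exact nodeDeriv_of_ne (by omega) (by omega) (by omega)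
    rw [z1, z2, nodeDeriv_of_ne h1 hjN (by omega)] at hE
    norm_num at hE
    exact hE
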